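/- Work in $\mathbf P^2=\mathbf P^2(\mathbf C)$ with homogeneous coordinates $(x,y,z)$. An irreducible plane curve $C$ of degree $d$ is of type $(d,\nu)$ if the maximal multiplicity of its singular points (points of multiplicity $\ge 2$) is $\nu$; a cusp is a unibranched singular point. For a curve having only cusps, $\mathrm{Data}(C)$ is the unordered list of the multiplicity sequences of its singular points; sequences are continued by ones, and $(m,2_a)=(m,2,\dots,2,1,1,\dots)$, $(2_a)=(2,\dots,2,1,1,\dots)$ with $a$ twos. The genus is the geometric genus. Let $g\ge 0$; below $n'\ge 0$, $j\ge0$, $b_i>0$. **Classes.** (a) $d=k+2$, $\mathrm{Data}(C)=[(k),(2_{b_1}),\dots,(2_{b_{n'}})]$, with $k\ge 2$, $k=g+\sum b_i$, $n'\le 2g+2$. (b) $d=2k+3$, $\mathrm{Data}(C)=[(2k+1,2_k),(2_{b_1}),\dots,(2_{b_{n'}})]$, with $k>0$, $k+1=g+\sum b_i$, $n'\le 2g+1$. (c) $d=2k+2$, $\mathrm{Data}(C)=[(2k,2_{k+j}),(2_{b_1}),\dots,(2_{b_{n'}})]$, with $k>0$, $k=g+j+\sum b_i$, $n'\le 2g+1$.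 **Equations** (the $\lambda_i\in\mathbf C$ are distinct, $c_h\in\mathbf C$, $G(x,y)=\sum_{h=0}^{k+1}c_hx^{k+1-h}y^h$). (a) $y^kz^2+2Gz+\{G^2-\Delta\}/y^k=0$, where $\Delta=\prod_{i=1}^{n'}(x-\lambda_iy)^{2b_i+1}\prod_{i=n'+1}^{2g+2}(x-\lambda_iy)$ and $y^k\mid G(1,y)^2-\Delta(1,y)$. (b) $(y^kz+G)^2y-\prod_{i=1}^{n'}(x-\lambda_iy)^{2b_i+1}\prod_{i=n'+1}^{2g+1}(x-\lambda_iy)=0$. (c) $(y^kz+G)^2-y^{2j+1}\prod_{i=1}^{n'}(x-\lambda_iy)^{2b_i+1}\prod_{i=n'+1}^{2g+1}(x-\lambda_iy)=0$, where $c_0\ne0$. **Claim.** 1. A plane curve of degree $d$ is irreducible, of type $(d,d-2)$, of genus $g$ and has only cusps if and only if it is projectively equivalent to a curve given by an equation (a), (b) or (c), with $d$ and the parameters $k,n',b_i$ (and $j$) subject to the numerical conditions of the corresponding class. 2. More precisely, for each of the classes (a), (b), (c) and each choice of $k,n',b_i$ (and $j$) satisfying its numerical conditions, a plane curve is irreducible,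 of type $(d,d-2)$, of genus $g$ and has the $\mathrm{Data}$ of that class if and only if it is projectively equivalent to a curve given by the equation with the same letter and the same parameters, for some $\lambda_i$ and $c_h$ as above. 3. In (a), the condition $y^k\mid G(1,y)^2-\Delta(1,y)$ implies that $y^k$ divides $G^2-\Delta$, and it determines $c_0,\dots,c_{k-1}$ recursively, up to the choice of a sign: writing $\Delta(1,y)=\sum_h d_hy^h$, it holds if and only if $c_0=\pm1$ and $c_j=\bigl(d_j-\sum_{i=1}^{j-1}c_ic_{j-i}\bigr)/(2c_0)$ for $1\le j\le k-1$ ($c_k$ and $c_{k+1}$ are arbitrary). -/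

import Mathlib

open scoped LinearAlgebra.Projectivization KaehlerDifferential

/-! ### Function fields of transcendence degree one over `ℂ`: places, branches, genus -/

section FunctionField

/-- A place of `K` over `ℂ`: a nontrivial valuation ring of `K` that contains the constants.
For `K` the function field of a curve, these are the points of its nonsingular model. -/
structure CurvePlace (K : Type*) [Field K] [Algebra ℂ K] where
  ring : ValuationSubring K
  const_mem : ∀ c : ℂ, algebraMap ℂ K c ∈ ring
  ne_top : ring ≠ ⊤

variable {K : Type*} [Field K] [Algebra ℂ K]

/-- The differentials of `K / ℂ` that are regular at every place, that is, lie in `V · dV` for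
every place `V`: the regular differentials on the nonsingular model. -/
noncomputable def regularDifferentials (K : Type*) [Field K] [Algebra ℂ K] :
    Submodule ℂ (Ω[K⁄ℂ]) :=
  ⨅ V : CurvePlace K, Submodule.span ℂ
    {ω | ∃ f ∈ V.ring, ∃ a ∈ V.ring, ω = f • KaehlerDifferential.D ℂ K a}

/-- The genus of a function field in one variable. -/
noncomputable def functionFieldGenus (K : Type*) [Field K] [Algebra ℂ K] : ℕ :=
  Module.finrank ℂ (regularDifferentials K)

namespace CurvePlace

/-- The localization of the subalgebra `R` of `K` at the center of the place `V`:
the fractions `a / b` with `a, b ∈ R` and `b` not in the maximal ideal of `V`. -/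
def localizeAt (V : CurvePlace K) (R : Subalgebra ℂ K) : Subalgebra ℂ K where
  carrier := {q | ∃ a ∈ R, ∃ b ∈ R, b ∉ V.ring.nonunits ∧ q = a / b}
  mul_mem' := by
    rintro _ _ ⟨a, ha, b, hb, hb', rfl⟩ ⟨a', ha', b', hb1, hb1', rfl⟩
    refine ⟨a * a', R.mul_mem ha ha', b * b', R.mul_mem hb hb1, ?_, by rw [div_mul_div_comm]⟩
    rw [ValuationSubring.mem_nonunits_iff, not_lt] at *
    rw [map_mul]
    exact one_le_mul hb' hb1'
  add_mem' := by
    rintro _ _ ⟨a, ha, b, hb, hb', rfl⟩ ⟨a', ha', b', hb1, hb1', rfl⟩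
    have h0 : b ≠ 0 := by
      rintro rfl
      exact hb' V.ring.nonunits.zero_mem
    have h1 : b' ≠ 0 := by
      rintro rfl
      exact hb1' V.ring.nonunits.zero_mem
    refine ⟨a * b' + b * a', R.add_mem (R.mul_mem ha hb1) (R.mul_mem hb ha'), b * b',
      R.mul_mem hb hb1, ?_, by rw [div_add_div _ _ h0 h1]⟩
    rw [ValuationSubring.mem_nonunits_iff, not_lt] at *
    rw [map_mul]
    exact one_le_mul hb' hb1'
  algebraMap_mem' := by
    intro r
    refine ⟨algebraMap ℂ K r, R.algebraMap_mem r, 1, R.one_mem, ?_, by simp⟩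
    rw [ValuationSubring.mem_nonunits_iff]
    simp

/-- The blow-up of the local ring `O` at its maximal ideal `𝔪 = O ∩ 𝔪_V`, localized at the center
of `V`: one adjoins all `a / b` with `a, b ∈ 𝔪`, where `b` has the least `V`-order in `𝔪`. -/
def blowUp (V : CurvePlace K) (O : Subalgebra ℂ K) : Subalgebra ℂ K :=
  V.localizeAt (Algebra.adjoin ℂ ((O : Set K) ∪
    {q | ∃ a ∈ O, ∃ b ∈ O, a ∈ V.ring.nonunits ∧ b ∈ V.ring.nonunits ∧ b ≠ 0 ∧
      (∀ c ∈ O, c ∈ V.ring.nonunits → c / b ∈ V.ring) ∧ q = a / b}))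

/-- The branch of `O` given by `V` has multiplicity `m`: the ideal generated in `V` by the
maximal ideal of `O` is the `m`-th power of the maximal ideal of `V`, i.e. `m` is the least
order of vanishing along `V` of an element of the maximal ideal of `O`. -/
def BranchMultiplicity (V : CurvePlace K) (O : Subalgebra ℂ K) (m : ℕ) : Prop :=
  Ideal.span {f : V.ring | (f : K) ∈ O ∧ (f : K) ∈ V.ring.nonunits} =
    IsLocalRing.maximalIdeal V.ring ^ m

end CurvePlace

end FunctionField

/-! ### Irreducible plane curves -/

/-- An irreducible plane curve of degree `d` in `ℙ²(ℂ)`. -/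
structure PlaneCurve (d : ℕ) where
  poly : MvPolynomial (Fin 3) ℂ
  homogeneous : poly.IsHomogeneous d
  irreducible : Irreducible poly

namespace PlaneCurve

variable {d : ℕ} (C : PlaneCurve d)

/-- The homogeneous coordinate ring. -/
abbrev CoordRing : Type := MvPolynomial (Fin 3) ℂ ⧸ Ideal.span {C.poly}

instance : IsDomain C.CoordRing :=
  (Ideal.Quotient.isDomain_iff_prime _).2
    ((Ideal.span_singleton_prime C.irreducible.ne_zero).2 C.irreducible.prime)

/-- The field of fractions of the homogeneous coordinate ring. -/
abbrev ConeField : Type := FractionRing C.CoordRing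

/-- The image of the `i`-th homogeneous coordinate. -/
noncomputable def coord (i : Fin 3) : C.ConeField :=
  algebraMap C.CoordRing C.ConeField (Ideal.Quotient.mk _ (MvPolynomial.X i))

/-- The function field of the curve: it is generated over `ℂ` by the ratios of the homogeneous
coordinates. -/
noncomputable def functionField : IntermediateField ℂ C.ConeField :=
  IntermediateField.adjoin ℂ {q | ∃ i j, q = C.coord i / C.coord j}

/-- The rational function `xᵢ / xⱼ` on the curve. -/
noncomputable def ratio (i j : Fin 3) : C.functionField :=
  ⟨C.coord i / C.coord j, IntermediateField.subset_adjoin _ _ ⟨i, j, rfl⟩⟩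

/-- The (geometric) genus, i.e. the genus of the nonsingular model. -/
noncomputable def genus : ℕ := functionFieldGenus C.functionField

/-- The multiplicity of the curve at the point `p`: the least degree of a nonzero term in the
Taylor expansion of the equation at a representative of `p` (`0` if `p` is not on the curve). -/
noncomputable def mult (p : ℙ ℂ (Fin 3 → ℂ)) : ℕ :=
  sInf {m | MvPolynomial.homogeneousComponent m
    (MvPolynomial.bind₁ (fun i => MvPolynomial.X i + MvPolynomial.C (p.rep i)) C.poly) ≠ 0}

/-- The singular points. -/
def singularPoints : Set (ℙ ℂ (Fin 3 → ℂ)) := {p | 2 ≤ C.mult p}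

/-- A curve of type `(d, ν)`: the maximal multiplicity of its singular points is `ν`. -/
def IsOfType (ν : ℕ) : Prop := IsGreatest (C.mult '' C.singularPoints) ν

/-- The place `V` is centered at the point `p`: in each affine chart `xⱼ ≠ 0` around `p`, every
affine coordinate function takes at `V` its value at `p`. -/
def IsCenteredAt (V : CurvePlace C.functionField) (p : ℙ ℂ (Fin 3 → ℂ)) : Prop :=
  ∀ i j, p.rep j ≠ 0 →
    C.ratio i j - algebraMap ℂ C.functionField (p.rep i / p.rep j) ∈ V.ring.nonunits

/-- The curve is unibranched at `p`: exactly one point of the nonsingular model lies over `p`. -/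
def IsUnibranchedAt (p : ℙ ℂ (Fin 3 → ℂ)) : Prop :=
  ∃! V : CurvePlace C.functionField, C.IsCenteredAt V p

/-- All singular points are cusps, i.e. unibranched. -/
def IsCuspidal : Prop := ∀ p ∈ C.singularPoints, C.IsUnibranchedAt p

/-- For a place `V` centered at `p`: the local rings of the curve at `p` (`n = 0`), and of its
successive strict transforms at the infinitely near points of `p` on the branch `V`. -/
noncomputable def infinitelyNearRing (p : ℙ ℂ (Fin 3 → ℂ)) (V : CurvePlace C.functionField) :
    ℕ → Subalgebra ℂ C.functionField
  | 0 => V.localizeAt (Algebra.adjoin ℂ {q | ∃ i j, p.rep j ≠ 0 ∧ q = C.ratio i j})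
  | n + 1 => V.blowUp (infinitelyNearRing p V n)

/-- The curve is unibranched at `p`, with multiplicity sequence `m 0, m 1, m 2, …` there. -/
def HasMultSeq (p : ℙ ℂ (Fin 3 → ℂ)) (m : ℕ → ℕ) : Prop :=
  C.IsUnibranchedAt p ∧ ∀ V : CurvePlace C.functionField, C.IsCenteredAt V p →
    ∀ n, V.BranchMultiplicity (C.infinitelyNearRing p V n) (m n)

/-- `Data(C) = [m₁, …, mᵣ]` for a cuspidal curve: the singular points can be numbered so that the
`i`-th one is a cusp with multiplicity sequence `mᵢ`. -/
def HasData (M : List (ℕ → ℕ)) : Prop :=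
  ∃ e : Fin M.length ≃ C.singularPoints, ∀ i, C.HasMultSeq (e i : ℙ ℂ (Fin 3 → ℂ)) (M.get i)

end PlaneCurve

/-- The multiplicity sequence that starts with the list `l` and continues with ones. -/
def multSeq (l : List ℕ) : ℕ → ℕ := fun i => l.getD i 1

/-- The list of multiplicity sequences `[m, (2_{b₁}), …, (2_{bₙ})]`, with `(2_b) = (2, …, 2, 1, 1, …)`
containing `b` twos, where `m` starts with `l` and continues with ones. -/
def cuspData (l : List ℕ) {n : ℕ} (b : Fin n → ℕ) : List (ℕ → ℕ) :=
  multSeq l :: List.ofFn fun i => multSeq (List.replicate (b i) 2)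

/-- Two plane curves, given by their equations, are projectively equivalent. -/
def ProjEquiv (P P' : MvPolynomial (Fin 3) ℂ) : Prop :=
  ∃ A : GL (Fin 3) ℂ, ∃ u : ℂˣ,
    MvPolynomial.bind₁ (fun i => ∑ j, MvPolynomial.C (A i j) * MvPolynomial.X j) P =
      MvPolynomial.C (u : ℂ) * P'

/-! ### The equations.  The homogeneous coordinates `x, y, z` are `X 0, X 1, X 2`. -/

section Equations

open MvPolynomial

/-- `∏_{i ≤ n} (x - λᵢ y)^{2 bᵢ + 1} ∏_{n < i ≤ N} (x - λᵢ y)`. -/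
noncomputable def oddProduct {n : ℕ} (b : Fin n → ℕ) {N : ℕ} (lam : Fin N → ℂ) :
    MvPolynomial (Fin 3) ℂ :=
  ∏ i : Fin N, (X 0 - C (lam i) * X 1) ^ (if h : (i : ℕ) < n then 2 * b ⟨i, h⟩ + 1 else 1)

/-- `G(x, y) = ∑_{h=0}^{k+1} c_h x^{k+1-h} y^h`. -/
noncomputable def gPoly (k : ℕ) (c : ℕ → ℂ) : MvPolynomial (Fin 3) ℂ :=
  ∑ h ∈ Finset.range (k + 2), C (c h) * X 0 ^ (k + 1 - h) * X 1 ^ h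

/-- `P(x, y) ↦ P(1, y)`. -/
noncomputable def dehom (P : MvPolynomial (Fin 3) ℂ) : Polynomial ℂ :=
  aeval ![1, Polynomial.X, 0] P

/-- The condition `y^k ∣ G(1, y)² - Δ(1, y)`. -/
def DivCond (k : ℕ) {n N : ℕ} (b : Fin n → ℕ) (lam : Fin N → ℂ) (c : ℕ → ℂ) : Prop :=
  Polynomial.X ^ k ∣ dehom (gPoly k c) ^ 2 - dehom (oddProduct b lam)

/-- `{G² - Δ} / y^k`. -/
noncomputable def hPoly (k : ℕ) {n N : ℕ} (b : Fin n → ℕ) (lam : Fin N → ℂ) (c : ℕ → ℂ) :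
    MvPolynomial (Fin 3) ℂ :=
  (gPoly k c ^ 2 - oddProduct b lam).divMonomial (Finsupp.single 1 k)

/-- `y^k z² + 2 G z + {G² - Δ} / y^k`. -/
noncomputable def eqnA (k : ℕ) {n N : ℕ} (b : Fin n → ℕ) (lam : Fin N → ℂ) (c : ℕ → ℂ) :
    MvPolynomial (Fin 3) ℂ :=
  X 1 ^ k * X 2 ^ 2 + 2 * gPoly k c * X 2 + hPoly k b lam c

/-- `(y^k z + G)² y - ∏ …`. -/
noncomputable def eqnB (k : ℕ) {n N : ℕ} (b : Fin n → ℕ) (lam : Fin N → ℂ) (c : ℕ → ℂ) :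
    MvPolynomial (Fin 3) ℂ :=
  (X 1 ^ k * X 2 + gPoly k c) ^ 2 * X 1 - oddProduct b lam

/-- `(y^k z + G)² - y^{2j+1} ∏ …`. -/
noncomputable def eqnC (k j : ℕ) {n N : ℕ} (b : Fin n → ℕ) (lam : Fin N → ℂ) (c : ℕ → ℂ) :
    MvPolynomial (Fin 3) ℂ :=
  (X 1 ^ k * X 2 + gPoly k c) ^ 2 - X 1 ^ (2 * j + 1) * oddProduct b lam

end Equations

/-! ### The three classes -/

/-- The numerical conditions of class (a), degree `k + 2`. -/
def AdmissibleA (g k : ℕ) {n : ℕ} (b : Fin n → ℕ) : Prop :=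
  2 ≤ k ∧ (∀ i, 0 < b i) ∧ n ≤ 2 * g + 2 ∧ k = g + ∑ i, b i

/-- The numerical conditions of class (b), degree `2 k + 3`. -/
def AdmissibleB (g k : ℕ) {n : ℕ} (b : Fin n → ℕ) : Prop :=
  0 < k ∧ (∀ i, 0 < b i) ∧ n ≤ 2 * g + 1 ∧ k + 1 = g + ∑ i, b i

/-- The numerical conditions of class (c), degree `2 k + 2`. -/
def AdmissibleC (g k j : ℕ) {n : ℕ} (b : Fin n → ℕ) : Prop :=
  0 < k ∧ (∀ i, 0 < b i) ∧ n ≤ 2 * g + 1 ∧ k = g + j + ∑ i, b i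

/-- Up to projective equivalence, `P = 0` is an equation of the family (a). -/
def IsInFamilyA (g k : ℕ) {n : ℕ} (b : Fin n → ℕ) (P : MvPolynomial (Fin 3) ℂ) : Prop :=
  ∃ lam : Fin (2 * g + 2) → ℂ, Function.Injective lam ∧
    ∃ c : ℕ → ℂ, DivCond k b lam c ∧ ProjEquiv P (eqnA k b lam c)

/-- Up to projective equivalence, `P = 0` is an equation of the family (b). -/
def IsInFamilyB (g k : ℕ) {n : ℕ} (b : Fin n → ℕ) (P : MvPolynomial (Fin 3) ℂ) : Prop :=
  ∃ lam : Fin (2 * g + 1) → ℂ, Function.Injective lam ∧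
    ∃ c : ℕ → ℂ, ProjEquiv P (eqnB k b lam c)

/-- Up to projective equivalence, `P = 0` is an equation of the family (c). -/
def IsInFamilyC (g k j : ℕ) {n : ℕ} (b : Fin n → ℕ) (P : MvPolynomial (Fin 3) ℂ) : Prop :=
  ∃ lam : Fin (2 * g + 1) → ℂ, Function.Injective lam ∧
    ∃ c : ℕ → ℂ, c 0 ≠ 0 ∧ ProjEquiv P (eqnC k j b lam c)

/-! Let `k = d - 2` and put the point of multiplicity `k` at the vertex `(0 : 0 : 1)`. The equation
becomes `a z² + 2 b z + c` with binary forms `a, b, c` of degrees `k, k+1, k+2`. Over each root of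
the tangent cone `a` lies a place centered at the vertex, so a unibranched vertex forces `a` to be a
power of one linear form, which is moved to `y` (`root_unique`, `exists_second_coordinates`). In the
chart `y = 1`, completing the square gives `(z + b(x))² = δ(x)`, with `δ` monic after a rescaling of
`z` (`exists_isNormalForm`).

Everything is then read off from `b` and `δ = Q² f`, where `f` has simple roots. The function field
is `ℂ(x, √f)`, of genus `g` when `deg f` is `2g+1` or `2g+2` (`QuadraticModel.genus_eq`). The
singular points other than the vertex are the points `(t, -b(t))` with `t` a multiple root of `δ`.
Such a point is unibranched exactly when `f(t) = 0`, that is, when `t` has odd multiplicity `2n+1`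
in `δ`. Its local ring is then `oddSubalgebra t n`, and each blow-up lowers `n` by one
(`blowUp_oddSubalgebra`), which produces the sequence `(2_n)`.

The branches at the vertex lie over `x = ∞`. If `b` has degree `k+1`, the top terms of `b²` and `δ`
cancel, `deg f` is even, and exactly one of the two places over `∞` is centered at the vertex; it
has the sequence `(k)`, and this is class (a). Otherwise every place over `∞` is centered at the
vertex, so unibranchedness means that `deg f` is odd. Then `deg b²` is even and `deg δ` is odd, and
the larger of the two is `k+2`: this is class (b) if it is `deg δ` and class (c) if it is `deg b²`
(`classification`). The sequence there follows from the order of `x/z` and from the fact that the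
first blow-up is again an `oddSubalgebra`, at `1/x = 0`.

Conversely, the equations (a), (b), (c) are such normal forms, irreducible because `δ` is not a
square (`irreducible_quadForm`). The parameters are recovered from `Data` in `family_of_hasData`,
since multiplicity sequences are unique. The recursion for the `c_h` compares coefficients in `G(1,
y)² ≡ Δ(1, y)` modulo `y^k`. -/

/-! ### Values of functions at a place -/

section Values

open Polynomial

namespace CurvePlace

variable {K : Type*} [Field K] [Algebra ℂ K] (V : CurvePlace K)

/-- The function `x` takes the finite value `c` at the place `V`. -/
def HasValue (x : K) (c : ℂ) : Prop := V.ring.valuation (x - algebraMap ℂ K c) < 1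

variable {V}

theorem ext_ring {V W : CurvePlace K} (h : ∀ x, x ∈ V.ring ↔ x ∈ W.ring) : V = W := by
  cases V; cases W
  congr
  exact ValuationSubring.ext _ _ h

theorem val_const_le (c : ℂ) : V.ring.valuation (algebraMap ℂ K c) ≤ 1 :=
  (V.ring.valuation_le_one_iff _).2 (V.const_mem c)

theorem val_const {c : ℂ} (hc : c ≠ 0) : V.ring.valuation (algebraMap ℂ K c) = 1 := by
  refine le_antisymm (val_const_le c) ?_
  have h := val_const_le (V := V) c⁻¹
  rw [map_inv₀, map_inv₀] at h
  have h0 : V.ring.valuation (algebraMap ℂ K c) ≠ 0 := by simpa using hc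
  simpa [h0] using (inv_le_one₀ (zero_lt_iff.2 h0)).1 h

theorem hasValue_zero_iff {x : K} : V.HasValue x 0 ↔ V.ring.valuation x < 1 := by
  simp [HasValue]

theorem hasValue_const (c : ℂ) : V.HasValue (algebraMap ℂ K c) c := by
  simp [HasValue]

namespace HasValue

variable {x y : K} {c d : ℂ}

theorem val_le_one (h : V.HasValue x c) : V.ring.valuation x ≤ 1 := by
  have : x = (x - algebraMap ℂ K c) + algebraMap ℂ K c := by ring
  rw [this]
  exact (Valuation.map_add _ _ _).trans (max_le h.le (val_const_le c))

theorem mem (h : V.HasValue x c) : x ∈ V.ring := (V.ring.valuation_le_one_iff _).1 h.val_le_one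

theorem add (hx : V.HasValue x c) (hy : V.HasValue y d) : V.HasValue (x + y) (c + d) := by
  have : x + y - algebraMap ℂ K (c + d) = (x - algebraMap ℂ K c) + (y - algebraMap ℂ K d) := by
    rw [map_add]; ring
  rw [HasValue, this]
  exact Valuation.map_add_lt _ hx hy

theorem mul (hx : V.HasValue x c) (hy : V.HasValue y d) : V.HasValue (x * y) (c * d) := by
  have : x * y - algebraMap ℂ K (c * d) =
      (x - algebraMap ℂ K c) * y + algebraMap ℂ K c * (y - algebraMap ℂ K d) := by
    rw [map_mul]; ring
  rw [HasValue, this]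
  refine Valuation.map_add_lt _ ?_ ?_
  · rw [map_mul]; exact (mul_le_of_le_one_right' hy.val_le_one).trans_lt hx
  · rw [map_mul]; exact (mul_le_of_le_one_left' (val_const_le c)).trans_lt hy

theorem neg (hx : V.HasValue x c) : V.HasValue (-x) (-c) := by
  simpa using (hasValue_const (V := V) (-1)).mul hx

theorem sub (hx : V.HasValue x c) (hy : V.HasValue y d) : V.HasValue (x - y) (c - d) := by
  simpa [sub_eq_add_neg] using hx.add hy.neg

theorem pow (hx : V.HasValue x c) (n : ℕ) : V.HasValue (x ^ n) (c ^ n) := by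
  induction n with
  | zero => simpa using hasValue_const (V := V) 1
  | succ n ih => simpa [pow_succ] using ih.mul hx

theorem val_eq_one (hx : V.HasValue x c) (hc : c ≠ 0) : V.ring.valuation x = 1 := by
  have h1 : V.ring.valuation (algebraMap ℂ K c) = 1 := val_const hc
  have h2 := Valuation.map_add_eq_of_lt_right V.ring.valuation
    (x := x - algebraMap ℂ K c) (y := algebraMap ℂ K c) (by rw [h1]; exact hx)
  rwa [sub_add_cancel, h1] at h2

theorem val_lt_one_iff (hx : V.HasValue x c) : V.ring.valuation x < 1 ↔ c = 0 := by
  constructor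
  · intro h
    by_contra hc
    rw [hx.val_eq_one hc] at h
    exact lt_irrefl _ h
  · rintro rfl
    exact hasValue_zero_iff.1 hx

theorem unique (hx : V.HasValue x c) (hy : V.HasValue x d) : c = d := by
  have h := hx.sub hy
  rw [sub_self] at h
  exact sub_eq_zero.1 (h.val_lt_one_iff.1 (by simp))

theorem ne_zero (hx : V.HasValue x c) (hc : c ≠ 0) : x ≠ 0 := by
  rintro rfl
  simpa using hx.val_eq_one hc

theorem inv (hx : V.HasValue x c) (hc : c ≠ 0) : V.HasValue x⁻¹ c⁻¹ := by
  have h0 := hx.ne_zero hc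
  have hc' : algebraMap ℂ K c ≠ 0 := by simpa using hc
  have : x⁻¹ - algebraMap ℂ K c⁻¹ = -(x - algebraMap ℂ K c) / (x * algebraMap ℂ K c) := by
    rw [map_inv₀]; field_simp; ring
  rw [HasValue, this, map_div₀, map_mul, hx.val_eq_one hc, val_const hc, Valuation.map_neg]
  simpa [HasValue] using hx

theorem div (hx : V.HasValue x c) (hy : V.HasValue y d) (hd : d ≠ 0) :
    V.HasValue (x / y) (c / d) := by
  simpa [div_eq_mul_inv] using hx.mul (hy.inv hd)

theorem aeval (hx : V.HasValue x c) (p : ℂ[X]) : V.HasValue (aeval x p) (p.eval c) := by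
  induction p using Polynomial.induction_on' with
  | add p q hp hq => simpa using hp.add hq
  | monomial n a =>
    simpa [Polynomial.aeval_monomial] using (hasValue_const (V := V) a).mul (hx.pow n)

theorem sum {ι : Type*} {I : Finset ι} {x : ι → K} {c : ι → ℂ}
    (h : ∀ i ∈ I, V.HasValue (x i) (c i)) : V.HasValue (∑ i ∈ I, x i) (∑ i ∈ I, c i) := by
  classical
  induction I using Finset.induction_on with
  | empty => simpa using hasValue_const (V := V) 0
  | insert i I hi ih =>
    rw [Finset.sum_insert hi, Finset.sum_insert hi]
    exact (h i (by simp)).add (ih fun j hj => h j (by simp [hj]))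

end HasValue

theorem val_lt_one_of_pow {x : K} {n : ℕ} (h : V.ring.valuation (x ^ n) < 1) :
    V.ring.valuation x < 1 := by
  rw [map_pow] at h
  by_contra h'
  exact absurd h (not_lt.2 (one_le_pow₀ (not_lt.1 h')))

/-- A proper ideal of a subalgebra of `K` that contains a nonzero element has a center. -/
theorem exists_of_ideal (R : Subalgebra ℂ K) (I : Ideal R) (hI : I ≠ ⊤) {x : R} (hx : x ∈ I)
    (hx0 : x ≠ 0) :
    ∃ V : CurvePlace K, R.toSubring ≤ V.ring.toSubring ∧
      ∀ y ∈ I, V.ring.valuation (y : K) < 1 := by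
  -- Chevalley's extension theorem: some valuation ring contains `R` and has `I` inside its maximal
  -- ideal.
  obtain ⟨B, hB, hIB⟩ := Ideal.image_subset_nonunits_valuationSubring (A := R.toSubring) I hI
  have key : ∀ y ∈ I, B.valuation (y : K) < 1 := fun y hy =>
    (B.mem_nonunits_iff).1 (hIB ⟨y, hy, rfl⟩)
  refine ⟨⟨B, fun c => hB (R.algebraMap_mem c), ?_⟩, hB, key⟩
  rintro rfl
  have h := key x hx
  rw [← ValuationSubring.mem_nonunits_iff, ValuationSubring.mem_nonunits_iff_or] at h
  rcases h with h | h
  · exact hx0 (Subtype.ext h)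
  · exact h (ValuationSubring.mem_top _)

end CurvePlace

end Values

/-! ### Quadratic extensions of `ℂ(s)` and their places -/

section QuadraticModel

open Polynomial

/-- `K` is the quadratic extension of the rational function field `ℂ(s)` generated by a square root
`w` of the polynomial `f(s)`. -/
structure QuadraticModel (K : Type*) [Field K] [Algebra ℂ K] (s w : K) (f : ℂ[X]) : Prop where
  sq : w ^ 2 = aeval s f
  indep : ∀ p q : ℂ[X], aeval s p + aeval s q * w = 0 → p = 0 ∧ q = 0
  gen : ∀ x : K, ∃ p q r : ℂ[X], r ≠ 0 ∧ x = (aeval s p + aeval s q * w) / aeval s r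

/-- Divide a pair of polynomials by the largest common power of `X - t`. -/
theorem Polynomial.exists_pow_mul_of_pair (t : ℂ) (p q : ℂ[X]) (h : p ≠ 0 ∨ q ≠ 0) :
    ∃ (n : ℕ) (p' q' : ℂ[X]), p = (X - C t) ^ n * p' ∧ q = (X - C t) ^ n * q' ∧
      (p'.eval t ≠ 0 ∨ q'.eval t ≠ 0) := by
  induction hN : p.natDegree + q.natDegree using Nat.strong_induction_on generalizing p q with
  | _ N ih =>
  by_cases hpq : p.eval t ≠ 0 ∨ q.eval t ≠ 0
  · exact ⟨0, p, q, by simp, by simp, hpq⟩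
  push Not at hpq
  obtain ⟨p1, rfl⟩ := dvd_iff_isRoot.2 hpq.1
  obtain ⟨q1, rfl⟩ := dvd_iff_isRoot.2 hpq.2
  have hX : (X - C t : ℂ[X]) ≠ 0 := X_sub_C_ne_zero t
  have hdeg : ∀ r : ℂ[X], r ≠ 0 → ((X - C t) * r).natDegree = r.natDegree + 1 := by
    intro r hr
    rw [natDegree_mul hX hr, natDegree_X_sub_C, add_comm]
  have h' : p1 ≠ 0 ∨ q1 ≠ 0 := by
    rcases h with h | h
    · exact Or.inl (right_ne_zero_of_mul h)
    · exact Or.inr (right_ne_zero_of_mul h)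
  have hlt : p1.natDegree + q1.natDegree < N := by
    rw [← hN]
    by_cases hp : p1 = 0
    · have hq : q1 ≠ 0 := h'.resolve_left (not_not.2 hp)
      simp [hp, hdeg q1 hq]
    · by_cases hq : q1 = 0
      · simp [hq, hdeg p1 hp]
      · rw [hdeg p1 hp, hdeg q1 hq]; omega
  obtain ⟨n, p', q', h1, h2, h3⟩ := ih _ hlt p1 q1 h' rfl
  exact ⟨n + 1, p', q', by rw [h1]; ring, by rw [h2]; ring, h3⟩

namespace QuadraticModel

variable {K : Type*} [Field K] [Algebra ℂ K] {s w : K} {f : ℂ[X]}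

theorem aeval_eq_zero (M : QuadraticModel K s w f) {p : ℂ[X]} : aeval s p = 0 ↔ p = 0 :=
  ⟨fun h => (M.indep p 0 (by simp [h])).1, fun h => by simp [h]⟩

theorem aeval_ne_zero (M : QuadraticModel K s w f) {p : ℂ[X]} (h : p ≠ 0) : aeval s p ≠ 0 :=
  fun h' => h (M.aeval_eq_zero.1 h')

theorem w_ne_zero (M : QuadraticModel K s w f) : w ≠ 0 := fun h => by
  have := (M.indep 0 1 (by simp [h])).2
  simp at this

theorem sub_ne_zero (M : QuadraticModel K s w f) (t : ℂ) : s - algebraMap ℂ K t ≠ 0 := by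
  have := M.aeval_ne_zero (X_sub_C_ne_zero t)
  simpa using this

theorem f_ne_zero (M : QuadraticModel K s w f) : f ≠ 0 := fun h =>
  M.w_ne_zero (by simpa [h] using M.sq)

/-- The norm from `K` to `ℂ(s)`. It reduces questions about zeros of `p + q w` to zeros of a
polynomial in `s`. -/
theorem norm_eq (M : QuadraticModel K s w f) (p q : ℂ[X]) :
    (aeval s p + aeval s q * w) * (aeval s p - aeval s q * w) = aeval s (p ^ 2 - q ^ 2 * f) := by
  simp only [map_sub, map_mul, map_pow, ← M.sq]; ring

theorem congr_pair (M : QuadraticModel K s w f) {p q p' q' : ℂ[X]}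
    (h : aeval s p + aeval s q * w = aeval s p' + aeval s q' * w) : p = p' ∧ q = q' := by
  have := M.indep (p - p') (q - q') (by simp only [map_sub]; linear_combination h)
  exact ⟨sub_eq_zero.1 this.1, sub_eq_zero.1 this.2⟩

/-- The place `V` lies over the point `(t, c)` of the curve `w² = f(s)`. -/
def _root_.CurvePlace.LiesOver (V : CurvePlace K) (s w : K) (t c : ℂ) : Prop :=
  V.HasValue s t ∧ V.HasValue w c

theorem _root_.CurvePlace.LiesOver.el {V : CurvePlace K} {t c : ℂ} (h : V.LiesOver s w t c)
    (p q : ℂ[X]) : V.HasValue (aeval s p + aeval s q * w) (p.eval t + q.eval t * c) :=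
  (h.1.aeval p).add ((h.1.aeval q).mul h.2)

theorem exists_el_of_mem_adjoin (M : QuadraticModel K s w f) {x : K}
    (hx : x ∈ Algebra.adjoin ℂ {s, w}) : ∃ p q : ℂ[X], x = aeval s p + aeval s q * w := by
  induction hx using Algebra.adjoin_induction with
  | mem x hx =>
    rcases hx with rfl | rfl
    · exact ⟨X, 0, by simp⟩
    · exact ⟨0, 1, by simp⟩
  | algebraMap r => exact ⟨C r, 0, by simp⟩
  | add x y _ _ hx hy =>
    obtain ⟨p, q, rfl⟩ := hx
    obtain ⟨p', q', rfl⟩ := hy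
    exact ⟨p + p', q + q', by simp only [map_add]; ring⟩
  | mul x y _ _ hx hy =>
    obtain ⟨p, q, rfl⟩ := hx
    obtain ⟨p', q', rfl⟩ := hy
    refine ⟨p * p' + q * q' * f, p * q' + q * p', ?_⟩
    simp only [map_add, map_mul, ← M.sq]; ring

theorem el_mem_adjoin (s w : K) (p q : ℂ[X]) :
    aeval s p + aeval s q * w ∈ Algebra.adjoin ℂ {s, w} := by
  have h1 : ∀ p : ℂ[X], aeval s p ∈ Algebra.adjoin ℂ {s, w} := fun p =>
    Algebra.adjoin_mono (Set.singleton_subset_iff.2 (Set.mem_insert _ _))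
      (aeval_mem_adjoin_singleton ℂ s)
  exact add_mem (h1 p) (mul_mem (h1 q) (Algebra.subset_adjoin (by simp)))

/-- Every point of the affine curve `w² = f(s)` is the center of a place. -/
theorem exists_place (M : QuadraticModel K s w f) {t c : ℂ} (h : c ^ 2 = f.eval t) :
    ∃ V : CurvePlace K, V.LiesOver s w t c := by
  let R := Algebra.adjoin ℂ {s, w}
  let s' : R := ⟨s, Algebra.subset_adjoin (by simp)⟩
  let w' : R := ⟨w, Algebra.subset_adjoin (by simp)⟩
  let I : Ideal R := Ideal.span {s' - algebraMap ℂ R t, w' - algebraMap ℂ R c}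
  have hI : I ≠ ⊤ := by
    intro htop
    have h1 : (1 : R) ∈ I := htop ▸ Submodule.mem_top
    obtain ⟨x, y, hxy⟩ := Ideal.mem_span_pair.1 h1
    obtain ⟨p, q, hx⟩ := M.exists_el_of_mem_adjoin x.2
    obtain ⟨p', q', hy⟩ := M.exists_el_of_mem_adjoin y.2
    have h2 : (x : K) * (s - algebraMap ℂ K t) + y * (w - algebraMap ℂ K c) = 1 :=
      congrArg Subtype.val hxy
    rw [hx, hy] at h2
    -- The value at `t` of the first component plus `c` times that of the second is the value of the
    -- element at the point `(t, c)`. It is `0` on the ideal but `1` for the unit element.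
    have h3 : aeval s (p * (X - C t) + q' * f - p' * C c) +
        aeval s (q * (X - C t) + p' - q' * C c) * w = aeval s (1 : ℂ[X]) + aeval s (0 : ℂ[X]) * w := by
      simp only [map_add, map_sub, map_mul, aeval_X, aeval_C, map_one, map_zero, ← M.sq]
      linear_combination h2
    obtain ⟨h4, h5⟩ := M.congr_pair h3
    have h4' := congrArg (eval t) h4
    have h5' := congrArg (eval t) h5
    simp only [eval_add, eval_sub, eval_mul, eval_X, eval_C, eval_one, eval_zero, sub_self,
      mul_zero, zero_add, ← h] at h4' h5'
    have : (1 : ℂ) = 0 := by linear_combination -h4' - c * h5'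
    exact one_ne_zero this
  obtain ⟨V, -, hV⟩ := CurvePlace.exists_of_ideal R I hI (x := s' - algebraMap ℂ R t)
    (Ideal.subset_span (by simp)) (fun h0 => M.sub_ne_zero t (congrArg Subtype.val h0))
  exact ⟨V, hV (s' - algebraMap ℂ R t) (Ideal.subset_span (by simp)),
    hV (w' - algebraMap ℂ R c) (Ideal.subset_span (by simp))⟩

/-- Every place lies over a finite point or over `s = ∞`. -/
theorem exists_value_or (M : QuadraticModel K s w f) (V : CurvePlace K) :
    V.HasValue s⁻¹ 0 ∨ ∃ t, V.HasValue s t := by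
  by_contra hcon
  push Not at hcon
  obtain ⟨h1, h2⟩ := hcon
  have hs0 : s ≠ 0 := by simpa using M.sub_ne_zero 0
  have hs : V.ring.valuation s ≤ 1 := by
    by_contra h
    apply h1
    rw [CurvePlace.hasValue_zero_iff, map_inv₀]
    exact inv_lt_one_of_one_lt₀ (not_le.1 h)
  -- If `s` is finite but takes no value, all `s - t` are units, hence so are all nonzero
  -- polynomials in `s`. Then `V` contains `ℂ(s)` and `w`, so it is all of `K`.
  have hlin : ∀ t : ℂ, V.ring.valuation (s - algebraMap ℂ K t) = 1 := fun t =>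
    le_antisymm ((Valuation.map_sub _ _ _).trans (max_le hs (CurvePlace.val_const_le t)))
      (not_lt.1 (h2 t))
  have hpol : ∀ p : ℂ[X], p ≠ 0 → V.ring.valuation (aeval s p) = 1 := by
    intro p hp
    have hsp := IsAlgClosed.splits p
    rw [hsp.eq_prod_roots]
    simp only [map_mul, aeval_C, map_multiset_prod, Multiset.map_map]
    rw [CurvePlace.val_const (leadingCoeff_ne_zero.2 hp), one_mul]
    refine Multiset.prod_eq_one ?_
    intro y hy
    obtain ⟨t, -, rfl⟩ := Multiset.mem_map.1 hy
    simpa using hlin t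
  have hpol' : ∀ p : ℂ[X], V.ring.valuation (aeval s p) ≤ 1 := by
    intro p
    by_cases hp : p = 0
    · simp [hp]
    · exact (hpol p hp).le
  have hw : V.ring.valuation w ≤ 1 := by
    have : V.ring.valuation w ^ 2 = 1 := by rw [← map_pow, M.sq, hpol f M.f_ne_zero]
    exact le_of_not_gt fun h => (one_lt_pow₀ h two_ne_zero).ne' this
  apply V.ne_top
  refine ValuationSubring.ext _ _ fun x => ⟨fun _ => ValuationSubring.mem_top x, fun _ => ?_⟩
  obtain ⟨p, q, r, hr, rfl⟩ := M.gen x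
  rw [← ValuationSubring.valuation_le_one_iff, map_div₀, hpol r hr, div_one]
  refine (Valuation.map_add _ _ _).trans (max_le (hpol' p) ?_)
  rw [map_mul]
  exact mul_le_one' (hpol' q) hw

/-- The function `π` is a uniformizer at the point `(t, c)` of the curve `w² = f(s)`: up to a power
of `π`, every function is a quotient of polynomials that do not vanish at the point. -/
structure IsUniformizerAt (s w : K) (t c : ℂ) (π : K) : Prop where
  ne_zero : π ≠ 0
  exists_el : ∃ p q : ℂ[X], p.eval t + q.eval t * c = 0 ∧ π = aeval s p + aeval s q * w
  exists_pow : ∀ x : K, x ≠ 0 → ∃ (n : ℤ) (p q p' q' : ℂ[X]), p.eval t + q.eval t * c ≠ 0 ∧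
    p'.eval t + q'.eval t * c ≠ 0 ∧
    x = π ^ n * ((aeval s p + aeval s q * w) / (aeval s p' + aeval s q' * w))

theorem _root_.Polynomial.exists_pow_mul_of_ne_zero (t : ℂ) {r : ℂ[X]} (hr : r ≠ 0) :
    ∃ (n : ℕ) (r' : ℂ[X]), r = (X - C t) ^ n * r' ∧ r'.eval t ≠ 0 := by
  obtain ⟨n, r', q', h1, h2, h3⟩ := exists_pow_mul_of_pair t r 0 (Or.inl hr)
  have : q' = 0 := by
    simpa [pow_ne_zero n (X_sub_C_ne_zero t)] using h2.symm
  exact ⟨n, r', h1, by simpa [this] using h3⟩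

theorem exists_reduced (M : QuadraticModel K s w f) (t : ℂ) {x : K} (hx : x ≠ 0) :
    ∃ (n m : ℕ) (p q r : ℂ[X]), (p.eval t ≠ 0 ∨ q.eval t ≠ 0) ∧ r.eval t ≠ 0 ∧
      x = (s - algebraMap ℂ K t) ^ n * (aeval s p + aeval s q * w) /
        ((s - algebraMap ℂ K t) ^ m * aeval s r) := by
  obtain ⟨p, q, r, hr, rfl⟩ := M.gen x
  have hpq : p ≠ 0 ∨ q ≠ 0 := by
    by_contra hcon
    push Not at hcon
    exact hx (by simp [hcon.1, hcon.2])
  obtain ⟨n, p1, q1, rfl, rfl, h1⟩ := exists_pow_mul_of_pair t p q hpq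
  obtain ⟨m, r1, rfl, h2⟩ := exists_pow_mul_of_ne_zero t hr
  refine ⟨n, m, p1, q1, r1, h1, h2, ?_⟩
  simp only [map_mul, map_pow, map_sub, aeval_X, aeval_C]
  ring

theorem ne_zero_of_eval (M : QuadraticModel K s w f) {p : ℂ[X]} {t : ℂ} (h : p.eval t ≠ 0) :
    aeval s p ≠ 0 := M.aeval_ne_zero (by rintro rfl; simp at h)

/-- If `p + q w` vanishes at `(t, c)` with `c ≠ 0`, its conjugate `p - q w` does not, unless `p` and
`q` both vanish at `t`. So the element is its norm divided by a unit, and the norm is a power of `s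
- t` times a polynomial without zero at `t`. -/
theorem isUniformizerAt_of_ne (M : QuadraticModel K s w f) {t c : ℂ}
    (hc : c ≠ 0) : IsUniformizerAt s w t c (s - algebraMap ℂ K t) := by
  have hs := M.sub_ne_zero t
  refine ⟨hs, ⟨X - C t, 0, by simp, by simp⟩, fun x hx => ?_⟩
  obtain ⟨n, m, p, q, r, hpq, hr, rfl⟩ := M.exists_reduced t hx
  have hr0 := M.ne_zero_of_eval hr
  by_cases he : p.eval t + q.eval t * c = 0
  · have hpq0 : p ≠ 0 ∨ q ≠ 0 := by
      rcases hpq with h | h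
      · left; rintro rfl; simp at h
      · right; rintro rfl; simp at h
    have hN : p ^ 2 - q ^ 2 * f ≠ 0 := by
      intro hN
      have h1 := M.norm_eq p q
      rw [hN, map_zero, mul_eq_zero] at h1
      rcases h1 with h1 | h1
      · obtain ⟨h2, h3⟩ := M.indep p q h1
        simp [h2, h3] at hpq0
      · obtain ⟨h2, h3⟩ := M.indep p (-q) (by rw [map_neg]; linear_combination h1)
        simp [h2, neg_eq_zero.1 h3] at hpq0
    have he' : p.eval t - q.eval t * c ≠ 0 := by
      intro he'
      have h1 : p.eval t = 0 := by linear_combination (he + he') / 2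
      have h2 : q.eval t = 0 := by
        have : q.eval t * c = 0 := by linear_combination (he - he') / 2
        exact (mul_eq_zero.1 this).resolve_right hc
      simp [h1, h2] at hpq
    have hconj : aeval s p - aeval s q * w ≠ 0 := by
      intro h1
      obtain ⟨h2, h3⟩ := M.indep p (-q) (by rw [map_neg]; linear_combination h1)
      simp [h2, neg_eq_zero.1 h3] at hpq0
    obtain ⟨l, N, hNe, hN0⟩ := exists_pow_mul_of_ne_zero t hN
    refine ⟨(n : ℤ) + l - m, N, 0, r * p, -(r * q), by simpa using hN0, ?_, ?_⟩
    · simp only [eval_mul, eval_neg]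
      have := mul_ne_zero hr he'
      intro h0; apply this; linear_combination h0
    · have h1 := M.norm_eq p q
      rw [hNe] at h1
      have h2 : aeval s p + aeval s q * w =
          (s - algebraMap ℂ K t) ^ l * aeval s N / (aeval s p - aeval s q * w) := by
        rw [eq_div_iff hconj, h1]; simp
      have h3 : aeval s (r * p) + aeval s (-(r * q)) * w =
          aeval s r * (aeval s p - aeval s q * w) := by
        simp only [map_mul, map_neg]; ring
      rw [h2, h3, zpow_sub₀ hs, zpow_add₀ hs]
      simp only [zpow_natCast, map_zero, zero_mul, add_zero]
      field_simp
  · refine ⟨(n : ℤ) - m, p, q, r, 0, he, by simpa using hr, ?_⟩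
    rw [zpow_sub₀ hs]
    simp only [zpow_natCast, map_zero, zero_mul, add_zero]
    field_simp

theorem exists_factor (h0 : f.eval t = 0) (h1 : f.derivative.eval t ≠ 0) :
    ∃ f₁ : ℂ[X], f = (X - C t) * f₁ ∧ f₁.eval t = f.derivative.eval t ∧ f₁.eval t ≠ 0 := by
  obtain ⟨f₁, rfl⟩ := dvd_iff_isRoot.2 h0
  have : f₁.eval t = ((X - C t) * f₁).derivative.eval t := by simp [derivative_mul]
  exact ⟨f₁, rfl, this, this ▸ h1⟩

/-- At a simple root `s - t = w² / f₁` with `f₁(t) ≠ 0`, so powers of `s - t` are even powers of `w`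
up to units. One further factor `w` comes out of `p + q w` when `p(t) = 0`. -/
theorem isUniformizerAt_of_root (M : QuadraticModel K s w f) {t : ℂ} (h0 : f.eval t = 0)
    (h1 : f.derivative.eval t ≠ 0) : IsUniformizerAt s w t 0 w := by
  have hw := M.w_ne_zero
  have hs := M.sub_ne_zero t
  obtain ⟨f₁, rfl, -, hf⟩ := exists_factor h0 h1
  have hf0 := M.ne_zero_of_eval hf
  have hsq : s - algebraMap ℂ K t = w ^ 2 / aeval s f₁ := by
    rw [eq_div_iff hf0, M.sq]; simp
  refine ⟨hw, ⟨0, 1, by simp, by simp⟩, fun x hx => ?_⟩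
  obtain ⟨n, m, p, q, r, hpq, hr, rfl⟩ := M.exists_reduced t hx
  have hr0 := M.ne_zero_of_eval hr
  by_cases hp : p.eval t = 0
  · have hq : q.eval t ≠ 0 := hpq.resolve_left (not_not.2 hp)
    obtain ⟨p, rfl⟩ := dvd_iff_isRoot.2 hp
    refine ⟨2 * n - 2 * m + 1, q * f₁ ^ (m + 1), p * f₁ ^ m, r * f₁ ^ (n + 1), 0, ?_, ?_, ?_⟩
    · simp [hq, hf]
    · simp [hr, hf]
    · have h3 : aeval s ((X - C t) * p) = w ^ 2 / aeval s f₁ * aeval s p := by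
        rw [map_mul, ← hsq]; simp
      rw [h3, hsq, zpow_add₀ hw, zpow_sub₀ hw, zpow_mul, zpow_mul]
      simp only [zpow_natCast, zpow_ofNat, map_mul, map_pow, map_zero, zero_mul, add_zero,
        div_pow]
      field_simp
      ring
  · refine ⟨2 * n - 2 * m, p * f₁ ^ m, q * f₁ ^ m, r * f₁ ^ n, 0, ?_, ?_, ?_⟩
    · simp [hp, hf]
    · simp [hr, hf]
    · rw [hsq, zpow_sub₀ hw, zpow_mul, zpow_mul]
      simp only [zpow_natCast, zpow_ofNat, map_mul, map_pow, map_zero, zero_mul, add_zero,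
        div_pow]
      field_simp

namespace IsUniformizerAt

variable {t c : ℂ} {π : K} {V W : CurvePlace K}

theorem hasValue (h : IsUniformizerAt s w t c π) (hV : V.LiesOver s w t c) : V.HasValue π 0 := by
  obtain ⟨p, q, h0, h1⟩ := h.exists_el
  rw [h1, ← h0]
  exact hV.el p q

theorem val_lt_one (h : IsUniformizerAt s w t c π) (hV : V.LiesOver s w t c) :
    V.ring.valuation π < 1 := CurvePlace.hasValue_zero_iff.1 (h.hasValue hV)

theorem val_pos (h : IsUniformizerAt s w t c π) : 0 < V.ring.valuation π :=
  zero_lt_iff.2 (by simpa using h.ne_zero)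

/-- The exponent depends on the function and the point only, not on the place over it; this is what
makes the place unique. -/
theorem exists_val_eq (h : IsUniformizerAt s w t c π) {x : K} (hx : x ≠ 0) :
    ∃ n : ℤ, ∀ V : CurvePlace K, V.LiesOver s w t c →
      V.ring.valuation x = V.ring.valuation π ^ n := by
  obtain ⟨n, p, q, p', q', h1, h2, rfl⟩ := h.exists_pow x hx
  refine ⟨n, fun V hV => ?_⟩
  rw [map_mul, map_zpow₀, ((hV.el p q).div (hV.el p' q') h2).val_eq_one (div_ne_zero h1 h2),
    mul_one]

theorem val_zpow_le_one_iff (h : IsUniformizerAt s w t c π) (hV : V.LiesOver s w t c) {n : ℤ} :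
    V.ring.valuation π ^ n ≤ 1 ↔ 0 ≤ n := by
  constructor
  · intro h1
    by_contra h2
    push Not at h2
    exact absurd h1 (not_le.2 (one_lt_zpow_of_neg₀ h.val_pos (h.val_lt_one hV) h2))
  · intro h1
    obtain ⟨m, rfl⟩ := Int.eq_ofNat_of_zero_le h1
    rw [zpow_natCast]
    exact pow_le_one' (h.val_lt_one hV).le m

theorem place_unique (h : IsUniformizerAt s w t c π) (hV : V.LiesOver s w t c)
    (hW : W.LiesOver s w t c) : V = W := by
  refine CurvePlace.ext_ring fun x => ?_
  by_cases hx : x = 0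
  · simp [hx]
  obtain ⟨n, hn⟩ := h.exists_val_eq hx
  rw [← ValuationSubring.valuation_le_one_iff, ← ValuationSubring.valuation_le_one_iff, hn V hV,
    hn W hW, h.val_zpow_le_one_iff hV, h.val_zpow_le_one_iff hW]

theorem mem (h : IsUniformizerAt s w t c π) (hV : V.LiesOver s w t c) : π ∈ V.ring :=
  (h.hasValue hV).mem

theorem val_le_of_lt_one (h : IsUniformizerAt s w t c π) (hV : V.LiesOver s w t c) {x : K}
    (hx : V.ring.valuation x < 1) : V.ring.valuation x ≤ V.ring.valuation π := by
  by_cases hx0 : x = 0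
  · simp [hx0]
  obtain ⟨n, hn⟩ := h.exists_val_eq hx0
  rw [hn V hV] at hx ⊢
  have h1 : 0 ≤ n := (h.val_zpow_le_one_iff hV).1 hx.le
  have h2 : n ≠ 0 := by rintro rfl; simp at hx
  obtain ⟨m, rfl⟩ : ∃ m : ℕ, n = m + 1 := ⟨(n - 1).toNat, by omega⟩
  rw [show (m : ℤ) + 1 = ((m + 1 : ℕ) : ℤ) by push_cast; ring, zpow_natCast]
  exact pow_le_of_le_one zero_le (h.val_lt_one hV).le (by omega)

theorem maximalIdeal_eq (h : IsUniformizerAt s w t c π) (hV : V.LiesOver s w t c) :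
    IsLocalRing.maximalIdeal V.ring = Ideal.span {⟨π, h.mem hV⟩} := by
  ext x
  rw [ValuationSubring.valuation_lt_one_iff, Ideal.mem_span_singleton']
  constructor
  · intro hx
    obtain ⟨a, ha⟩ := (ValuationSubring.valuation_le_iff _ _ _).1 (h.val_le_of_lt_one hV hx)
    exact ⟨a, Subtype.ext ha⟩
  · rintro ⟨a, rfl⟩
    change V.ring.valuation ((a : K) * π) < 1
    rw [map_mul]
    exact (mul_le_of_le_one_left' (V.ring.valuation_le_one a)).trans_lt (h.val_lt_one hV)

/-- The valuation ring is the local ring of the affine curve `w² = f(s)` at the point: a nonnegative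
power of `π` can be absorbed in the numerator. -/
theorem exists_el_div (M : QuadraticModel K s w f) (h : IsUniformizerAt s w t c π)
    (hV : V.LiesOver s w t c) {x : K} (hx : x ∈ V.ring) :
    ∃ p q p' q' : ℂ[X], p'.eval t + q'.eval t * c ≠ 0 ∧
      x = (aeval s p + aeval s q * w) / (aeval s p' + aeval s q' * w) := by
  by_cases hx0 : x = 0
  · exact ⟨0, 0, 1, 0, by simp, by simp [hx0]⟩
  obtain ⟨n, p, q, p', q', h1, h2, rfl⟩ := h.exists_pow x hx0
  rw [← ValuationSubring.valuation_le_one_iff, map_mul, map_zpow₀,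
    ((hV.el p q).div (hV.el p' q') h2).val_eq_one (div_ne_zero h1 h2), mul_one,
    h.val_zpow_le_one_iff hV] at hx
  obtain ⟨m, rfl⟩ := Int.eq_ofNat_of_zero_le hx
  obtain ⟨a, b, -, hπ⟩ := h.exists_el
  have hmem : π ^ m * (aeval s p + aeval s q * w) ∈ Algebra.adjoin ℂ {s, w} :=
    mul_mem (pow_mem (hπ ▸ el_mem_adjoin s w a b) m) (el_mem_adjoin s w p q)
  obtain ⟨a, b, hab⟩ := M.exists_el_of_mem_adjoin hmem
  exact ⟨a, b, p', q', h2, by rw [← hab, zpow_natCast, mul_div_assoc]⟩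

end IsUniformizerAt

theorem val_sub_eq_sq (M : QuadraticModel K s w f) {t : ℂ} (h0 : f.eval t = 0)
    (h1 : f.derivative.eval t ≠ 0) {V : CurvePlace K} (hV : V.HasValue s t) :
    V.ring.valuation (s - algebraMap ℂ K t) = V.ring.valuation w ^ 2 := by
  obtain ⟨f₁, rfl, -, hf⟩ := exists_factor h0 h1
  rw [← map_pow, M.sq, map_mul, map_mul, (hV.aeval f₁).val_eq_one hf]
  simp

theorem liesOver_of_root (M : QuadraticModel K s w f) {t : ℂ} (h0 : f.eval t = 0)
    {V : CurvePlace K} (hV : V.HasValue s t) : V.LiesOver s w t 0 := by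
  refine ⟨hV, ?_⟩
  rw [CurvePlace.hasValue_zero_iff]
  apply CurvePlace.val_lt_one_of_pow (n := 2)
  rw [M.sq, (hV.aeval f).val_lt_one_iff, h0]

theorem liesOver_or (M : QuadraticModel K s w f) {t c : ℂ} (h : c ^ 2 = f.eval t)
    {V : CurvePlace K} (hV : V.HasValue s t) : V.LiesOver s w t c ∨ V.LiesOver s w t (-c) := by
  by_contra hcon
  rw [not_or] at hcon
  have h1 : ¬ V.HasValue w c := fun h => hcon.1 ⟨hV, h⟩
  have h2 : ¬ V.HasValue w (-c) := fun h => hcon.2 ⟨hV, h⟩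
  have h3 := hV.aeval f
  rw [← M.sq, ← h, CurvePlace.HasValue] at h3
  have h4 : w ^ 2 - algebraMap ℂ K (c ^ 2) =
      (w - algebraMap ℂ K c) * (w - algebraMap ℂ K (-c)) := by
    simp only [map_pow, map_neg]; ring
  rw [h4, map_mul] at h3
  exact absurd h3 (not_lt.2 (one_le_mul (not_lt.1 h1) (not_lt.1 h2)))

end QuadraticModel

end QuadraticModel


/-! ### Differentials of a quadratic extension of `ℂ(s)` -/

section Differentials

open Polynomial TensorProduct

namespace QuadraticModel

variable {K : Type*} [Field K] [Algebra ℂ K] {s w : K} {f : ℂ[X]}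

/-- Via `X ↦ s` the field `K` is formally étale over `ℂ[X]`, being a separable algebraic extension
of a localization. So its differentials are the base change of those of `ℂ[X]`, free on `ds`, and
`L` is the coordinate with respect to `ds`. -/
theorem exists_differential (M : QuadraticModel K s w f) :
    ∃ L : Ω[K⁄ℂ] ≃ₗ[K] K, L (KaehlerDifferential.D ℂ K s) = 1 := by
  let : Algebra ℂ[X] K := (aeval s).toAlgebra
  have halg : ∀ p : ℂ[X], algebraMap ℂ[X] K p = aeval s p := fun _ => rfl
  have : IsScalarTower ℂ ℂ[X] K := IsScalarTower.of_algebraMap_eq fun c => by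
    rw [halg]; simp
  have : FaithfulSMul ℂ[X] K := (faithfulSMul_iff_algebraMap_injective _ _).2 <|
    (injective_iff_map_eq_zero _).2 fun p hp => M.aeval_eq_zero.1 hp
  let : Algebra (FractionRing ℂ[X]) K := FractionRing.liftAlgebra ℂ[X] K
  have : IsScalarTower ℂ[X] (FractionRing ℂ[X]) K := FractionRing.isScalarTower_liftAlgebra _ _
  have hp : ∀ p : ℂ[X], IsAlgebraic (FractionRing ℂ[X]) (aeval s p) := fun p => by
    rw [← halg, IsScalarTower.algebraMap_apply ℂ[X] (FractionRing ℂ[X]) K]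
    exact isAlgebraic_algebraMap _
  have hw : IsAlgebraic (FractionRing ℂ[X]) w := by
    apply IsAlgebraic.of_pow two_pos
    rw [M.sq]
    exact hp f
  have : Algebra.IsAlgebraic (FractionRing ℂ[X]) K := ⟨fun x => by
    obtain ⟨p, q, r, -, rfl⟩ := M.gen x
    rw [div_eq_mul_inv]
    exact ((hp p).add ((hp q).mul hw)).mul (hp r).inv⟩
  have : Algebra.FormallyEtale (FractionRing ℂ[X]) K := Algebra.FormallyEtale.of_isSeparable _ _
  have : Algebra.FormallyEtale ℂ[X] (FractionRing ℂ[X]) :=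
    Algebra.FormallyEtale.of_isLocalization (nonZeroDivisors ℂ[X])
  have : Algebra.FormallyEtale ℂ[X] K := Algebra.FormallyEtale.comp _ (FractionRing ℂ[X]) _
  let e := KaehlerDifferential.tensorKaehlerEquivOfFormallyEtale ℂ ℂ[X] K
  let e' : K ⊗[ℂ[X]] Ω[ℂ[X]⁄ℂ] ≃ₗ[K] K :=
    (LinearEquiv.baseChange ℂ[X] K _ _ (KaehlerDifferential.polynomialEquiv ℂ)).trans
      (TensorProduct.AlgebraTensorModule.rid ℂ[X] K K)
  refine ⟨e.symm.trans e', ?_⟩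
  have : s = algebraMap ℂ[X] K X := by rw [halg, aeval_X]
  rw [LinearEquiv.trans_apply]
  conv_lhs => rw [this]
  rw [KaehlerDifferential.tensorKaehlerEquivOfFormallyEtale_symm_D_algebraMap]
  simp [e']

/-- The submodule `V · dV` of the differentials that are regular at the place `V`. -/
noncomputable def _root_.CurvePlace.regularAt (V : CurvePlace K) : Submodule ℂ (Ω[K⁄ℂ]) :=
  Submodule.span ℂ {ω | ∃ f ∈ V.ring, ∃ a ∈ V.ring, ω = f • KaehlerDifferential.D ℂ K a}

theorem two_mul_w_mul_D (M : QuadraticModel K s w f) (D : Derivation ℂ K K) :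
    2 * w * D w = aeval s (derivative f) * D s := by
  have h := congrArg D M.sq
  rw [D.map_aeval, pow_two, D.leibniz] at h
  simp only [smul_eq_mul] at h
  linear_combination h

/-- Elements of the valuation ring are fractions in `s` and `w` with unit denominator, so by the
Leibniz and quotient rules only `s` and `w` need to be tested. -/
theorem derivation_mem (M : QuadraticModel K s w f) {t c : ℂ} {π : K}
    (hπ : IsUniformizerAt s w t c π) {V : CurvePlace K} (hV : V.LiesOver s w t c)
    (D : Derivation ℂ K K) {μ : K} (hs : μ * D s ∈ V.ring) (hw : μ * D w ∈ V.ring) {x : K}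
    (hx : x ∈ V.ring) : μ * D x ∈ V.ring := by
  have hel : ∀ p q : ℂ[X], μ * D (aeval s p + aeval s q * w) ∈ V.ring := by
    intro p q
    have : μ * D (aeval s p + aeval s q * w) =
        aeval s (derivative p) * (μ * D s) + (w * aeval s (derivative q) * (μ * D s) +
          aeval s q * (μ * D w)) := by
      rw [map_add, D.leibniz, D.map_aeval, D.map_aeval]
      simp only [smul_eq_mul]
      ring
    rw [this]
    have h1 := fun p : ℂ[X] => (hV.1.aeval p).mem
    exact add_mem (mul_mem (h1 _) hs)
      (add_mem (mul_mem (mul_mem hV.2.mem (h1 _)) hs) (mul_mem (h1 _) hw))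
  obtain ⟨p, q, p', q', h1, rfl⟩ := hπ.exists_el_div M hV hx
  have hden := hV.el p' q'
  have hinv := (hden.inv h1).mem
  rw [D.leibniz_div]
  simp only [smul_eq_mul]
  have : ∀ a b da db : K, μ * (b⁻¹ ^ 2 * (b * da - a * db)) =
      b⁻¹ ^ 2 * (b * (μ * da) - a * (μ * db)) := fun _ _ _ _ => by ring
  rw [this]
  exact mul_mem (pow_mem hinv 2) (sub_mem (mul_mem hden.mem (hel _ _))
    (mul_mem (hV.el p q).mem (hel _ _)))

/-- The hypotheses say that `da` generates `V · dV` over the valuation ring: `μ` is the factor that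
turns the coordinate `L` with respect to `ds` into the one with respect to `da`. -/
theorem mem_regularAt_iff (M : QuadraticModel K s w f) {t c : ℂ} {π : K}
    (hπ : IsUniformizerAt s w t c π) {V : CurvePlace K} (hV : V.LiesOver s w t c)
    (L : Ω[K⁄ℂ] ≃ₗ[K] K) {μ : K} (hμ : μ ≠ 0)
    (hs : μ * L (KaehlerDifferential.D ℂ K s) ∈ V.ring)
    (hw : μ * L (KaehlerDifferential.D ℂ K w) ∈ V.ring) {a : K} (ha : a ∈ V.ring)
    (haμ : L (KaehlerDifferential.D ℂ K a) = μ⁻¹) (ω : Ω[K⁄ℂ]) :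
    ω ∈ V.regularAt ↔ μ * L ω ∈ V.ring := by
  constructor
  · intro h
    refine Submodule.span_induction ?_ ?_ ?_ ?_ h
    · rintro _ ⟨b, hb, x, hx, rfl⟩
      have h1 := M.derivation_mem hπ hV (L.toLinearMap.compDer (KaehlerDifferential.D ℂ K)) hs hw hx
      rw [map_smul, smul_eq_mul, mul_left_comm]
      exact mul_mem hb h1
    · simp
    · intro x y _ _ hx hy
      rw [map_add, mul_add]
      exact add_mem hx hy
    · intro r x _ hx
      rw [← algebraMap_smul K r x, map_smul, smul_eq_mul, mul_left_comm]
      exact mul_mem (V.const_mem r) hx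
  · intro h
    refine Submodule.subset_span ⟨μ * L ω, h, a, ha, L.injective ?_⟩
    rw [map_smul, haμ, smul_eq_mul]
    field_simp

/-- The differential `x · ds / w` is regular at a place over a finite point if and only if `x` is. -/
theorem mem_regularAt_iff_of_hasValue (M : QuadraticModel K s w f) {t : ℂ}
    (hf : f.eval t = 0 → f.derivative.eval t ≠ 0) {V : CurvePlace K} (hV : V.HasValue s t)
    (L : Ω[K⁄ℂ] ≃ₗ[K] K) (hL : L (KaehlerDifferential.D ℂ K s) = 1) (ω : Ω[K⁄ℂ]) :
    ω ∈ V.regularAt ↔ w * L ω ∈ V.ring := by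
  have hw := M.w_ne_zero
  have hDw := M.two_mul_w_mul_D (L.toLinearMap.compDer (KaehlerDifferential.D ℂ K))
  change 2 * w * L (KaehlerDifferential.D ℂ K w) =
    aeval s (derivative f) * L (KaehlerDifferential.D ℂ K s) at hDw
  rw [hL, mul_one] at hDw
  have h2 : V.HasValue (2 : K) 2 := by
    simpa only [map_ofNat] using CurvePlace.hasValue_const (V := V) 2
  have : CharZero K := charZero_of_injective_algebraMap (algebraMap ℂ K).injective
  by_cases h0 : f.eval t = 0
  · have hV' := M.liesOver_of_root h0 hV
    have hd := hV.aeval (derivative f)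
    have hd0 := M.ne_zero_of_eval (hf h0)
    -- At a branch point the parameter is `w`, and `2 w dw = f'(s) ds` gives `dw = μ⁻¹ ds` for this
    -- `μ`. Since `f'(t) ≠ 0`, `μ` is `w` up to a unit.
    rw [M.mem_regularAt_iff (M.isUniformizerAt_of_root h0 (hf h0)) hV' L
      (μ := 2 * w / aeval s (derivative f)) (by simp [hw, hd0]) ?_ ?_ hV'.2.mem ?_]
    · have hu := h2.div hd (hf h0)
      have hu' := (hd.div h2 two_ne_zero)
      constructor
      · intro h
        have : w * L ω = aeval s (derivative f) / 2 *
            (2 * w / aeval s (derivative f) * L ω) := by field_simp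
        rw [this]
        exact mul_mem hu'.mem h
      · intro h
        have : 2 * w / aeval s (derivative f) * L ω =
          2 / aeval s (derivative f) * (w * L ω) := by ring
        rw [this]
        exact mul_mem hu.mem h
    · rw [hL, mul_one]
      exact ((h2.mul hV'.2).div hd (hf h0)).mem
    · have : 2 * w / aeval s (derivative f) * L (KaehlerDifferential.D ℂ K w) = 1 := by
        field_simp
        linear_combination hDw
      rw [this]
      exact one_mem _
    · rw [inv_div]
      field_simp
      linear_combination hDw
  · obtain ⟨c, hc⟩ := IsAlgClosed.exists_pow_nat_eq (f.eval t) two_pos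
    have hc0 : c ≠ 0 := by
      rintro rfl
      simp at hc
      exact h0 hc.symm
    have key : ∀ c : ℂ, c ≠ 0 → V.LiesOver s w t c → (ω ∈ V.regularAt ↔ w * L ω ∈ V.ring) := by
      intro c hc0 hV'
      rw [M.mem_regularAt_iff (M.isUniformizerAt_of_ne hc0) hV' L (μ := 1) one_ne_zero ?_ ?_
        hV.mem (by simpa using hL), one_mul]
      · constructor
        · exact fun h => mul_mem hV'.2.mem h
        · intro h
          have : L ω = w⁻¹ * (w * L ω) := by field_simp
          rw [this]
          exact mul_mem (hV'.2.inv hc0).mem h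
      · rw [hL, mul_one]
        exact one_mem _
      · have : 1 * L (KaehlerDifferential.D ℂ K w) = aeval s (derivative f) / (2 * w) := by
          field_simp
          linear_combination hDw
        rw [this]
        exact ((hV.aeval _).div (h2.mul hV'.2) (mul_ne_zero two_ne_zero hc0)).mem
    rcases M.liesOver_or hc hV with hV' | hV'
    · exact key c hc0 hV'
    · exact key (-c) (neg_ne_zero.2 hc0) hV'

theorem aeval_inv_reflect {s : K} (hs : s ≠ 0) {N : ℕ} {p : ℂ[X]} (hp : p.natDegree ≤ N) :
    aeval s⁻¹ (reflect N p) * s ^ N = aeval s p := by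
  let _ := invertibleOfNonzero hs
  simpa [aeval_def] using eval₂_reflect_mul_pow (algebraMap ℂ K) s N p hp

theorem s_ne_zero (M : QuadraticModel K s w f) : s ≠ 0 := by simpa using M.sub_ne_zero 0

/-- The equation of a quadratic extension in terms of the coordinate `1 / s`. -/
theorem reverse (M : QuadraticModel K s w f) {n : ℕ} (hn : f.natDegree ≤ 2 * n) :
    QuadraticModel K s⁻¹ (w / s ^ n) (reflect (2 * n) f) := by
  have hs := M.s_ne_zero
  refine ⟨?_, fun p q h => ?_, fun x => ?_⟩
  · rw [div_pow, M.sq, ← aeval_inv_reflect hs hn, ← pow_mul, mul_comm n 2]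
    field_simp
  · obtain ⟨N, hp, hq⟩ : ∃ N, p.natDegree ≤ N ∧ q.natDegree ≤ N :=
      ⟨_, le_max_left _ _, le_max_right _ _⟩
    have hrefl : ∀ p : ℂ[X], p.natDegree ≤ N → (reflect N p).natDegree ≤ N := fun p hp =>
      natDegree_reflect_le.trans (max_le le_rfl hp)
    have h1 := aeval_inv_reflect hs (hrefl p hp)
    have h2 := aeval_inv_reflect hs (hrefl q hq)
    rw [reflect_reflect] at h1 h2
    have h3 := M.indep (X ^ n * reflect N p) (reflect N q) (by
      rw [map_mul, ← h1, ← h2, map_pow, aeval_X]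
      have : s ^ N * s ^ n * (aeval s⁻¹ p + aeval s⁻¹ q * (w / s ^ n)) = 0 := by rw [h, mul_zero]
      rw [← this]
      field_simp)
    simpa [reflect_eq_zero_iff] using h3
  · obtain ⟨p, q, r, hr, rfl⟩ := M.gen x
    let N := max p.natDegree (max q.natDegree r.natDegree)
    refine ⟨X ^ n * reflect N p, reflect N q, X ^ n * reflect N r,
      mul_ne_zero (pow_ne_zero _ X_ne_zero) (by simpa [reflect_eq_zero_iff] using hr), ?_⟩
    have hr0 := M.aeval_ne_zero hr
    rw [← aeval_inv_reflect hs (p := p) (N := N) (by simp [N]),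
      ← aeval_inv_reflect hs (p := q) (N := N) (by simp [N]),
      ← aeval_inv_reflect hs (p := r) (N := N) (by simp [N])] at *
    simp only [map_mul, map_pow, aeval_X, inv_pow]
    have : aeval s⁻¹ (reflect N r) ≠ 0 := left_ne_zero_of_mul hr0
    generalize aeval s⁻¹ (reflect N r) = r' at *
    generalize aeval s⁻¹ (reflect N q) = q'
    generalize aeval s⁻¹ (reflect N p) = p'
    field_simp

/-- The point `s = ∞` is a simple branch point when the degree is odd and no branch point when it is
even. -/
theorem reflect_simple_zero {n : ℕ} (hn : f.natDegree = 2 * n + 1 ∨ f.natDegree = 2 * n + 2) :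
    (reflect (2 * (n + 1)) f).eval 0 = 0 → (reflect (2 * (n + 1)) f).derivative.eval 0 ≠ 0 := by
  rw [← coeff_zero_eq_eval_zero, ← coeff_zero_eq_eval_zero, coeff_derivative, coeff_reflect,
    coeff_reflect, revAt_le (by omega), revAt_le (by omega)]
  intro h
  have h1 : f ≠ 0 := by rintro rfl; simp at hn
  have h2 : f.natDegree = 2 * n + 1 := by
    refine hn.resolve_right fun h2 => h1 ?_
    rw [← leadingCoeff_eq_zero, leadingCoeff, h2]
    exact h
  have h3 : 2 * (n + 1) - (0 + 1) = f.natDegree := by omega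
  rw [h3]
  simpa using h1

/-- A quotient `(p + q w) / r` in lowest terms with a pole over `s = t` is not regular there. -/
theorem exists_notMem (M : QuadraticModel K s w f) {t : ℂ}
    (hf : f.eval t = 0 → f.derivative.eval t ≠ 0) {p q r : ℂ[X]}
    (hpq : p.eval t ≠ 0 ∨ q.eval t ≠ 0) (hr0 : r ≠ 0) (hr : r.eval t = 0) :
    ∃ V : CurvePlace K, V.HasValue s t ∧ (aeval s p + aeval s q * w) / aeval s r ∉ V.ring := by
  have hlt : ∀ V : CurvePlace K, V.HasValue s t → V.ring.valuation (aeval s r) < 1 := fun V hV =>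
    (hV.aeval r).val_lt_one_iff.2 hr
  have hpos : ∀ V : CurvePlace K, 0 < V.ring.valuation (aeval s r) := fun V =>
    zero_lt_iff.2 (by simpa using M.aeval_ne_zero hr0)
  have key : ∀ V : CurvePlace K, V.HasValue s t →
      V.ring.valuation (aeval s r) < V.ring.valuation (aeval s p + aeval s q * w) →
      (aeval s p + aeval s q * w) / aeval s r ∉ V.ring := by
    intro V _ h hmem
    rw [← ValuationSubring.valuation_le_one_iff, map_div₀, div_le_one₀ (hpos V)] at hmem
    exact absurd h (not_lt.2 hmem)
  by_cases h0 : f.eval t = 0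
  · obtain ⟨V, hV⟩ := M.exists_place (t := t) (c := 0) (by simp [h0])
    refine ⟨V, hV.1, key V hV.1 ?_⟩
    by_cases hp : p.eval t = 0
    · have hq : q.eval t ≠ 0 := hpq.resolve_left (not_not.2 hp)
      have hw1 : V.ring.valuation w < 1 := CurvePlace.hasValue_zero_iff.1 hV.2
      have hw0 : 0 < V.ring.valuation w := zero_lt_iff.2 (by simpa using M.w_ne_zero)
      -- At a branch point `s - t` has order `2`, so polynomials in `s` vanishing at `t` have larger
      -- order than `w`.
      have hdiv : ∀ r : ℂ[X], r.eval t = 0 → V.ring.valuation (aeval s r) < V.ring.valuation w := by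
        intro r hr
        obtain ⟨r, rfl⟩ := dvd_iff_isRoot.2 hr
        have h1 := M.val_sub_eq_sq h0 (hf h0) hV.1
        rw [map_mul, map_mul]
        have h2 : aeval s (X - C t) = s - algebraMap ℂ K t := by simp
        rw [h2, h1]
        refine (mul_le_of_le_one_right' (hV.1.aeval r).val_le_one).trans_lt ?_
        exact pow_lt_self_of_lt_one₀ hw0 hw1 one_lt_two
      have h1 : V.ring.valuation (aeval s q * w) = V.ring.valuation w := by
        rw [map_mul, (hV.1.aeval q).val_eq_one hq, one_mul]
      rw [Valuation.map_add_eq_of_lt_right _ (by rw [h1]; exact hdiv p hp), h1]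
      exact hdiv r hr
    · rw [(hV.el p q).val_eq_one (by simpa using hp)]
      exact hlt V hV.1
  · obtain ⟨c, hc⟩ := IsAlgClosed.exists_pow_nat_eq (f.eval t) two_pos
    have hc0 : c ≠ 0 := by
      rintro rfl
      simp at hc
      exact h0 hc.symm
    obtain ⟨c, hc, hne⟩ : ∃ c, c ^ 2 = f.eval t ∧ p.eval t + q.eval t * c ≠ 0 := by
      by_contra hcon
      push Not at hcon
      have h1 := hcon c hc
      have h2 := hcon (-c) (by simpa using hc)
      have h3 : p.eval t = 0 := by linear_combination (h1 + h2) / 2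
      have h4 : q.eval t * c = 0 := by linear_combination (h1 - h2) / 2
      simp [h3, hc0] at h4 hpq
      exact hpq h4
    obtain ⟨V, hV⟩ := M.exists_place hc
    refine ⟨V, hV.1, key V hV.1 ?_⟩
    rw [(hV.el p q).val_eq_one hne]
    exact hlt V hV.1

/-- A function with no pole over the finite points is a polynomial in `s` and `w`. -/
theorem exists_el_of_forall_mem (M : QuadraticModel K s w f)
    (hf : ∀ t, f.eval t = 0 → f.derivative.eval t ≠ 0) {x : K}
    (hx : ∀ (V : CurvePlace K) (t : ℂ), V.HasValue s t → x ∈ V.ring) :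
    ∃ p q : ℂ[X], x = aeval s p + aeval s q * w := by
  obtain ⟨p, q, r, hr, rfl⟩ := M.gen x
  induction hN : r.natDegree generalizing p q r with
  | zero =>
    obtain ⟨c, rfl⟩ := natDegree_eq_zero.1 hN
    refine ⟨p * C c⁻¹, q * C c⁻¹, ?_⟩
    simp only [map_mul, aeval_C, map_inv₀]
    ring
  | succ N ih =>
    obtain ⟨t, ht⟩ := IsAlgClosed.exists_root r (by
      rw [degree_eq_natDegree hr, hN]; exact_mod_cast N.succ_ne_zero)
    by_cases hpq : p.eval t ≠ 0 ∨ q.eval t ≠ 0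
    · obtain ⟨V, hV, hV'⟩ := M.exists_notMem (hf t) hpq hr ht
      exact absurd (hx V t hV) hV'
    · push Not at hpq
      obtain ⟨p, rfl⟩ := dvd_iff_isRoot.2 hpq.1
      obtain ⟨q, rfl⟩ := dvd_iff_isRoot.2 hpq.2
      obtain ⟨r, rfl⟩ := dvd_iff_isRoot.2 ht
      have hX := M.aeval_ne_zero (X_sub_C_ne_zero t)
      have hr' : r ≠ 0 := right_ne_zero_of_mul hr
      have hr0 := M.aeval_ne_zero hr'
      have heq : (aeval s ((X - C t) * p) + aeval s ((X - C t) * q) * w) / aeval s ((X - C t) * r) =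
          (aeval s p + aeval s q * w) / aeval s r := by
        simp only [map_mul]
        generalize aeval s (X - C t) = y at *
        field_simp
      rw [heq] at hx ⊢
      refine ih p q r hr' hx ?_
      rw [natDegree_mul (X_sub_C_ne_zero t) hr', natDegree_X_sub_C] at hN
      omega

/-- The change of coordinate `ds = -s² d(1/s)`, which transports the criterion for regularity to `s
= ∞`. -/
theorem mul_differential_reverse (M : QuadraticModel K s w f) (n : ℕ) (L L' : Ω[K⁄ℂ] ≃ₗ[K] K)
    (hL : L (KaehlerDifferential.D ℂ K s) = 1) (hL' : L' (KaehlerDifferential.D ℂ K s⁻¹) = 1)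
    (ω : Ω[K⁄ℂ]) : w / s ^ n * L' ω = -(s ^ 2 / s ^ n) * (w * L ω) := by
  have hs := M.s_ne_zero
  have hω : ω = L ω • KaehlerDifferential.D ℂ K s := L.injective (by simp [hL])
  have h1 : L' (KaehlerDifferential.D ℂ K s) = -s ^ 2 := by
    rw [Derivation.leibniz_inv, map_smul, smul_eq_mul] at hL'
    field_simp at hL'
    linear_combination -hL'
  have h2 : L' ω = L ω * -s ^ 2 := by
    conv_lhs => rw [hω]
    rw [map_smul, h1, smul_eq_mul]
  rw [h2]
  ring

/-- Write a differential as `x ds / w`. Regularity over finite points means `x = p + q w` with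
polynomials `p, q`; regularity at infinity kills `q` and bounds the degree of `p`. This leaves the
classical basis `s^i ds / w`, `i < g`. -/
theorem mem_regularDifferentials_iff (M : QuadraticModel K s w f) {g : ℕ}
    (hf : ∀ t, f.eval t = 0 → f.derivative.eval t ≠ 0)
    (hg : f.natDegree = 2 * g + 1 ∨ f.natDegree = 2 * g + 2) (L : Ω[K⁄ℂ] ≃ₗ[K] K)
    (hL : L (KaehlerDifferential.D ℂ K s) = 1) (ω : Ω[K⁄ℂ]) :
    ω ∈ regularDifferentials K ↔ ∃ p ∈ degreeLT ℂ g, w * L ω = aeval s p := by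
  have hs := M.s_ne_zero
  have M' := M.reverse (n := g + 1) (by omega)
  obtain ⟨L', hL'⟩ := M'.exists_differential
  have hLL := M.mul_differential_reverse (g + 1) L L' hL hL' ω
  have hmem : ω ∈ regularDifferentials K ↔ ∀ V : CurvePlace K, ω ∈ V.regularAt := by
    simp only [regularDifferentials, Submodule.mem_iInf]
    rfl
  rw [hmem]
  constructor
  · intro h
    obtain ⟨p, q, hx⟩ := M.exists_el_of_forall_mem hf (x := w * L ω) fun V t hV =>
      (M.mem_regularAt_iff_of_hasValue (hf t) hV L hL ω).1 (h V)
    by_cases hpq : p = 0 ∧ q = 0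
    · exact ⟨0, Submodule.zero_mem _, by rw [hx]; simp [hpq]⟩
    -- Since `w` has weight `g + 1` at infinity, `p + q w` equals `s^(N+g+1)` times the combination
    -- of the two reflected polynomials with `w / s^(g+1)`.
    obtain ⟨N, hNg, hp, hq⟩ : ∃ N, g ≤ N ∧ p.natDegree ≤ N + g + 1 ∧ q.natDegree ≤ N :=
      ⟨max g (max p.natDegree q.natDegree), le_max_left _ _, by
        have := le_max_right g (max p.natDegree q.natDegree)
        have := le_max_left p.natDegree q.natDegree
        omega, (le_max_right _ _).trans (le_max_right _ _)⟩
    obtain ⟨m, P, Q, hP, hQ, hPQ⟩ := exists_pow_mul_of_pair 0 (reflect (N + g + 1) p)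
      (reflect N q) (by
        rw [Ne, Ne, reflect_eq_zero_iff, reflect_eq_zero_iff]
        exact not_and_or.1 hpq)
    rw [C_0, sub_zero] at hP hQ
    have hlow : ∀ (N : ℕ) (p P : ℂ[X]), reflect N p = X ^ m * P → ∀ j, j ≤ N → N - j < m →
        p.coeff j = 0 := by
      intro N p P h j hj hm
      have h1 := congrArg (fun r => coeff r (N - j)) h
      simp only [coeff_reflect, revAt_le (Nat.sub_le N j), Nat.sub_sub_self hj, coeff_X_pow_mul',
        if_neg (not_le.2 hm)] at h1
      exact h1
    -- After the common factor `s^(-m)` is removed, the function to be regular at infinity is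
    -- `-s^(N+2-m) (P + Q w / s^(g+1))`, so `m ≥ N + 2`. That annihilates all of `q` and the
    -- coefficients of `p` in degrees at least `g`.
    have hmN : N + 1 < m := by
      by_contra hmN
      obtain ⟨e, he⟩ : ∃ e, N + 1 = m + e := ⟨N + 1 - m, by omega⟩
      obtain ⟨V, hV, hV'⟩ := M'.exists_notMem (t := 0) (reflect_simple_zero hg) hPQ
        (r := X ^ (e + 1)) (pow_ne_zero _ X_ne_zero) (by simp)
      apply hV'
      have h1 := (M'.mem_regularAt_iff_of_hasValue (reflect_simple_zero hg) hV L' hL' ω).1 (h V)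
      rw [hLL, hx, ← aeval_inv_reflect hs hp, ← aeval_inv_reflect hs hq, hP, hQ] at h1
      have h2 : (aeval s⁻¹ P + aeval s⁻¹ Q * (w / s ^ (g + 1))) / aeval s⁻¹ (X ^ (e + 1) : ℂ[X]) =
          -(-(s ^ 2 / s ^ (g + 1)) * (aeval s⁻¹ (X ^ m * P) * s ^ (N + g + 1) +
            aeval s⁻¹ (X ^ m * Q) * s ^ N * w)) := by
        simp only [map_mul, map_pow, aeval_X, inv_pow]
        generalize aeval s⁻¹ P = P'
        generalize aeval s⁻¹ Q = Q'
        have h3 : s ^ (N + g + 1) = s ^ m * s ^ e * s ^ g := by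
          rw [← pow_add, ← he, ← pow_add]; ring
        have h4 : s ^ N = s ^ m * s ^ e / s := by
          rw [← pow_add, ← he, pow_succ]; field_simp
        rw [h3, h4]
        field_simp
        ring
      rw [h2]
      exact neg_mem h1
    have hq0 : q = 0 := by
      ext j
      by_cases hj : j ≤ N
      · rw [hlow N q Q hQ j hj (by omega), coeff_zero]
      · rw [coeff_eq_zero_of_natDegree_lt (by omega), coeff_zero]
    refine ⟨p, ?_, by rw [hx, hq0]; simp⟩
    rw [mem_degreeLT, degree_lt_iff_coeff_zero]
    intro j hj
    by_cases hj' : j ≤ N + g + 1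
    · exact hlow _ p P hP j hj' (by omega)
    · exact coeff_eq_zero_of_natDegree_lt (by omega)
  · rintro ⟨p, hp, hx⟩ V
    rcases M.exists_value_or V with hV | ⟨t, hV⟩
    · rw [M'.mem_regularAt_iff_of_hasValue (reflect_simple_zero hg) hV L' hL' ω, hLL, hx]
      rw [mem_degreeLT] at hp
      by_cases hp0 : p = 0
      · simp [hp0]
      · rw [degree_eq_natDegree hp0] at hp
        have hp' : p.natDegree < g := by exact_mod_cast hp
        obtain ⟨e, rfl⟩ : ∃ e, g = e + 1 := ⟨g - 1, by omega⟩
        rw [← aeval_inv_reflect hs (N := e) (by omega)]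
        have : -(s ^ 2 / s ^ (e + 1 + 1)) * (aeval s⁻¹ (reflect e p) * s ^ e) =
            -(aeval s⁻¹ (reflect e p)) := by
          generalize aeval s⁻¹ (reflect e p) = P'
          field_simp
          ring
        rw [this]
        exact neg_mem (hV.aeval _).mem
    · rw [M.mem_regularAt_iff_of_hasValue (hf t) hV L hL ω, hx]
      exact (hV.aeval p).mem

/-- The genus of the hyperelliptic function field `ℂ(s, √f)`. -/
theorem genus_eq (M : QuadraticModel K s w f) {g : ℕ}
    (hf : ∀ t, f.eval t = 0 → f.derivative.eval t ≠ 0)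
    (hg : f.natDegree = 2 * g + 1 ∨ f.natDegree = 2 * g + 2) : functionFieldGenus K = g := by
  obtain ⟨L, hL⟩ := M.exists_differential
  have hw := M.w_ne_zero
  let Φ : degreeLT ℂ g →ₗ[ℂ] Ω[K⁄ℂ] := (L.symm.toLinearMap.restrictScalars ℂ).comp
    ((LinearMap.mulLeft ℂ w⁻¹).comp ((aeval s).toLinearMap.comp (degreeLT ℂ g).subtype))
  have hΦ : ∀ p, Φ p = L.symm (w⁻¹ * aeval s (p : ℂ[X])) := fun p => rfl
  have hinj : Function.Injective Φ := by
    rw [injective_iff_map_eq_zero]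
    intro p hp
    rw [hΦ, LinearEquiv.map_eq_zero_iff, mul_eq_zero] at hp
    exact Subtype.ext (M.aeval_eq_zero.1 (hp.resolve_left (inv_ne_zero hw)))
  have hrange : LinearMap.range Φ = regularDifferentials K := by
    ext ω
    rw [M.mem_regularDifferentials_iff hf hg L hL]
    constructor
    · rintro ⟨p, rfl⟩
      exact ⟨p, p.2, by rw [hΦ, LinearEquiv.apply_symm_apply]; field_simp⟩
    · rintro ⟨p, hp, h⟩
      refine ⟨⟨p, hp⟩, ?_⟩
      rw [hΦ, LinearEquiv.symm_apply_eq, ← h]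
      field_simp
  rw [functionFieldGenus, ← hrange, LinearMap.finrank_range_of_inj hinj,
    (degreeLTEquiv ℂ g).finrank_eq]
  simp

end QuadraticModel

end Differentials


/-! ### Multiplicities of branches -/

section Multiplicities

open Polynomial

namespace CurvePlace

variable {K : Type*} [Field K] [Algebra ℂ K] {V : CurvePlace K}

theorem le_localizeAt (V : CurvePlace K) (R : Subalgebra ℂ K) : R ≤ V.localizeAt R := fun x hx =>
  ⟨x, hx, 1, R.one_mem, by rw [ValuationSubring.mem_nonunits_iff]; simp, by simp⟩

theorem le_blowUp (V : CurvePlace K) (O : Subalgebra ℂ K) : O ≤ V.blowUp O := fun _ hx =>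
  V.le_localizeAt _ (Algebra.subset_adjoin (Or.inl hx))

theorem div_mem_localizeAt {R : Subalgebra ℂ K} {x y : K} (hx : x ∈ V.localizeAt R)
    (hy : y ∈ V.localizeAt R) (h : 1 ≤ V.ring.valuation y) : x / y ∈ V.localizeAt R := by
  obtain ⟨a, ha, b, hb, hb', rfl⟩ := hx
  obtain ⟨a', ha', b', hb1, hb1', rfl⟩ := hy
  have h0 : ∀ b, b ∉ V.ring.nonunits → b ≠ 0 := by
    rintro b hb rfl
    exact hb V.ring.nonunits.zero_mem
  refine ⟨a * b', R.mul_mem ha hb1, b * a', R.mul_mem hb ha', ?_, by rw [div_div_div_eq]⟩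
  rw [ValuationSubring.mem_nonunits_iff, not_lt] at *
  rw [map_div₀] at h
  rw [map_mul]
  refine one_le_mul hb' ?_
  by_contra hlt
  have hpos : 0 < V.ring.valuation b' := zero_lt_one.trans_le hb1'
  rw [one_le_div₀ hpos] at h
  exact absurd (hb1'.trans h) hlt

theorem localizeAt_le {R A : Subalgebra ℂ K} (hRA : R ≤ A)
    (hA : ∀ x ∈ A, ∀ y ∈ A, 1 ≤ V.ring.valuation y → x / y ∈ A) : V.localizeAt R ≤ A := by
  rintro _ ⟨a, ha, b, hb, hb', rfl⟩
  rw [ValuationSubring.mem_nonunits_iff, not_lt] at hb'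
  exact hA a (hRA ha) b (hRA hb) hb'

theorem localizeAt_le_localizeAt {R S : Subalgebra ℂ K} (h : R ≤ V.localizeAt S) :
    V.localizeAt R ≤ V.localizeAt S :=
  localizeAt_le h fun _ hx _ hy => div_mem_localizeAt hx hy

/-- The valuation ring of a place as a subalgebra. -/
def toSubalgebra (V : CurvePlace K) : Subalgebra ℂ K :=
  { V.ring.toSubring with algebraMap_mem' := V.const_mem }

theorem mem_toSubalgebra {x : K} : x ∈ V.toSubalgebra ↔ x ∈ V.ring := Iff.rfl

/-- The subalgebra `A` is a local ring dominated by the place `V`. -/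
structure Dominates (V : CurvePlace K) (A : Subalgebra ℂ K) : Prop where
  le : A ≤ V.toSubalgebra
  inv_mem : ∀ x ∈ A, V.ring.valuation x = 1 → x⁻¹ ∈ A

theorem dominates_toSubalgebra (V : CurvePlace K) : V.Dominates V.toSubalgebra := by
  refine ⟨le_rfl, fun x _ h => ?_⟩
  rw [mem_toSubalgebra, ← ValuationSubring.valuation_le_one_iff, map_inv₀, h, inv_one]

theorem Dominates.val_le {A : Subalgebra ℂ K} (hA : V.Dominates A) {x : K} (hx : x ∈ A) :
    V.ring.valuation x ≤ 1 := (V.ring.valuation_le_one_iff x).2 (hA.le hx)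

theorem Dominates.div_mem {A : Subalgebra ℂ K} (hA : V.Dominates A) {x y : K} (hx : x ∈ A)
    (hy : y ∈ A) (h : 1 ≤ V.ring.valuation y) : x / y ∈ A := by
  rw [div_eq_mul_inv]
  exact A.mul_mem hx (hA.inv_mem y hy (le_antisymm (hA.val_le hy) h))

theorem Dominates.localizeAt_le {R A : Subalgebra ℂ K} (hA : V.Dominates A) (hRA : R ≤ A) :
    V.localizeAt R ≤ A :=
  CurvePlace.localizeAt_le hRA fun _ hx _ hy => hA.div_mem hx hy

theorem branchMultiplicity_of {π : K} (hπ : π ∈ V.ring)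
    (hmax : IsLocalRing.maximalIdeal V.ring = Ideal.span {⟨π, hπ⟩}) {O : Subalgebra ℂ K} {m : ℕ}
    {x : K} (hx : x ∈ O) (hx1 : V.ring.valuation x < 1)
    (hxm : V.ring.valuation x = V.ring.valuation π ^ m)
    (h : ∀ y ∈ O, V.ring.valuation y < 1 → V.ring.valuation y ≤ V.ring.valuation π ^ m) :
    V.BranchMultiplicity O m := by
  unfold BranchMultiplicity
  rw [hmax, Ideal.span_singleton_pow]
  apply le_antisymm
  · rw [Ideal.span_le]
    rintro y ⟨hy, hy'⟩
    rw [ValuationSubring.mem_nonunits_iff] at hy'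
    have h1 := h y hy hy'
    rw [← map_pow] at h1
    obtain ⟨a, ha⟩ := (ValuationSubring.valuation_le_iff _ _ _).1 h1
    exact Ideal.mem_span_singleton'.2 ⟨a, Subtype.ext ha⟩
  · rw [Ideal.span_singleton_le_iff_mem]
    rw [← map_pow] at hxm
    obtain ⟨a, ha⟩ := (ValuationSubring.valuation_le_iff _ _ _).1 hxm.ge
    have hx0 : x ∈ V.ring := (V.ring.valuation_le_one_iff x).1 hx1.le
    have h1 : (⟨π, hπ⟩ : V.ring) ^ m = a * ⟨x, hx0⟩ := Subtype.ext ha.symm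
    rw [h1]
    refine Ideal.mul_mem_left _ _ (Ideal.subset_span ⟨hx, ?_⟩)
    rwa [ValuationSubring.mem_nonunits_iff]

theorem branchMultiplicity_unique {π : K} (hπ : π ∈ V.ring) (hπ0 : π ≠ 0)
    (hπ1 : V.ring.valuation π < 1)
    (hmax : IsLocalRing.maximalIdeal V.ring = Ideal.span {⟨π, hπ⟩}) {O : Subalgebra ℂ K} {m n : ℕ}
    (hm : V.BranchMultiplicity O m) (hn : V.BranchMultiplicity O n) : m = n := by
  unfold BranchMultiplicity at hm hn
  rw [hm, hmax, Ideal.span_singleton_pow, Ideal.span_singleton_pow] at hn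
  have key : ∀ a b : ℕ, Ideal.span {(⟨π, hπ⟩ : V.ring) ^ a} ≤ Ideal.span {(⟨π, hπ⟩ : V.ring) ^ b} →
      b ≤ a := by
    intro a b hab
    rw [Ideal.span_singleton_le_iff_mem, Ideal.mem_span_singleton'] at hab
    obtain ⟨c, hc⟩ := hab
    have hc' : (c : K) * π ^ b = π ^ a := congrArg Subtype.val hc
    have h1 := congrArg V.ring.valuation hc'
    rw [map_mul, map_pow, map_pow] at h1
    by_contra hlt
    have h2 : V.ring.valuation π ^ b < V.ring.valuation π ^ a :=
      pow_lt_pow_right_of_lt_one₀ (zero_lt_iff.2 (by simpa using hπ0)) hπ1 (not_le.1 hlt)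
    rw [← h1] at h2
    exact absurd h2 (not_lt.2 (mul_le_of_le_one_left' (V.ring.valuation_le_one c)))
  exact le_antisymm (key n m hn.ge) (key m n hn.le)

/-- Elements of the maximal ideal of the local ring of a point with affine coordinates `u`, `u τ`
are divisible by `u` in every local ring dominated by `V` that contains `u` and `τ`. -/
theorem Dominates.exists_eq_mul {A : Subalgebra ℂ K} (hA : V.Dominates A) {u τ : K} (hu : u ∈ A)
    (hτ : τ ∈ A) (hu1 : V.ring.valuation u < 1) {y : K}
    (hy : y ∈ V.localizeAt (Algebra.adjoin ℂ {u, u * τ})) (hy1 : V.ring.valuation y < 1) :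
    ∃ a ∈ A, y = u * a := by
  -- Every polynomial in `u` and `u τ` is a constant plus a multiple of `u`; vanishing at `V`
  -- removes the constant.
  have key : ∀ x ∈ Algebra.adjoin ℂ {u, u * τ}, ∃ (c : ℂ), ∃ a ∈ A, x = algebraMap ℂ K c + u * a := by
    intro x hx
    induction hx using Algebra.adjoin_induction with
    | mem x hx =>
      rcases hx with rfl | rfl
      · exact ⟨0, 1, A.one_mem, by simp⟩
      · exact ⟨0, τ, hτ, by simp⟩
    | algebraMap r => exact ⟨r, 0, A.zero_mem, by simp⟩
    | add x y _ _ hx hy =>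
      obtain ⟨c, a, ha, rfl⟩ := hx
      obtain ⟨d, b, hb, rfl⟩ := hy
      exact ⟨c + d, a + b, A.add_mem ha hb, by rw [map_add]; ring⟩
    | mul x y _ _ hx hy =>
      obtain ⟨c, a, ha, rfl⟩ := hx
      obtain ⟨d, b, hb, rfl⟩ := hy
      refine ⟨c * d, algebraMap ℂ K c * b + algebraMap ℂ K d * a + u * a * b, ?_, ?_⟩
      · exact A.add_mem (A.add_mem (A.mul_mem (A.algebraMap_mem c) hb)
          (A.mul_mem (A.algebraMap_mem d) ha)) (A.mul_mem (A.mul_mem hu ha) hb)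
      · rw [map_mul]; ring
  obtain ⟨x, hx, z, hz, hz', rfl⟩ := hy
  rw [ValuationSubring.mem_nonunits_iff, not_lt] at hz'
  have hle : Algebra.adjoin ℂ {u, u * τ} ≤ A := by
    rw [Algebra.adjoin_le_iff]
    rintro x (rfl | rfl)
    · exact hu
    · exact A.mul_mem hu hτ
  obtain ⟨c, a, ha, rfl⟩ := key x hx
  have hz1 : V.ring.valuation z = 1 := le_antisymm (hA.val_le (hle hz)) hz'
  have hu0 : V.HasValue u 0 := hasValue_zero_iff.2 hu1
  have hua : V.ring.valuation (u * a) < 1 := by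
    rw [map_mul]
    exact (mul_le_of_le_one_right' (hA.val_le ha)).trans_lt hu1
  have hval : V.HasValue (algebraMap ℂ K c + u * a) (c + 0) :=
    (hasValue_const c).add (hasValue_zero_iff.2 hua)
  rw [map_div₀, hz1, div_one, hval.val_lt_one_iff, add_zero] at hy1
  subst hy1
  refine ⟨a / z, hA.div_mem ha (hle hz) hz', ?_⟩
  rw [map_zero]
  ring

theorem val_le_of_mem_localizeAt {u τ : K} (hτ : τ ∈ V.ring)
    (hu1 : V.ring.valuation u < 1) {y : K}
    (hy : y ∈ V.localizeAt (Algebra.adjoin ℂ {u, u * τ})) (hy1 : V.ring.valuation y < 1) :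
    V.ring.valuation y ≤ V.ring.valuation u := by
  have hu : u ∈ V.ring := (V.ring.valuation_le_one_iff u).1 hu1.le
  obtain ⟨a, ha, rfl⟩ := V.dominates_toSubalgebra.exists_eq_mul hu hτ hu1 hy hy1
  rw [map_mul]
  exact mul_le_of_le_one_right' ((V.ring.valuation_le_one_iff a).2 ha)

theorem branchMultiplicity_localizeAt {π : K} (hπ : π ∈ V.ring)
    (hmax : IsLocalRing.maximalIdeal V.ring = Ideal.span {⟨π, hπ⟩}) {u τ : K} (hτ : τ ∈ V.ring)
    (hu1 : V.ring.valuation u < 1) {m : ℕ}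
    (hum : V.ring.valuation u = V.ring.valuation π ^ m) :
    V.BranchMultiplicity (V.localizeAt (Algebra.adjoin ℂ {u, u * τ})) m :=
  branchMultiplicity_of hπ hmax (V.le_localizeAt _ (Algebra.subset_adjoin (by simp))) hu1 hum
    fun _ hy hy1 => hum ▸ val_le_of_mem_localizeAt hτ hu1 hy hy1

/-- The function `u` has least order in the maximal ideal, so the blow-up adjoins `(u τ) / u`. -/
theorem mem_blowUp_localizeAt {u τ : K} (hτ : τ ∈ V.ring) (hu0 : u ≠ 0)
    (hu1 : V.ring.valuation u < 1) :
    τ ∈ V.blowUp (V.localizeAt (Algebra.adjoin ℂ {u, u * τ})) := by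
  have h1 : ∀ x ∈ ({u, u * τ} : Set K), x ∈ V.localizeAt (Algebra.adjoin ℂ {u, u * τ}) :=
    fun x hx => V.le_localizeAt _ (Algebra.subset_adjoin hx)
  refine V.le_localizeAt _ (Algebra.subset_adjoin (Or.inr ?_))
  refine ⟨u * τ, h1 _ (by simp), u, h1 _ (by simp), ?_, ?_, hu0, ?_, by field_simp⟩
  · rw [ValuationSubring.mem_nonunits_iff, map_mul]
    exact (mul_le_of_le_one_right' ((V.ring.valuation_le_one_iff τ).2 hτ)).trans_lt hu1
  · rwa [ValuationSubring.mem_nonunits_iff]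
  · intro c hc hc'
    rw [ValuationSubring.mem_nonunits_iff] at hc'
    have hpos : 0 < V.ring.valuation u := zero_lt_iff.2 (by simpa using hu0)
    rw [← ValuationSubring.valuation_le_one_iff, map_div₀, div_le_one₀ hpos]
    exact val_le_of_mem_localizeAt hτ hu1 hc hc'

end CurvePlace

namespace QuadraticModel

variable {K : Type*} [Field K] [Algebra ℂ K] {s w : K} {f : ℂ[X]}

theorem IsUniformizerAt.branchMultiplicity_one {t c : ℂ} {π : K} {V : CurvePlace K}
    (h : IsUniformizerAt s w t c π) (hV : V.LiesOver s w t c) {O : Subalgebra ℂ K} (hπ : π ∈ O) :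
    V.BranchMultiplicity O 1 :=
  CurvePlace.branchMultiplicity_of (h.mem hV) (h.maximalIdeal_eq hV) hπ (h.val_lt_one hV)
    (by simp) fun y _ hy => by simpa using h.val_le_of_lt_one hV hy

/-- The functions `a(s) + b(s) w`, regular at `s = t`, for which `b` vanishes to order `n` at `t`. -/
def oddSubalgebra (M : QuadraticModel K s w f) (t : ℂ) (n : ℕ) : Subalgebra ℂ K where
  carrier := {x | ∃ p q r : ℂ[X], r.eval t ≠ 0 ∧
    x = (aeval s p + aeval s ((X - C t) ^ n * q) * w) / aeval s r}
  mul_mem' := by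
    rintro _ _ ⟨p, q, r, hr, rfl⟩ ⟨p', q', r', hr', rfl⟩
    refine ⟨p * p' + (X - C t) ^ (2 * n) * q * q' * f, p * q' + q * p', r * r',
      by simp [hr, hr'], ?_⟩
    rw [div_mul_div_comm]
    simp only [map_add, map_mul, ← M.sq, map_pow]
    congr 1
    ring
  add_mem' := by
    rintro _ _ ⟨p, q, r, hr, rfl⟩ ⟨p', q', r', hr', rfl⟩
    refine ⟨p * r' + r * p', q * r' + r * q', r * r', by simp [hr, hr'], ?_⟩
    rw [div_add_div _ _ (M.ne_zero_of_eval hr) (M.ne_zero_of_eval hr')]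
    simp only [map_add, map_mul, map_pow]
    congr 1
    ring
  algebraMap_mem' c := ⟨C c, 0, 1, by simp, by simp⟩

theorem mem_oddSubalgebra {M : QuadraticModel K s w f} {t : ℂ} {n : ℕ} {x : K} :
    x ∈ M.oddSubalgebra t n ↔ ∃ p q r : ℂ[X], r.eval t ≠ 0 ∧
      x = (aeval s p + aeval s ((X - C t) ^ n * q) * w) / aeval s r := Iff.rfl

variable (M : QuadraticModel K s w f) {t : ℂ} {V : CurvePlace K}

theorem aeval_mem_oddSubalgebra (n : ℕ) (p : ℂ[X]) : aeval s p ∈ M.oddSubalgebra t n :=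
  ⟨p, 0, 1, by simp, by simp⟩

theorem hasValue_of_oddSubalgebra (hV : V.LiesOver s w t 0) (n : ℕ) {p q r : ℂ[X]}
    (hr : r.eval t ≠ 0) :
    V.HasValue ((aeval s p + aeval s ((X - C t) ^ n * q) * w) / aeval s r)
      (p.eval t / r.eval t) := by
  have := (hV.el p ((X - C t) ^ n * q)).div (hV.1.aeval r) hr
  simpa using this

/-- Inverses are conjugates divided by norms. As `f(t) = 0`, the norm of a numerator takes the value
`p(t)²` at `t`, which is nonzero for a unit. -/
theorem dominates_oddSubalgebra (hV : V.LiesOver s w t 0) (h0 : f.eval t = 0) (n : ℕ) :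
    V.Dominates (M.oddSubalgebra t n) := by
  refine ⟨?_, ?_⟩
  · rintro _ ⟨p, q, r, hr, rfl⟩
    exact (hasValue_of_oddSubalgebra hV n hr).mem
  · rintro _ ⟨p, q, r, hr, rfl⟩ h
    have hp : p.eval t ≠ 0 := by
      intro hp
      have h1 := (hasValue_of_oddSubalgebra hV n (p := p) (q := q) hr).val_lt_one_iff.2
        (by simp [hp])
      exact h1.ne h
    have hN : (p ^ 2 - ((X - C t) ^ n * q) ^ 2 * f).eval t ≠ 0 := by simp [h0, hp]
    have hN0 := M.ne_zero_of_eval hN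
    refine ⟨r * p, -(r * q), _, hN, ?_⟩
    rw [← M.norm_eq] at hN0 ⊢
    rw [inv_div, div_eq_div_iff (left_ne_zero_of_mul hN0) hN0]
    simp only [map_mul, map_neg]
    ring

/-- Vanishing at `V` means `p(t) = 0`, and then `s - t` divides both the even and the odd part; the
odd part loses one of its `n + 1` factors. -/
theorem le_of_val_lt_one (hV : V.LiesOver s w t 0) {n : ℕ} {x : K}
    (hx : x ∈ M.oddSubalgebra t (n + 1)) (hx1 : V.ring.valuation x < 1) :
    ∃ y ∈ M.oddSubalgebra t n, x = (s - algebraMap ℂ K t) * y := by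
  obtain ⟨p, q, r, hr, rfl⟩ := hx
  rw [(hasValue_of_oddSubalgebra hV (n + 1) hr).val_lt_one_iff, div_eq_zero_iff,
    or_iff_left hr] at hx1
  obtain ⟨p, rfl⟩ := dvd_iff_isRoot.2 hx1
  refine ⟨_, ⟨p, q, r, hr, rfl⟩, ?_⟩
  have : s - algebraMap ℂ K t = aeval s (X - C t) := by simp
  rw [this]
  simp only [map_mul, map_pow]
  ring

theorem sub_mem_oddSubalgebra (n : ℕ) : s - algebraMap ℂ K t ∈ M.oddSubalgebra t n := by
  have : s - algebraMap ℂ K t = aeval s (X - C t) := by simp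
  rw [this]
  exact M.aeval_mem_oddSubalgebra n _

theorem branchMultiplicity_oddSubalgebra (h0 : f.eval t = 0) (h1 : f.derivative.eval t ≠ 0)
    (hV : V.LiesOver s w t 0) (n : ℕ) :
    V.BranchMultiplicity (M.oddSubalgebra t (n + 1)) 2 := by
  have hπ := M.isUniformizerAt_of_root h0 h1
  refine CurvePlace.branchMultiplicity_of (hπ.mem hV) (hπ.maximalIdeal_eq hV)
    (M.sub_mem_oddSubalgebra _) hV.1 (M.val_sub_eq_sq h0 h1 hV.1) fun y hy hy1 => ?_
  obtain ⟨z, hz, rfl⟩ := M.le_of_val_lt_one hV hy hy1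
  rw [map_mul, M.val_sub_eq_sq h0 h1 hV.1]
  exact mul_le_of_le_one_right' ((M.dominates_oddSubalgebra hV h0 n).val_le hz)

theorem oddSubalgebra_succ_le (n : ℕ) : M.oddSubalgebra t (n + 1) ≤ M.oddSubalgebra t n := by
  rintro _ ⟨p, q, r, hr, rfl⟩
  exact ⟨p, (X - C t) * q, r, hr, by rw [← mul_assoc, ← pow_succ]⟩

/-- The blow-up of a cusp `v² = (s-t)^(2n+3) · unit`, with `v = (s-t)^(n+1) w`: the function `s - t`
has least order, and the new coordinate is `v / (s-t) = (s-t)^n w`. -/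
theorem blowUp_oddSubalgebra (h0 : f.eval t = 0) (hV : V.LiesOver s w t 0) (n : ℕ) :
    V.blowUp (M.oddSubalgebra t (n + 1)) = M.oddSubalgebra t n := by
  have hs := M.sub_ne_zero t
  have hpos : 0 < V.ring.valuation (s - algebraMap ℂ K t) := zero_lt_iff.2 (by simpa using hs)
  have hdom := M.dominates_oddSubalgebra hV h0 n
  have hτ : ∀ c ∈ M.oddSubalgebra t (n + 1), V.ring.valuation c < 1 →
      c / (s - algebraMap ℂ K t) ∈ M.oddSubalgebra t n := by
    intro c hc hc1
    obtain ⟨z, hz, rfl⟩ := M.le_of_val_lt_one hV hc hc1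
    rwa [mul_div_cancel_left₀ _ hs]
  apply le_antisymm
  · apply hdom.localizeAt_le
    rw [Algebra.adjoin_le_iff]
    rintro x (hx | ⟨a, ha, b, hb, ha1, hb1, hb0, hmin, rfl⟩)
    · exact M.oddSubalgebra_succ_le n hx
    · rw [ValuationSubring.mem_nonunits_iff] at ha1 hb1
      -- Minimality of `b` against `s - t` makes `b / (s - t)` a unit, so `a / b` is a quotient
      -- taken inside `oddSubalgebra t n`.
      have h2 := hmin _ (M.sub_mem_oddSubalgebra _)
        (by rw [ValuationSubring.mem_nonunits_iff]; exact hV.1)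
      rw [← ValuationSubring.valuation_le_one_iff, map_div₀,
        div_le_one₀ (zero_lt_iff.2 (by simpa using hb0))] at h2
      have h3 : a / b = (a / (s - algebraMap ℂ K t)) / (b / (s - algebraMap ℂ K t)) := by
        field_simp
      rw [h3]
      refine hdom.div_mem (hτ a ha ha1) (hτ b hb hb1) ?_
      rwa [map_div₀, one_le_div₀ hpos]
  · rintro _ ⟨p, q, r, hr, rfl⟩
    apply V.le_localizeAt
    have hr0 := M.ne_zero_of_eval hr
    have h2 : (aeval s p + aeval s ((X - C t) ^ n * q) * w) / aeval s r = aeval s p / aeval s r +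
        (aeval s ((X - C t) ^ (n + 1) * q) * w / aeval s r) / (s - algebraMap ℂ K t) := by
      have : s - algebraMap ℂ K t = aeval s (X - C t) := by simp
      rw [this] at hs ⊢
      simp only [map_mul, map_pow]
      generalize aeval s (X - C t) = y at *
      field_simp
      ring
    rw [h2]
    have h3 : aeval s ((X - C t) ^ (n + 1) * q) * w / aeval s r ∈ M.oddSubalgebra t (n + 1) :=
      ⟨0, q, r, hr, by simp⟩
    have h4 : V.ring.valuation (aeval s ((X - C t) ^ (n + 1) * q) * w / aeval s r) < 1 := by
      have := (hasValue_of_oddSubalgebra hV (n + 1) (p := 0) (q := q) hr).val_lt_one_iff.2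
        (by simp)
      simpa using this
    refine add_mem (Algebra.subset_adjoin (Or.inl ⟨p, 0, r, hr, by simp⟩))
      (Algebra.subset_adjoin (Or.inr ⟨_, h3, _, M.sub_mem_oddSubalgebra _, ?_, ?_, hs, ?_, rfl⟩))
    · rwa [ValuationSubring.mem_nonunits_iff]
    · rw [ValuationSubring.mem_nonunits_iff]; exact hV.1
    · intro c hc hc1
      rw [ValuationSubring.mem_nonunits_iff] at hc1
      exact hdom.le (hτ c hc hc1)

/-- A subalgebra that contains `s` and a function whose odd part has order exactly `n`, and is
closed under division by functions without zero at `V`. -/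
theorem oddSubalgebra_le {O : Subalgebra ℂ K} (hV : V.LiesOver s w t 0)
    (hO : ∀ x ∈ O, ∀ y ∈ O, 1 ≤ V.ring.valuation y → x / y ∈ O) (hs : s ∈ O) {n : ℕ}
    {p q r : ℂ[X]} (hq : q.eval t ≠ 0) (hr : r.eval t ≠ 0)
    (hx : (aeval s p + aeval s ((X - C t) ^ n * q) * w) / aeval s r ∈ O) :
    M.oddSubalgebra t n ≤ O := by
  have hpol : ∀ p : ℂ[X], aeval s p ∈ O := fun p =>
    Algebra.adjoin_le (Set.singleton_subset_iff.2 hs) (aeval_mem_adjoin_singleton ℂ s)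
  have hdiv : ∀ (x : K) (r : ℂ[X]), x ∈ O → r.eval t ≠ 0 → x / aeval s r ∈ O := fun x r hx hr =>
    hO x hx _ (hpol r) ((hV.1.aeval r).val_eq_one hr).ge
  have h1 : aeval s ((X - C t) ^ n) * w ∈ O := by
    have h2 := hdiv _ q (sub_mem (mul_mem hx (hpol r)) (hpol p)) hq
    rw [div_mul_cancel₀ _ (M.ne_zero_of_eval hr), add_sub_cancel_left, map_mul] at h2
    have hq0 := M.ne_zero_of_eval hq
    convert h2 using 1
    field_simp
  rintro _ ⟨p', q', r', hr', rfl⟩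
  refine hdiv _ r' (add_mem (hpol p') ?_) hr'
  rw [map_mul, mul_right_comm]
  exact mul_mem h1 (hpol q')

/-- Multiplicities of the successive blow-ups of `oddSubalgebra t n`. -/
theorem branchMultiplicity_of_oddSubalgebra (h0 : f.eval t = 0) (h1 : f.derivative.eval t ≠ 0)
    (hV : V.LiesOver s w t 0) {O : ℕ → Subalgebra ℂ K} (hO : ∀ i, O (i + 1) = V.blowUp (O i))
    {m n : ℕ} (hm : O m = M.oddSubalgebra t n) (i : ℕ) :
    V.BranchMultiplicity (O (m + i)) (if i < n then 2 else 1) := by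
  have h2 : ∀ i ≤ n, O (m + i) = M.oddSubalgebra t (n - i) := by
    intro i
    induction i with
    | zero => intro _; simpa using hm
    | succ i ih =>
      intro hi
      rw [← add_assoc, hO, ih (by omega)]
      obtain ⟨e, he⟩ : ∃ e, n - i = e + 1 := ⟨n - i - 1, by omega⟩
      rw [he, blowUp_oddSubalgebra M h0 hV]
      congr 1
      omega
  split_ifs with hi
  · rw [h2 i hi.le]
    obtain ⟨e, he⟩ : ∃ e, n - i = e + 1 := ⟨n - i - 1, by omega⟩
    rw [he]
    exact M.branchMultiplicity_oddSubalgebra h0 h1 hV e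
  · refine (M.isUniformizerAt_of_root h0 h1).branchMultiplicity_one hV ?_
    -- After `n` blow-ups the ring contains the uniformizer `w`. Later rings only grow, so all
    -- further multiplicities are `1`.
    have h3 : ∀ j, w ∈ O (m + n + j) := by
      intro j
      induction j with
      | zero => rw [add_zero, h2 n le_rfl, Nat.sub_self]; exact ⟨0, 1, 1, by simp, by simp⟩
      | succ j ih => rw [← add_assoc, hO]; exact V.le_blowUp _ ih
    obtain ⟨j, rfl⟩ := Nat.exists_eq_add_of_le (not_lt.1 hi)
    rw [← add_assoc]
    exact h3 j

/-- The first blow-up of the local ring with coordinates `u`, `u (s - t)` at a ramified place. -/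
theorem blowUp_localizeAt_eq (h0 : f.eval t = 0) (hV : V.LiesOver s w t 0) {n : ℕ} {p q r : ℂ[X]}
    (hq : q.eval t ≠ 0) (hr : r.eval t ≠ 0) {u : K}
    (hu : u = (aeval s p + aeval s ((X - C t) ^ n * q) * w) / aeval s r) (hu0 : u ≠ 0)
    (hu1 : V.ring.valuation u < 1) :
    V.blowUp (V.localizeAt (Algebra.adjoin ℂ {u, u * (s - algebraMap ℂ K t)})) =
      M.oddSubalgebra t n := by
  have hdom := M.dominates_oddSubalgebra hV h0 n
  have huA : u ∈ M.oddSubalgebra t n := ⟨p, q, r, hr, hu⟩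
  have hτA := M.sub_mem_oddSubalgebra (t := t) n
  have hτ : s - algebraMap ℂ K t ∈ V.ring := hdom.le hτA
  have hle : V.localizeAt (Algebra.adjoin ℂ {u, u * (s - algebraMap ℂ K t)}) ≤
      M.oddSubalgebra t n := by
    apply hdom.localizeAt_le
    rw [Algebra.adjoin_le_iff]
    rintro x (rfl | rfl)
    · exact huA
    · exact mul_mem huA hτA
  have huO : u ∈ V.localizeAt (Algebra.adjoin ℂ {u, u * (s - algebraMap ℂ K t)}) :=
    V.le_localizeAt _ (Algebra.subset_adjoin (by simp))
  have hpos : 0 < V.ring.valuation u := zero_lt_iff.2 (by simpa using hu0)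
  apply le_antisymm
  · apply hdom.localizeAt_le
    rw [Algebra.adjoin_le_iff]
    rintro x (hx | ⟨a, ha, b, hb, ha1, hb1, hb0, hmin, rfl⟩)
    · exact hle hx
    · rw [ValuationSubring.mem_nonunits_iff] at ha1 hb1
      have h2 := hmin u huO (by rwa [ValuationSubring.mem_nonunits_iff])
      rw [← ValuationSubring.valuation_le_one_iff, map_div₀,
        div_le_one₀ (zero_lt_iff.2 (by simpa using hb0))] at h2
      -- Numerator and denominator are both divisible by `u`, and minimality of the denominator
      -- against `u` makes its cofactor a unit.
      obtain ⟨a', ha', rfl⟩ := hdom.exists_eq_mul huA hτA hu1 ha ha1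
      obtain ⟨b', hb', rfl⟩ := hdom.exists_eq_mul huA hτA hu1 hb hb1
      rw [mul_div_mul_left _ _ hu0]
      refine hdom.div_mem ha' hb' ?_
      rw [map_mul] at h2
      exact (le_mul_iff_one_le_right hpos).1 h2
  · refine M.oddSubalgebra_le (p := p) hV (fun _ hx _ hy => CurvePlace.div_mem_localizeAt hx hy) ?_
      hq hr ?_
    · have := add_mem (CurvePlace.mem_blowUp_localizeAt hτ hu0 hu1) (Subalgebra.algebraMap_mem
        (V.blowUp (V.localizeAt (Algebra.adjoin ℂ {u, u * (s - algebraMap ℂ K t)}))) t)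
      rwa [sub_add_cancel] at this
    · rw [← hu]
      exact V.le_blowUp _ huO

end QuadraticModel

end Multiplicities


/-! ### Affine charts of plane curves with a point of multiplicity `d - 2` -/

section Charts

open MvPolynomial

/-- The linear change of variables given by the matrix `A`. -/
noncomputable def linSubst (A : Matrix (Fin 3) (Fin 3) ℂ) :
    MvPolynomial (Fin 3) ℂ →ₐ[ℂ] MvPolynomial (Fin 3) ℂ :=
  bind₁ fun i => ∑ j, C (A i j) * X j

theorem aeval_linSubst {R : Type*} [CommRing R] [Algebra ℂ R] (A : Matrix (Fin 3) (Fin 3) ℂ)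
    (θ : Fin 3 → R) (P : MvPolynomial (Fin 3) ℂ) :
    aeval θ (linSubst A P) = aeval (fun i => ∑ j, algebraMap ℂ R (A i j) * θ j) P := by
  rw [linSubst, aeval_bind₁]
  simp

theorem linSubst_linSubst (A B : Matrix (Fin 3) (Fin 3) ℂ) (P : MvPolynomial (Fin 3) ℂ) :
    linSubst A (linSubst B P) = linSubst (B * A) P := by
  have h := aeval_linSubst B (fun i => ∑ j, C (A i j) * X j : Fin 3 → MvPolynomial (Fin 3) ℂ) P
  have h2 : (fun i => ∑ j, algebraMap ℂ (MvPolynomial (Fin 3) ℂ) (B i j) *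
      ∑ k, C (A j k) * X k) = fun i => ∑ j, C ((B * A) i j) * X j := by
    funext i
    simp only [Finset.mul_sum, Matrix.mul_apply, map_sum, Finset.sum_mul, map_mul, algebraMap_eq]
    rw [Finset.sum_comm]
    simp only [mul_assoc]
  rw [h2] at h
  exact h

theorem linSubst_one (P : MvPolynomial (Fin 3) ℂ) : linSubst 1 P = P := by
  change aeval _ P = P
  have : (fun i : Fin 3 => ∑ j, C ((1 : Matrix (Fin 3) (Fin 3) ℂ) i j) * X j) =
      (X : Fin 3 → MvPolynomial (Fin 3) ℂ) := by
    funext i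
    simp [Matrix.one_apply]
  rw [this, aeval_X_left]
  rfl

/-- The binary form of degree `N` in `x, y` with dehomogenization `p(x)`. -/
noncomputable def binaryForm (N : ℕ) (p : Polynomial ℂ) : MvPolynomial (Fin 3) ℂ :=
  rename Fin.castSucc (p.homogenize N)

/-- The form `a z² + 2 b z + c` of degree `k + 2`, where `a, b, c` are binary forms in `x, y`. -/
noncomputable def quadForm (k : ℕ) (a b c : Polynomial ℂ) : MvPolynomial (Fin 3) ℂ :=
  binaryForm k a * X 2 ^ 2 + 2 * binaryForm (k + 1) b * X 2 + binaryForm (k + 2) c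

theorem aeval_binaryForm_of_eq_one {R : Type*} [CommRing R] [Algebra ℂ R] {θ : Fin 3 → R}
    (h : θ 1 = 1) {N : ℕ} {p : Polynomial ℂ} (hp : p.natDegree ≤ N) :
    aeval θ (binaryForm N p) = Polynomial.aeval (θ 0) p := by
  rw [binaryForm, aeval_rename, Polynomial.aeval_homogenize_of_eq_one hp]
  · rfl
  · exact h

theorem aeval_quadForm_of_eq_one {R : Type*} [CommRing R] [Algebra ℂ R] {θ : Fin 3 → R}
    (h : θ 1 = 1) {k : ℕ} {a b c : Polynomial ℂ} (ha : a.natDegree ≤ k) (hb : b.natDegree ≤ k + 1)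
    (hc : c.natDegree ≤ k + 2) :
    aeval θ (quadForm k a b c) = Polynomial.aeval (θ 0) a * θ 2 ^ 2 +
      2 * Polynomial.aeval (θ 0) b * θ 2 + Polynomial.aeval (θ 0) c := by
  simp only [quadForm, map_add, map_mul, map_pow, aeval_X, map_ofNat,
    aeval_binaryForm_of_eq_one h ha, aeval_binaryForm_of_eq_one h hb,
    aeval_binaryForm_of_eq_one h hc]

theorem isHomogeneous_binaryForm (N : ℕ) (p : Polynomial ℂ) : (binaryForm N p).IsHomogeneous N :=
  (Polynomial.isHomogeneous_homogenize p).rename_isHomogeneous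

theorem isHomogeneous_quadForm (k : ℕ) (a b c : Polynomial ℂ) :
    (quadForm k a b c).IsHomogeneous (k + 2) := by
  have h2 : (2 : MvPolynomial (Fin 3) ℂ).IsHomogeneous 0 := by
    have := isHomogeneous_C (Fin 3) (2 : ℂ)
    rwa [map_ofNat] at this
  refine IsHomogeneous.add (IsHomogeneous.add ?_ ?_) (isHomogeneous_binaryForm _ _)
  · exact (isHomogeneous_binaryForm k a).mul (isHomogeneous_X_pow _ _)
  · have := (h2.mul (isHomogeneous_binaryForm (k + 1) b)).mul (isHomogeneous_X ℂ (2 : Fin 3))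
    convert this using 1
    ring

/-- Dehomogenization with respect to `y`, as a polynomial in `z` over `ℂ[x]`. -/
noncomputable def affinePart : MvPolynomial (Fin 3) ℂ →ₐ[ℂ] Polynomial (Polynomial ℂ) :=
  aeval ![Polynomial.C Polynomial.X, 1, Polynomial.X]

theorem aeval_C_X (p : Polynomial ℂ) :
    Polynomial.aeval (Polynomial.C Polynomial.X : Polynomial (Polynomial ℂ)) p = Polynomial.C p := by
  have := Polynomial.aeval_algHom_apply (Polynomial.CAlgHom (R := ℂ) (A := Polynomial ℂ))
    Polynomial.X p
  simpa using this

theorem affinePart_quadForm {k : ℕ} {a b c : Polynomial ℂ} (ha : a.natDegree ≤ k)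
    (hb : b.natDegree ≤ k + 1) (hc : c.natDegree ≤ k + 2) :
    affinePart (quadForm k a b c) = Polynomial.C a * Polynomial.X ^ 2 +
      Polynomial.C (2 * b) * Polynomial.X + Polynomial.C c := by
  rw [affinePart, aeval_quadForm_of_eq_one (by simp) ha hb hc]
  simp only [Matrix.cons_val, aeval_C_X, map_mul, map_ofNat]

theorem natDegree_affinePart_quadForm {k : ℕ} {a b c : Polynomial ℂ} (ha : a.natDegree ≤ k)
    (hb : b.natDegree ≤ k + 1) (hc : c.natDegree ≤ k + 2) (ha0 : a ≠ 0) :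
    (affinePart (quadForm k a b c)).natDegree = 2 := by
  rw [affinePart_quadForm ha hb hc]
  exact Polynomial.natDegree_quadratic ha0

/-- In the chart `y = 1` a polynomial of degree at most one in `z` cannot be a nonzero multiple of
one of degree two. This yields the independence of `1` and `z` over the polynomials in `x` on the
curve. -/
theorem eq_zero_of_quadForm_dvd {k : ℕ} {a b c : Polynomial ℂ} (ha : a.natDegree ≤ k)
    (hb : b.natDegree ≤ k + 1) (hc : c.natDegree ≤ k + 2) (ha0 : a ≠ 0) {N : ℕ}
    {p q : Polynomial ℂ} (hp : p.natDegree ≤ N) (hq : q.natDegree ≤ N)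
    (h : quadForm k a b c ∣ binaryForm N p * X 1 + binaryForm N q * X 2) : p = 0 ∧ q = 0 := by
  have h1 := map_dvd affinePart h
  have h2 : affinePart (binaryForm N p * X 1 + binaryForm N q * X 2) =
      Polynomial.C q * Polynomial.X + Polynomial.C p := by
    have h3 : (![Polynomial.C Polynomial.X, 1, Polynomial.X] :
        Fin 3 → Polynomial (Polynomial ℂ)) 1 = 1 := rfl
    simp only [affinePart, map_add, map_mul, aeval_binaryForm_of_eq_one h3 hp,
      aeval_binaryForm_of_eq_one h3 hq, aeval_X]
    simp only [Matrix.cons_val, aeval_C_X]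
    ring
  rw [h2] at h1
  have h3 := Polynomial.eq_zero_of_dvd_of_natDegree_lt h1 (by
    rw [natDegree_affinePart_quadForm ha hb hc ha0]
    exact Polynomial.natDegree_linear_le.trans_lt one_lt_two)
  have h4 := congrArg (fun r => Polynomial.coeff r 0) h3
  have h5 := congrArg (fun r => Polynomial.coeff r 1) h3
  simp at h4 h5
  exact ⟨h4, h5⟩

end Charts


/-! ### Function field, centers and local rings of a curve in an affine chart. -/

section ChartOfCurve

open MvPolynomial

theorem aeval_mul_of_isHomogeneous {R : Type*} [CommRing R] [Algebra ℂ R]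
    {P : MvPolynomial (Fin 3) ℂ} {n : ℕ} (hP : P.IsHomogeneous n) (r : R) (θ : Fin 3 → R) :
    aeval (fun i => r * θ i) P = r ^ n * aeval θ P := by
  simp only [aeval_def, eval₂_eq', Finset.mul_sum]
  refine Finset.sum_congr rfl fun m hm => ?_
  have hdeg := hP (mem_support_iff.1 hm)
  simp only [Finsupp.weight_apply, Pi.one_apply, smul_eq_mul, mul_one] at hdeg
  rw [Finsupp.sum_fintype _ _ fun _ => rfl] at hdeg
  simp only [mul_pow, Finset.prod_mul_distrib, Finset.prod_pow_eq_pow_sum]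
  rw [hdeg]
  ring

namespace PlaneCurve

variable {d : ℕ} (C : PlaneCurve d)

/-- The functions `θ` on the curve `C` are the coordinates `x / y, 1, z / y` of an affine chart,
after the linear change of coordinates given by the matrix `A`. -/
structure IsChart (A : Matrix (Fin 3) (Fin 3) ℂ) (θ : Fin 3 → C.functionField) : Prop where
  one : θ 1 = 1
  ratio : ∀ i j, C.ratio i j =
    (∑ l, algebraMap ℂ C.functionField (A i l) * θ l) /
      ∑ l, algebraMap ℂ C.functionField (A j l) * θ l
  indep : ∀ p q : Polynomial ℂ,
    Polynomial.aeval (θ 0) p + Polynomial.aeval (θ 0) q * θ 2 = 0 → p = 0 ∧ q = 0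

theorem aeval_coord (P : MvPolynomial (Fin 3) ℂ) :
    aeval C.coord P = algebraMap C.CoordRing C.ConeField (Ideal.Quotient.mk _ P) := by
  have : aeval C.coord = (IsScalarTower.toAlgHom ℂ C.CoordRing C.ConeField).comp
      (Ideal.Quotient.mkₐ ℂ (Ideal.span {C.poly})) := by
    refine algHom_ext fun i => ?_
    simp [coord]
  rw [this]
  rfl

theorem aeval_coord_eq_zero {P : MvPolynomial (Fin 3) ℂ} : aeval C.coord P = 0 ↔ C.poly ∣ P := by
  rw [aeval_coord, map_eq_zero_iff _ (IsFractionRing.injective _ _), Ideal.Quotient.eq_zero_iff_mem,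
    Ideal.mem_span_singleton]

theorem coord_div_mem (i j : Fin 3) : C.coord i / C.coord j ∈ C.functionField :=
  (C.ratio i j).2

/-- The new homogeneous coordinates `η` satisfy no relations but the multiples of the form, which
has degree two in `z`; hence `η 1 ≠ 0` and `1, z` are independent over polynomials in `x`. -/
theorem exists_chart {A B : Matrix (Fin 3) (Fin 3) ℂ} (hBA : B * A = 1) {u : ℂ} (hu : u ≠ 0)
    {k : ℕ} {a b c : Polynomial ℂ} (ha : a.natDegree ≤ k) (hb : b.natDegree ≤ k + 1)
    (hc : c.natDegree ≤ k + 2) (ha0 : a ≠ 0)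
    (hE : linSubst A C.poly = MvPolynomial.C u * quadForm k a b c) :
    ∃ θ : Fin 3 → C.functionField, C.IsChart A θ ∧ aeval θ (quadForm k a b c) = 0 := by
  have hAB : A * B = 1 := mul_eq_one_comm.1 hBA
  set ξ := C.coord with hξ
  let η : Fin 3 → C.ConeField := fun i => ∑ j, algebraMap ℂ C.ConeField (B i j) * ξ j
  have hηξ : ∀ i, ξ i = ∑ j, algebraMap ℂ C.ConeField (A i j) * η j := by
    intro i
    simp only [η, Finset.mul_sum]
    rw [Finset.sum_comm]
    have : ∀ l, ∑ j, algebraMap ℂ C.ConeField (A i j) * (algebraMap ℂ C.ConeField (B j l) * ξ l) =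
        algebraMap ℂ C.ConeField ((A * B) i l) * ξ l := by
      intro l
      rw [Matrix.mul_apply, map_sum, Finset.sum_mul]
      simp only [map_mul, mul_assoc]
    simp only [this, hAB, Matrix.one_apply]
    simp [apply_ite (algebraMap ℂ C.ConeField)]
  have hdvd : ∀ P, aeval η P = 0 → quadForm k a b c ∣ P := by
    intro P hP
    have h1 : aeval ξ (linSubst B P) = 0 := by rw [aeval_linSubst]; exact hP
    have h2 := map_dvd (linSubst A) (C.aeval_coord_eq_zero.1 h1)
    rw [linSubst_linSubst, hBA, linSubst_one, hE] at h2
    exact (dvd_mul_left _ _).trans h2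
  have hE0 : aeval η (quadForm k a b c) = 0 := by
    have h1 : aeval η (linSubst A C.poly) = 0 := by
      rw [aeval_linSubst]
      have : (fun i => ∑ j, algebraMap ℂ C.ConeField (A i j) * η j) = ξ := funext fun i => (hηξ i).symm
      rw [this]
      exact C.aeval_coord_eq_zero.2 dvd_rfl
    rw [hE, map_mul, mul_eq_zero] at h1
    exact h1.resolve_left (by simpa using hu)
  have hη1 : η 1 ≠ 0 := by
    intro h1
    have h2 := map_dvd affinePart (hdvd (X 1) (by simpa using h1))
    have h3 : affinePart (X 1) = 1 := by simp [affinePart]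
    rw [h3] at h2
    have h4 := Polynomial.natDegree_le_of_dvd h2 one_ne_zero
    rw [natDegree_affinePart_quadForm ha hb hc ha0] at h4
    simp at h4
  -- Only ratios of the original coordinates generate the function field, so `η i / η 1` is reached
  -- through the auxiliary denominator `ξ j₀`.
  obtain ⟨j₀, hj₀⟩ : ∃ j, ξ j ≠ 0 := by
    by_contra hcon
    push Not at hcon
    exact hη1 (by simp [η, hcon])
  have hmem : ∀ i, η i / ξ j₀ ∈ C.functionField := by
    intro i
    have : η i / ξ j₀ = ∑ j, algebraMap ℂ C.ConeField (B i j) * (ξ j / ξ j₀) := by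
      simp only [η, Finset.sum_div, mul_div_assoc]
    rw [this]
    exact sum_mem fun j _ => mul_mem (IntermediateField.algebraMap_mem _ _) (C.coord_div_mem j j₀)
  have hmem' : ∀ i, η i / η 1 ∈ C.functionField := fun i => by
    have := div_mem (hmem i) (hmem 1)
    rwa [div_div_div_cancel_right₀ hj₀] at this
  let θ : Fin 3 → C.functionField := fun i => ⟨η i / η 1, hmem' i⟩
  have hθ : ∀ P : MvPolynomial (Fin 3) ℂ, ∀ n, P.IsHomogeneous n →
      aeval η P = η 1 ^ n * (aeval θ P : C.functionField) := by
    intro P n hP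
    have h1 : ((aeval θ P : C.functionField) : C.ConeField) = aeval (fun i => (η i / η 1)) P := by
      have := aeval_algebraMap_apply (A := C.functionField) C.ConeField θ P
      exact this.symm
    rw [h1, ← aeval_mul_of_isHomogeneous hP]
    congr 2
    funext i
    field_simp
  refine ⟨θ, ⟨Subtype.ext (div_self hη1), fun i j => Subtype.ext ?_, fun p q hpq => ?_⟩, ?_⟩
  · have h1 : ∀ i, ((∑ l, algebraMap ℂ C.functionField (A i l) * θ l : C.functionField) :
        C.ConeField) = ξ i / η 1 := by
      intro i
      rw [hηξ i, Finset.sum_div]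
      push_cast
      refine Finset.sum_congr rfl fun l _ => ?_
      simp only [θ, mul_div_assoc]
    rw [IntermediateField.coe_div, h1, h1, div_div_div_cancel_right₀ hη1]
    rfl
  · obtain ⟨N, hp, hq⟩ : ∃ N, p.natDegree ≤ N ∧ q.natDegree ≤ N :=
      ⟨_, le_max_left _ _, le_max_right _ _⟩
    refine eq_zero_of_quadForm_dvd ha hb hc ha0 hp hq (hdvd _ ?_)
    have h1 : θ 1 = 1 := Subtype.ext (div_self hη1)
    rw [hθ _ (N + 1)]
    · rw [map_add, map_mul, map_mul, aeval_X, aeval_X, aeval_binaryForm_of_eq_one h1 hp,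
        aeval_binaryForm_of_eq_one h1 hq, h1, mul_one, hpq]
      simp
    · exact ((isHomogeneous_binaryForm N p).mul (isHomogeneous_X _ _)).add
        ((isHomogeneous_binaryForm N q).mul (isHomogeneous_X _ _))
  · have := hθ _ _ (isHomogeneous_quadForm k a b c)
    rw [hE0] at this
    have h2 := (mul_eq_zero.1 this.symm).resolve_left (pow_ne_zero _ hη1)
    exact Subtype.ext h2

variable {C}

namespace IsChart

variable {A B : Matrix (Fin 3) (Fin 3) ℂ} {θ : Fin 3 → C.functionField}

/-- The function on the chart given by a linear form. -/
theorem linear_eq_zero (h : C.IsChart A θ) {v : Fin 3 → ℂ}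
    (hv : ∑ l, algebraMap ℂ C.functionField (v l) * θ l = 0) : v = 0 := by
  rw [Fin.sum_univ_three, h.one, mul_one] at hv
  obtain ⟨h1, h2⟩ := h.indep (Polynomial.C (v 0) * Polynomial.X + Polynomial.C (v 1))
    (Polynomial.C (v 2)) (by simpa using hv)
  have h3 := congrArg (fun p => Polynomial.coeff p 0) h1
  have h4 := congrArg (fun p => Polynomial.coeff p 1) h1
  have h5 := congrArg (fun p => Polynomial.coeff p 0) h2
  simp [Polynomial.coeff_C] at h3 h4 h5
  funext i
  fin_cases i <;> simp [h3, h4, h5]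

theorem row_ne_zero (h : C.IsChart A θ) (hBA : B * A = 1) (i : Fin 3) :
    ∑ l, algebraMap ℂ C.functionField (A i l) * θ l ≠ 0 := by
  intro h0
  have h1 : (A * B) i i = 0 := by
    rw [Matrix.mul_apply]
    exact Finset.sum_eq_zero fun l _ => by rw [congrFun (h.linear_eq_zero h0) l]; simp
  rw [mul_eq_one_comm.1 hBA] at h1
  simp at h1

theorem theta_ne_zero (h : C.IsChart A θ) (k : Fin 3) : θ k ≠ 0 := by
  intro hk
  have := h.linear_eq_zero (v := Pi.single k 1) (by
    rw [Finset.sum_eq_single k] <;> simp +contextual [hk])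
  simpa using congrFun this k

theorem theta_eq (_ : C.IsChart A θ) (hBA : B * A = 1) (i : Fin 3) :
    θ i = ∑ j, algebraMap ℂ C.functionField (B i j) *
      ∑ l, algebraMap ℂ C.functionField (A j l) * θ l := by
  simp only [Finset.mul_sum]
  rw [Finset.sum_comm]
  have : ∀ l, ∑ j, algebraMap ℂ C.functionField (B i j) *
      (algebraMap ℂ C.functionField (A j l) * θ l) =
      algebraMap ℂ C.functionField ((B * A) i l) * θ l := by
    intro l
    rw [Matrix.mul_apply, map_sum, Finset.sum_mul]
    simp only [map_mul, mul_assoc]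
  simp only [this, hBA, Matrix.one_apply]
  simp [apply_ite (algebraMap ℂ C.functionField)]

theorem theta_div_eq (h : C.IsChart A θ) (hBA : B * A = 1) (i j₀ : Fin 3) :
    θ i / (∑ l, algebraMap ℂ C.functionField (A j₀ l) * θ l) =
      ∑ j, algebraMap ℂ C.functionField (B i j) * C.ratio j j₀ := by
  conv_lhs => rw [h.theta_eq hBA i]
  simp only [h.ratio, Finset.sum_div, mul_div_assoc]

theorem linear_div_eq (v : Fin 3 → ℂ) (k : Fin 3) :
    (∑ l, algebraMap ℂ C.functionField (v l) * θ l) / θ k =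
      ∑ l, algebraMap ℂ C.functionField (v l) * (θ l / θ k) := by
  simp only [Finset.sum_div, mul_div_assoc]

theorem hasValue_linear {V : CurvePlace C.functionField} {k : Fin 3} {q v : Fin 3 → ℂ}
    (hV : ∀ i, V.HasValue (θ i / θ k) (q i / q k)) :
    V.HasValue ((∑ l, algebraMap ℂ C.functionField (v l) * θ l) / θ k)
      ((∑ l, v l * q l) / q k) := by
  rw [linear_div_eq, Finset.sum_div]
  simp only [mul_div_assoc]
  exact CurvePlace.HasValue.sum fun l _ => (CurvePlace.hasValue_const (v l)).mul (hV l)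

/-- Centers are defined by ratios of the original coordinates. Both directions are linear
combinations followed by a division by a coordinate that is nonzero at the point. -/
theorem isCenteredAt_iff (h : C.IsChart A θ) (hBA : B * A = 1) {V : CurvePlace C.functionField}
    {p : ℙ ℂ (Fin 3 → ℂ)} {q : Fin 3 → ℂ} (hp : p.rep = A.mulVec q) {k : Fin 3} (hk : q k ≠ 0) :
    C.IsCenteredAt V p ↔ ∀ i, V.HasValue (θ i / θ k) (q i / q k) := by
  have hpi : ∀ i, p.rep i = ∑ l, A i l * q l := fun i => by rw [hp]; rfl
  have hq : ∀ i, q i = ∑ j, B i j * p.rep j := fun i => by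
    have h1 : B.mulVec (A.mulVec q) = q := by rw [Matrix.mulVec_mulVec, hBA, Matrix.one_mulVec]
    rw [hp]
    exact (congrFun h1 i).symm
  have hcen : C.IsCenteredAt V p ↔ ∀ i j, p.rep j ≠ 0 →
      V.HasValue (C.ratio i j) (p.rep i / p.rep j) := by
    simp only [IsCenteredAt, CurvePlace.HasValue, ValuationSubring.mem_nonunits_iff]
  rw [hcen]
  constructor
  · intro hV i
    obtain ⟨j₀, hj₀⟩ : ∃ j, p.rep j ≠ 0 := by
      by_contra hcon
      push Not at hcon
      exact p.rep_nonzero (funext hcon)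
    have key : ∀ i, V.HasValue (θ i / (∑ l, algebraMap ℂ C.functionField (A j₀ l) * θ l))
        (q i / p.rep j₀) := by
      intro i
      rw [h.theta_div_eq hBA, hq, Finset.sum_div]
      simp only [mul_div_assoc]
      exact CurvePlace.HasValue.sum fun j _ =>
        (CurvePlace.hasValue_const (B i j)).mul (hV j j₀ hj₀)
    have h1 := (key i).div (key k) (div_ne_zero hk hj₀)
    rwa [div_div_div_cancel_right₀ (h.row_ne_zero hBA j₀), div_div_div_cancel_right₀ hj₀] at h1
  · intro hV i j hj
    have key : ∀ i, V.HasValue ((∑ l, algebraMap ℂ C.functionField (A i l) * θ l) / θ k)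
        (p.rep i / q k) := fun i => by
      rw [hpi]
      exact hasValue_linear hV
    have h1 := (key i).div (key j) (div_ne_zero hj hk)
    rwa [div_div_div_cancel_right₀ (h.theta_ne_zero k), div_div_div_cancel_right₀ hk,
      ← h.ratio] at h1

theorem infinitelyNearRing_zero (h : C.IsChart A θ) (hBA : B * A = 1)
    {V : CurvePlace C.functionField} {p : ℙ ℂ (Fin 3 → ℂ)} {q : Fin 3 → ℂ}
    (hp : p.rep = A.mulVec q) {k : Fin 3} (hk : q k ≠ 0)
    (hV : ∀ i, V.HasValue (θ i / θ k) (q i / q k)) :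
    C.infinitelyNearRing p V 0 = V.localizeAt (Algebra.adjoin ℂ (Set.range fun i => θ i / θ k)) := by
  have hpi : ∀ i, p.rep i = ∑ l, A i l * q l := fun i => by rw [hp]; rfl
  have hval : ∀ i, V.HasValue ((∑ l, algebraMap ℂ C.functionField (A i l) * θ l) / θ k)
      (p.rep i / q k) := fun i => by
    rw [hpi]
    exact hasValue_linear hV
  have hlin : ∀ i, (∑ l, algebraMap ℂ C.functionField (A i l) * θ l) / θ k ∈
      V.localizeAt (Algebra.adjoin ℂ (Set.range fun i => θ i / θ k)) := fun i => by
    rw [linear_div_eq]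
    exact sum_mem fun l _ => mul_mem (Subalgebra.algebraMap_mem _ _)
      (V.le_localizeAt _ (Algebra.subset_adjoin ⟨l, rfl⟩))
  rw [infinitelyNearRing]
  apply le_antisymm
  · apply CurvePlace.localizeAt_le_localizeAt
    rw [Algebra.adjoin_le_iff]
    rintro _ ⟨i, j, hj, rfl⟩
    have h1 := CurvePlace.div_mem_localizeAt (hlin i) (hlin j)
      ((hval j).val_eq_one (div_ne_zero hj hk)).ge
    rwa [div_div_div_cancel_right₀ (h.theta_ne_zero k), ← h.ratio] at h1
  · apply CurvePlace.localizeAt_le_localizeAt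
    rw [Algebra.adjoin_le_iff]
    rintro _ ⟨i, rfl⟩
    obtain ⟨j₀, hj₀⟩ : ∃ j, p.rep j ≠ 0 := by
      by_contra hcon
      push Not at hcon
      exact p.rep_nonzero (funext hcon)
    have hmem : ∀ i, θ i / (∑ l, algebraMap ℂ C.functionField (A j₀ l) * θ l) ∈
        V.localizeAt (Algebra.adjoin ℂ {q | ∃ i j, p.rep j ≠ 0 ∧ q = C.ratio i j}) := by
      intro i
      rw [h.theta_div_eq hBA]
      exact sum_mem fun j _ => mul_mem (Subalgebra.algebraMap_mem _ _)
        (V.le_localizeAt _ (Algebra.subset_adjoin ⟨j, j₀, hj₀, rfl⟩))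
    have h1 := ((hval j₀).inv (div_ne_zero hj₀ hk))
    rw [inv_div, inv_div] at h1
    have h2 := CurvePlace.div_mem_localizeAt (hmem i) (hmem k)
      (h1.val_eq_one (div_ne_zero hk hj₀)).ge
    rwa [div_div_div_cancel_right₀ (h.row_ne_zero hBA j₀)] at h2

/-- Every function on the curve is of the form `(p + q z) / r` with polynomials `p, q, r` in `x`. -/
theorem exists_repr (h : C.IsChart A θ) {a b c : Polynomial ℂ} (ha0 : a ≠ 0)
    (heq : Polynomial.aeval (θ 0) a * θ 2 ^ 2 + 2 * Polynomial.aeval (θ 0) b * θ 2 +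
      Polynomial.aeval (θ 0) c = 0) (x : C.functionField) :
    ∃ p q r : Polynomial ℂ, r ≠ 0 ∧
      x = (Polynomial.aeval (θ 0) p + Polynomial.aeval (θ 0) q * θ 2) /
        Polynomial.aeval (θ 0) r := by
  have hne : ∀ r : Polynomial ℂ, r ≠ 0 → Polynomial.aeval (θ 0) r ≠ 0 := fun r hr h0 =>
    hr (h.indep r 0 (by simp [h0])).1
  have hlin : ∀ v : Fin 3 → ℂ, ∃ p q r : Polynomial ℂ, r ≠ 0 ∧
      (∑ l, algebraMap ℂ C.functionField (v l) * θ l) =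
        (Polynomial.aeval (θ 0) p + Polynomial.aeval (θ 0) q * θ 2) /
          Polynomial.aeval (θ 0) r := fun v =>
    ⟨Polynomial.C (v 0) * Polynomial.X + Polynomial.C (v 1), Polynomial.C (v 2), 1, one_ne_zero, by
      rw [Fin.sum_univ_three, h.one]; simp⟩
  let S : Set C.functionField := {x | ∃ p q r : Polynomial ℂ, r ≠ 0 ∧
      x = (Polynomial.aeval (θ 0) p + Polynomial.aeval (θ 0) q * θ 2) /
        Polynomial.aeval (θ 0) r}
  have hmul : ∀ x ∈ S, ∀ y ∈ S, x * y ∈ S := by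
    rintro _ ⟨p, q, r, hr, rfl⟩ _ ⟨p', q', r', hr', rfl⟩
    -- The square of `z` is replaced by `-(2 b z + c) / a`.
    refine ⟨a * p * p' - c * q * q', a * p * q' + a * q * p' - 2 * b * q * q', a * r * r',
      mul_ne_zero (mul_ne_zero ha0 hr) hr', ?_⟩
    have := hne a ha0
    have := hne r hr
    have := hne r' hr'
    simp only [map_add, map_sub, map_mul, map_ofNat]
    field_simp
    linear_combination Polynomial.aeval (θ 0) q * Polynomial.aeval (θ 0) q' * heq
  have hadd : ∀ x ∈ S, ∀ y ∈ S, x + y ∈ S := by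
    rintro _ ⟨p, q, r, hr, rfl⟩ _ ⟨p', q', r', hr', rfl⟩
    refine ⟨p * r' + r * p', q * r' + r * q', r * r', mul_ne_zero hr hr', ?_⟩
    rw [div_add_div _ _ (hne r hr) (hne r' hr')]
    simp only [map_add, map_mul]
    congr 1
    ring
  have hinv : ∀ x ∈ S, x⁻¹ ∈ S := by
    rintro _ ⟨p, q, r, hr, rfl⟩
    by_cases hpq : Polynomial.aeval (θ 0) p + Polynomial.aeval (θ 0) q * θ 2 = 0
    · exact ⟨0, 0, 1, one_ne_zero, by simp [hpq]⟩
    -- The second factor is `a` times the conjugate of `p + q z`, the other root of the equation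
    -- being `-2b/a - z`.
    have hmulN : (Polynomial.aeval (θ 0) p + Polynomial.aeval (θ 0) q * θ 2) *
        (Polynomial.aeval (θ 0) (a * p - 2 * q * b) + Polynomial.aeval (θ 0) (-(q * a)) * θ 2) =
        Polynomial.aeval (θ 0) (a * p ^ 2 - 2 * p * q * b + q ^ 2 * c) := by
      simp only [map_add, map_sub, map_mul, map_neg, map_pow, map_ofNat]
      linear_combination (-Polynomial.aeval (θ 0) q ^ 2) * heq
    have hN : Polynomial.aeval (θ 0) (a * p ^ 2 - 2 * p * q * b + q ^ 2 * c) ≠ 0 := by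
      rw [← hmulN]
      refine mul_ne_zero hpq fun h0 => hpq ?_
      obtain ⟨h1, h2⟩ := h.indep _ _ h0
      have hq : q = 0 := by simpa [ha0] using h2
      have hp : p = 0 := by simpa [hq, ha0] using h1
      simp [hp, hq]
    refine ⟨r * (a * p - 2 * q * b), r * (-(q * a)), a * p ^ 2 - 2 * p * q * b + q ^ 2 * c,
      fun h0 => hN (by rw [h0, map_zero]), ?_⟩
    rw [inv_div, div_eq_div_iff hpq hN, ← hmulN, map_mul, map_mul]
    ring
  have hratio : ∀ i j, C.ratio i j ∈ S := fun i j => by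
    rw [h.ratio, div_eq_mul_inv]
    exact hmul _ (hlin _) _ (hinv _ (hlin _))
  have hall : ∀ (y : C.ConeField) (hy : y ∈ C.functionField), (⟨y, hy⟩ : C.functionField) ∈ S := by
    intro y hy
    induction hy using IntermediateField.adjoin_induction with
    | mem y hy =>
      obtain ⟨i, j, rfl⟩ := hy
      exact hratio i j
    | algebraMap r =>
      exact ⟨Polynomial.C r, 0, 1, one_ne_zero, by simp; rfl⟩
    | add y z hy hz h1 h2 => exact hadd _ h1 _ h2
    | inv y hy h1 => exact hinv _ h1
    | mul y z hy hz h1 h2 => exact hmul _ h1 _ h2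
  exact hall x x.2

/-- The quadratic model of the function field of a curve `a z² + 2 b z + c = 0`. -/
theorem quadraticModel (h : C.IsChart A θ) {a b c : Polynomial ℂ} (ha0 : a ≠ 0)
    (heq : Polynomial.aeval (θ 0) a * θ 2 ^ 2 + 2 * Polynomial.aeval (θ 0) b * θ 2 +
      Polynomial.aeval (θ 0) c = 0) {Q f : Polynomial ℂ} (hQ : Q ≠ 0)
    (hf : b ^ 2 - a * c = Q ^ 2 * f) :
    QuadraticModel C.functionField (θ 0)
      ((Polynomial.aeval (θ 0) a * θ 2 + Polynomial.aeval (θ 0) b) / Polynomial.aeval (θ 0) Q)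
      f := by
  have hne : ∀ r : Polynomial ℂ, r ≠ 0 → Polynomial.aeval (θ 0) r ≠ 0 := fun r hr h0 =>
    hr (h.indep r 0 (by simp [h0])).1
  have hQ0 := hne Q hQ
  have ha0' := hne a ha0
  refine ⟨?_, fun p q hpq => ?_, fun x => ?_⟩
  · have h1 := congrArg (Polynomial.aeval (θ 0)) hf
    simp only [map_sub, map_mul, map_pow] at h1
    rw [div_pow, div_eq_iff (pow_ne_zero 2 hQ0)]
    linear_combination Polynomial.aeval (θ 0) a * heq + h1
  · have h1 := h.indep (p * Q + q * b) (q * a) (by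
      have : Polynomial.aeval (θ 0) Q * (Polynomial.aeval (θ 0) p + Polynomial.aeval (θ 0) q *
        ((Polynomial.aeval (θ 0) a * θ 2 + Polynomial.aeval (θ 0) b) /
          Polynomial.aeval (θ 0) Q)) = 0 := by rw [hpq, mul_zero]
      rw [← this]
      simp only [map_add, map_mul]
      field_simp
      ring)
    have hq : q = 0 := by simpa [ha0] using h1.2
    have hp : p = 0 := by simpa [hq, hQ] using h1.1
    exact ⟨hp, hq⟩
  · obtain ⟨p, q, r, hr, rfl⟩ := h.exists_repr ha0 heq x
    refine ⟨p * a - q * b, q * Q, r * a, mul_ne_zero hr ha0, ?_⟩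
    have := hne r hr
    simp only [map_sub, map_mul]
    field_simp
    ring

end IsChart

end PlaneCurve

end ChartOfCurve


/-! ### Multiplicities of points -/

section PointMultiplicity

open MvPolynomial

/-- The line through `q` in the direction `v`, with parameter `X`. -/
noncomputable def lineThrough (q v : Fin 3 → ℂ) : Fin 3 → Polynomial ℂ :=
  fun i => Polynomial.C (q i) + Polynomial.C (v i) * Polynomial.X

theorem aeval_C_mul_X (P : MvPolynomial (Fin 3) ℂ) (v : Fin 3 → ℂ) (j : ℕ) :
    (aeval (fun i => Polynomial.C (v i) * Polynomial.X) P : Polynomial ℂ).coeff j =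
      aeval v (homogeneousComponent j P) := by
  have hC : ∀ i : ℕ, (aeval (fun l => Polynomial.C (v l) * Polynomial.X)
      (homogeneousComponent i P) : Polynomial ℂ) =
      Polynomial.X ^ i * Polynomial.C (aeval v (homogeneousComponent i P)) := by
    intro i
    have h1 := aeval_mul_of_isHomogeneous (homogeneousComponent_isHomogeneous i P)
      (Polynomial.X : Polynomial ℂ) (fun l => Polynomial.C (v l))
    have h2 : (aeval (fun l => Polynomial.C (v l)) (homogeneousComponent i P) : Polynomial ℂ) =
        Polynomial.C (aeval v (homogeneousComponent i P)) := by
      have := aeval_algebraMap_apply (A := ℂ) (Polynomial ℂ) v (homogeneousComponent i P)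
      exact this
    rw [← h2, ← h1]
    congr 2
    funext l
    ring
  conv_lhs => rw [← sum_homogeneousComponent P]
  rw [map_sum, Polynomial.finsetSum_coeff]
  simp only [hC, Polynomial.coeff_X_pow_mul', Polynomial.coeff_C]
  by_cases hj : j ∈ Finset.range (P.totalDegree + 1)
  · rw [Finset.sum_eq_single_of_mem j hj]
    · simp
    · intro i _ hij
      split_ifs <;> first | rfl | omega
  · rw [Finset.sum_eq_zero, homogeneousComponent_eq_zero, map_zero]
    · simp at hj; omega
    · intro i hi
      have : i ≠ j := by rintro rfl; exact hj hi
      split_ifs <;> first | rfl | omega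

namespace PlaneCurve

variable {d : ℕ} (C : PlaneCurve d)

/-- Along a line through `p`, the coefficient of `X^j` is the degree `j` part of the Taylor
expansion evaluated at the direction, and a form over `ℂ` is zero once all its values are. In terms
of lines, multiplicities are easy to follow through linear changes. -/
theorem le_mult_iff (p : ℙ ℂ (Fin 3 → ℂ)) (m : ℕ) :
    m ≤ C.mult p ↔ ∀ v, Polynomial.X ^ m ∣ aeval (lineThrough p.rep v) C.poly := by
  set S := bind₁ (fun i => X i + MvPolynomial.C (p.rep i)) C.poly with hS
  have hline : ∀ v, aeval (lineThrough p.rep v) C.poly =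
      aeval (fun i => Polynomial.C (v i) * Polynomial.X) S := by
    intro v
    rw [hS, aeval_bind₁]
    congr 2
    funext i
    simp [lineThrough, add_comm]
  have hS0 : S ≠ 0 := by
    intro h0
    have h1 : bind₁ (fun i => X i - MvPolynomial.C (p.rep i)) S = C.poly := by
      rw [hS, bind₁_bind₁]
      have : (fun i => (bind₁ fun i => X i - MvPolynomial.C (p.rep i))
          (X i + MvPolynomial.C (p.rep i))) = (X : Fin 3 → MvPolynomial (Fin 3) ℂ) := by
        funext i
        simp
      rw [this, bind₁_X_left]
      rfl
    rw [h0, map_zero] at h1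
    exact C.irreducible.ne_zero h1.symm
  have hne : {m | homogeneousComponent m S ≠ 0}.Nonempty := by
    by_contra hcon
    rw [Set.not_nonempty_iff_eq_empty, Set.eq_empty_iff_forall_notMem] at hcon
    apply hS0
    rw [← sum_homogeneousComponent S]
    exact Finset.sum_eq_zero fun i _ => not_not.1 (hcon i)
  have h1 : m ≤ C.mult p ↔ ∀ j < m, homogeneousComponent j S = 0 := by
    constructor
    · intro h j hj
      by_contra hcon
      exact absurd (Nat.sInf_le (s := {m | homogeneousComponent m S ≠ 0}) hcon)
        (not_le.2 (hj.trans_le h))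
    · intro h
      by_contra hcon
      exact Nat.sInf_mem hne (h _ (not_le.1 hcon))
  rw [h1]
  simp only [hline, Polynomial.X_pow_dvd_iff, aeval_C_mul_X]
  constructor
  · intro h v j hj
    rw [h j hj, map_zero]
  · intro h j hj
    refine MvPolynomial.funext fun v => ?_
    rw [map_zero, ← h v j hj]
    rfl

theorem le_mult_iff_of_linSubst {A B : Matrix (Fin 3) (Fin 3) ℂ} (hBA : B * A = 1) {u : ℂ}
    (hu : u ≠ 0) {E : MvPolynomial (Fin 3) ℂ} (hE : linSubst A C.poly = MvPolynomial.C u * E)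
    {p : ℙ ℂ (Fin 3 → ℂ)} {q : Fin 3 → ℂ} {ρ : ℂ} (hρ : ρ ≠ 0)
    (hp : p.rep = ρ • A.mulVec q) (m : ℕ) :
    m ≤ C.mult p ↔ ∀ v, Polynomial.X ^ m ∣ aeval (lineThrough q v) E := by
  have hAB : A * B = 1 := mul_eq_one_comm.1 hBA
  have key : ∀ v, aeval (lineThrough p.rep (ρ • A.mulVec v)) C.poly =
      Polynomial.C (ρ ^ d * u) * aeval (lineThrough q v) E := by
    intro v
    have h1 := aeval_linSubst A (lineThrough q v) C.poly
    rw [hE, map_mul, algHom_C, Polynomial.algebraMap_eq] at h1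
    have h2 := aeval_mul_of_isHomogeneous C.homogeneous (Polynomial.C ρ)
      (fun i => ∑ j, Polynomial.C (A i j) * lineThrough q v j)
    rw [← h1, ← mul_assoc, ← map_pow, ← map_mul] at h2
    rw [← h2]
    congr 2
    funext i
    rw [hp]
    simp only [lineThrough, Pi.smul_apply, smul_eq_mul, Matrix.mulVec, dotProduct, map_mul, map_sum, mul_add, Finset.sum_add_distrib, Finset.mul_sum, Finset.sum_mul]
    congr 1
    exact Finset.sum_congr rfl fun j _ => by ring
  have hunit : IsUnit (Polynomial.C (ρ ^ d * u)) :=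
    Polynomial.isUnit_C.2 (mul_ne_zero (pow_ne_zero _ hρ) hu).isUnit
  rw [le_mult_iff]
  constructor
  · intro h v
    have := h (ρ • A.mulVec v)
    rwa [key, hunit.dvd_mul_left] at this
  · intro h v
    have h1 : v = ρ • A.mulVec (ρ⁻¹ • B.mulVec v) := by
      rw [Matrix.mulVec_smul, Matrix.mulVec_mulVec, hAB, Matrix.one_mulVec, smul_smul,
        mul_inv_cancel₀ hρ, one_smul]
    rw [h1, key, hunit.dvd_mul_left]
    exact h _

end PlaneCurve

theorem binaryForm_mul {M N : ℕ} {p q : Polynomial ℂ} (hp : p.natDegree ≤ M)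
    (hq : q.natDegree ≤ N) : binaryForm (M + N) (p * q) = binaryForm M p * binaryForm N q := by
  rw [binaryForm, Polynomial.homogenize_mul p q hp hq, map_mul]
  rfl

theorem binaryForm_sub (N : ℕ) (p q : Polynomial ℂ) :
    binaryForm N (p - q) = binaryForm N p - binaryForm N q := by
  simp [binaryForm]

theorem binaryForm_add (N : ℕ) (p q : Polynomial ℂ) :
    binaryForm N (p + q) = binaryForm N p + binaryForm N q := by
  simp [binaryForm]

theorem binaryForm_C (N : ℕ) (c : ℂ) :
    binaryForm N (Polynomial.C c) = MvPolynomial.C c * X 1 ^ N := by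
  rw [binaryForm, Polynomial.homogenize_C]
  simp

theorem binaryForm_C_mul (N : ℕ) (c : ℂ) (p : Polynomial ℂ) :
    binaryForm N (Polynomial.C c * p) = MvPolynomial.C c * binaryForm N p := by
  rw [binaryForm, Polynomial.homogenize_C_mul]
  simp [binaryForm]

theorem binaryForm_one (N : ℕ) : binaryForm N 1 = X 1 ^ N := by
  simpa using binaryForm_C N 1

theorem binaryForm_X_sub_C (t : ℂ) :
    binaryForm 1 (Polynomial.X - Polynomial.C t) = X 0 - MvPolynomial.C t * X 1 := by
  rw [binaryForm_sub, binaryForm_C, binaryForm, Polynomial.homogenize_X one_ne_zero]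
  simp

/-- Completing the square. -/
theorem X_pow_mul_quadForm {k : ℕ} {b δ : Polynomial ℂ} (hb : b.natDegree ≤ k + 1)
    (hc : (b ^ 2 - δ).natDegree ≤ k + 2) :
    X 1 ^ k * quadForm k 1 b (b ^ 2 - δ) =
      (X 1 ^ k * X 2 + binaryForm (k + 1) b) ^ 2 - binaryForm (2 * k + 2) δ := by
  have h1 : binaryForm (2 * k + 2) (b ^ 2 - δ) = X 1 ^ k * binaryForm (k + 2) (b ^ 2 - δ) := by
    rw [← binaryForm_one, ← binaryForm_mul (by simp) hc, one_mul]
    congr 1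
    ring
  have h2 : binaryForm (2 * k + 2) (b ^ 2) = binaryForm (k + 1) b ^ 2 := by
    rw [pow_two (binaryForm _ _), ← binaryForm_mul hb hb, pow_two]
    congr 1
    ring
  rw [binaryForm_sub, h2] at h1
  rw [quadForm, binaryForm_one]
  linear_combination -h1

theorem aeval_binaryForm_of_eq_zero {R : Type*} [CommRing R] [Algebra ℂ R] {θ : Fin 3 → R}
    (h : θ 1 = 0) (N : ℕ) (p : Polynomial ℂ) :
    aeval θ (binaryForm N p) = algebraMap ℂ R (p.coeff N) * θ 0 ^ N := by
  rw [binaryForm, aeval_rename, Polynomial.homogenize, map_sum,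
    Finset.sum_eq_single_of_mem (N, 0) (by simp)]
  · rw [aeval_monomial, Finsupp.prod_fintype _ _ (fun _ => pow_zero _)]
    simp [Fin.prod_univ_two]
  · rintro ⟨i, j⟩ hij hne
    rw [Finset.HasAntidiagonal.mem_antidiagonal] at hij
    rw [aeval_monomial, Finsupp.prod_fintype _ _ (fun _ => pow_zero _)]
    have : j ≠ 0 := by
      rintro rfl
      simp at hij hne
      exact hne hij
    simp [Fin.prod_univ_two, h, this]

theorem lineThrough_apply (q v : Fin 3 → ℂ) (i : Fin 3) :
    lineThrough q v i = Polynomial.C (q i) + Polynomial.C (v i) * Polynomial.X := rfl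

theorem aeval_line_binaryForm_of_vertex {q v : Fin 3 → ℂ} (h0 : q 0 = 0) (h1 : q 1 = 0) (N : ℕ)
    (p : Polynomial ℂ) : aeval (lineThrough q v) (binaryForm N p) =
      Polynomial.X ^ N * Polynomial.C (aeval v (binaryForm N p)) := by
  have h2 : (aeval (fun l => Polynomial.C (v l)) (binaryForm N p) : Polynomial ℂ) =
      Polynomial.C (aeval v (binaryForm N p)) := by
    have := aeval_algebraMap_apply (A := ℂ) (Polynomial ℂ) v (binaryForm N p)
    exact this
  rw [← h2, ← aeval_mul_of_isHomogeneous (isHomogeneous_binaryForm N p)]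
  simp only [binaryForm, aeval_rename]
  congr 2
  funext i
  fin_cases i
  · simp [lineThrough_apply, h0]
  · simp [lineThrough_apply, h1]

theorem X_pow_dvd_line_vertex {q : Fin 3 → ℂ} (h0 : q 0 = 0) (h1 : q 1 = 0) {k : ℕ}
    (a b c : Polynomial ℂ) (v : Fin 3 → ℂ) :
    Polynomial.X ^ k ∣ aeval (lineThrough q v) (quadForm k a b c) := by
  simp only [quadForm, map_add, map_mul, map_pow, aeval_X, aeval_line_binaryForm_of_vertex h0 h1]
  refine dvd_add (dvd_add ?_ ?_) ?_
  · exact (dvd_mul_right _ _).mul_right _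
  · rw [pow_succ]
    exact (((dvd_mul_right _ _).mul_right _).mul_left _).mul_right _
  · rw [pow_add]
    exact (dvd_mul_right _ _).mul_right _

/-- The tangent cone at the vertex is given by `a`. -/
theorem coeff_line_vertex {q : Fin 3 → ℂ} (h0 : q 0 = 0) (h1 : q 1 = 0) {k : ℕ}
    (a b c : Polynomial ℂ) (v : Fin 3 → ℂ) :
    (aeval (lineThrough q v) (quadForm k a b c)).coeff k = aeval v (binaryForm k a) * q 2 ^ 2 := by
  have : aeval (lineThrough q v) (quadForm k a b c) = Polynomial.X ^ k *
      (Polynomial.C (aeval v (binaryForm k a)) * lineThrough q v 2 ^ 2 +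
        Polynomial.X * (2 * Polynomial.C (aeval v (binaryForm (k + 1) b)) * lineThrough q v 2 +
        Polynomial.X * Polynomial.C (aeval v (binaryForm (k + 2) c)))) := by
    simp only [quadForm, map_add, map_mul, map_pow, map_ofNat, aeval_X,
      aeval_line_binaryForm_of_vertex h0 h1]
    ring
  rw [this, Polynomial.coeff_X_pow_mul', if_pos le_rfl, Nat.sub_self,
    Polynomial.coeff_zero_eq_eval_zero]
  simp [lineThrough_apply]

variable {k : ℕ} {b δ : Polynomial ℂ}

theorem aeval_line_vertical (hb : b.natDegree ≤ k + 1) (hc : (b ^ 2 - δ).natDegree ≤ k + 2)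
    (t z : ℂ) : aeval (lineThrough ![t, 1, z] ![0, 0, 1]) (quadForm k 1 b (b ^ 2 - δ)) =
      (Polynomial.C (z + b.eval t) + Polynomial.X) ^ 2 - Polynomial.C (δ.eval t) := by
  rw [aeval_quadForm_of_eq_one (by simp [lineThrough_apply]) (by simp) hb hc]
  have : lineThrough ![t, 1, z] ![0, 0, 1] 0 = algebraMap ℂ (Polynomial ℂ) t := by
    simp [lineThrough_apply]
  have hC : ∀ p : Polynomial ℂ, Polynomial.aeval (algebraMap ℂ (Polynomial ℂ) t) p =
      Polynomial.C (p.eval t) := fun p => by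
    rw [Polynomial.aeval_algebraMap_apply]; rfl
  rw [this]
  simp only [hC, lineThrough_apply, Matrix.cons_val, map_one, map_sub, map_pow, map_add,
    Polynomial.eval_sub, Polynomial.eval_pow, Polynomial.eval_one]
  ring

/-- The vertical direction gives `z + b(t) = 0`. In the direction of `x` the square `(z + b)²` then
has order at least two, so `δ` has it too. -/
theorem singular_of_two_dvd (hb : b.natDegree ≤ k + 1) (hc : (b ^ 2 - δ).natDegree ≤ k + 2)
    {t z : ℂ} (h : ∀ v, Polynomial.X ^ 2 ∣
      aeval (lineThrough ![t, 1, z] v) (quadForm k 1 b (b ^ 2 - δ))) :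
    z = -b.eval t ∧ (Polynomial.X - Polynomial.C t) ^ 2 ∣ δ := by
  have h1 := h ![0, 0, 1]
  rw [aeval_line_vertical hb hc, Polynomial.X_pow_dvd_iff] at h1
  have h2 := h1 0 (by norm_num)
  have h3 := h1 1 (by norm_num)
  have h4 : ∀ e : ℂ, (Polynomial.C e + Polynomial.X) ^ 2 = Polynomial.C (e ^ 2) +
      Polynomial.C (2 * e) * Polynomial.X + Polynomial.X ^ 2 := fun e => by
    simp only [map_pow, map_mul, map_ofNat]; ring
  have h5 : z + b.eval t = 0 := by
    rw [h4] at h3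
    generalize z + b.eval t = e at h3
    simpa [Polynomial.coeff_C, Polynomial.coeff_X_pow, -map_pow, -map_mul] using h3
  refine ⟨eq_neg_of_add_eq_zero_left h5, ?_⟩
  have h6 := h ![1, 0, 0]
  rw [aeval_quadForm_of_eq_one (by simp [lineThrough_apply]) (by simp) hb hc] at h6
  have h7 : lineThrough ![t, 1, z] ![1, 0, 0] 0 = Polynomial.X + Polynomial.C t := by
    simp [lineThrough_apply, add_comm]
  have h8 : lineThrough ![t, 1, z] ![1, 0, 0] 2 = Polynomial.C z := by simp [lineThrough_apply]
  rw [h7, h8] at h6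
  simp only [← Polynomial.comp_eq_aeval, Polynomial.sub_comp, Polynomial.pow_comp,
    Polynomial.one_comp] at h6
  have h9 : Polynomial.X ^ 2 ∣ (Polynomial.C z + b.comp (Polynomial.X + Polynomial.C t)) ^ 2 := by
    apply pow_dvd_pow_of_dvd
    rw [Polynomial.X_dvd_iff, Polynomial.coeff_zero_eq_eval_zero]
    simpa using h5
  have h10 : Polynomial.X ^ 2 ∣ δ.comp (Polynomial.X + Polynomial.C t) := by
    have := dvd_sub h9 h6
    convert this using 1
    ring
  obtain ⟨e, he⟩ := h10
  have h11 : δ = (δ.comp (Polynomial.X + Polynomial.C t)).comp (Polynomial.X - Polynomial.C t) := by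
    rw [Polynomial.comp_assoc]
    simp
  rw [h11, he, Polynomial.mul_comp, Polynomial.pow_comp, Polynomial.X_comp]
  exact dvd_mul_right _ _

/-- On a vertical line the equation is a monic quadratic polynomial. -/
theorem not_three_dvd (hb : b.natDegree ≤ k + 1) (hc : (b ^ 2 - δ).natDegree ≤ k + 2) (t z : ℂ) :
    ¬ ∀ v, Polynomial.X ^ 3 ∣
      aeval (lineThrough ![t, 1, z] v) (quadForm k 1 b (b ^ 2 - δ)) := by
  intro h
  have h1 := h ![0, 0, 1]
  rw [aeval_line_vertical hb hc, Polynomial.X_pow_dvd_iff] at h1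
  have h3 := h1 2 (by norm_num)
  have h4 : ∀ e : ℂ, (Polynomial.C e + Polynomial.X) ^ 2 = Polynomial.C (e ^ 2) +
      Polynomial.C (2 * e) * Polynomial.X + Polynomial.X ^ 2 := fun e => by
    simp only [map_pow, map_mul, map_ofNat]; ring
  rw [h4] at h3
  generalize z + b.eval t = e at h3
  simp [-map_pow, -map_mul] at h3

/-- The factor `y^k` is invertible at the point, so the completed square can be used: `y^k z + b`
vanishes there, and `δ` contributes `(x - t y)²`. -/
theorem two_dvd_of_singular (hb : b.natDegree ≤ k + 1) (hc : (b ^ 2 - δ).natDegree ≤ k + 2)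
    (hδ : δ.natDegree ≤ 2 * k + 2)
    {t : ℂ} (h : (Polynomial.X - Polynomial.C t) ^ 2 ∣ δ) (v : Fin 3 → ℂ) :
    Polynomial.X ^ 2 ∣ aeval (lineThrough ![t, 1, -b.eval t] v) (quadForm k 1 b (b ^ 2 - δ)) := by
  set θ := lineThrough ![t, 1, -b.eval t] v with hθ
  have h1 := congrArg (aeval θ) (X_pow_mul_quadForm hb hc)
  rw [map_mul, map_pow, aeval_X] at h1
  have hcop : IsCoprime (Polynomial.X ^ 2) (θ 1 ^ k) := by
    apply IsCoprime.pow
    refine ⟨-Polynomial.C (v 1), 1, ?_⟩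
    simp [hθ, lineThrough_apply]
  refine hcop.dvd_of_dvd_mul_left ?_
  rw [h1, map_sub]
  apply dvd_sub
  · rw [map_pow]
    apply pow_dvd_pow_of_dvd
    rw [Polynomial.X_dvd_iff, Polynomial.coeff_zero_eq_eval_zero]
    have h2 : ∀ P : MvPolynomial (Fin 3) ℂ, (aeval θ P).eval 0 = aeval ![t, 1, -b.eval t] P := by
      intro P
      have h3 := (comp_aeval_apply θ (Polynomial.aeval (R := ℂ) (0 : ℂ)) P)
      rw [Polynomial.coe_aeval_eq_eval] at h3
      rw [h3]
      congr 2
      funext i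
      simp [hθ, lineThrough_apply]
    rw [h2, map_add, map_mul, map_pow, aeval_X, aeval_X, aeval_binaryForm_of_eq_one rfl hb]
    simp
  · obtain ⟨e, rfl⟩ := h
    by_cases he : e = 0
    · simp [he, binaryForm]
    have hdeg : ((Polynomial.X - Polynomial.C t) ^ 2 : Polynomial ℂ).natDegree = 2 := by
      rw [Polynomial.natDegree_pow, Polynomial.natDegree_X_sub_C]
    have hne : ((Polynomial.X - Polynomial.C t) ^ 2 : Polynomial ℂ) ≠ 0 :=
      pow_ne_zero _ (Polynomial.X_sub_C_ne_zero t)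
    rw [Polynomial.natDegree_mul hne he, hdeg] at hδ
    have hsq : binaryForm 2 ((Polynomial.X - Polynomial.C t) ^ 2) =
        (X 0 - MvPolynomial.C t * X 1) * (X 0 - MvPolynomial.C t * X 1) := by
      rw [← binaryForm_X_sub_C, ← binaryForm_mul (by simp) (by simp), pow_two]
    rw [show 2 * k + 2 = 2 + 2 * k by ring, binaryForm_mul hdeg.le (by omega), map_mul, hsq,
      map_mul]
    have h3 : Polynomial.X ∣ aeval θ (X 0 - MvPolynomial.C t * X 1) := by
      rw [Polynomial.X_dvd_iff, Polynomial.coeff_zero_eq_eval_zero]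
      simp [hθ, lineThrough_apply]
    rw [pow_two]
    exact (mul_dvd_mul h3 h3).mul_right _

/-- On `y = 0` with `x = 1` the equation is the polynomial `2 b_{k+1} z + c_{k+2}`, of degree at
most one in `z`, where `c = b² - δ`. It is nonzero by `hy`, which says that `y` does not divide the
equation. -/
theorem not_two_dvd_of_infinity (hk : k ≠ 0)
    (hy : b.coeff (k + 1) ≠ 0 ∨ (b ^ 2 - δ).coeff (k + 2) ≠ 0) (z : ℂ) :
    ¬ ∀ v, Polynomial.X ^ 2 ∣
      aeval (lineThrough ![1, 0, z] v) (quadForm k 1 b (b ^ 2 - δ)) := by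
  intro h
  have h1 := h ![0, 0, 1]
  have h0 : lineThrough ![1, 0, z] ![0, 0, 1] 1 = 0 := by simp [lineThrough_apply]
  have h2 : lineThrough ![1, 0, z] ![0, 0, 1] 0 = 1 := by simp [lineThrough_apply]
  have h3 : lineThrough ![1, 0, z] ![0, 0, 1] 2 = Polynomial.C z + Polynomial.X := by
    simp [lineThrough_apply]
  simp only [quadForm, map_add, map_mul, map_pow, map_ofNat, aeval_X,
    aeval_binaryForm_of_eq_zero h0, h2, h3, Polynomial.coeff_one, hk, if_false, map_zero, zero_mul,
    one_pow, mul_one, zero_add, Polynomial.algebraMap_eq] at h1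
  rw [Polynomial.X_pow_dvd_iff] at h1
  have h4 : 2 * Polynomial.C (b.coeff (k + 1)) * (Polynomial.C z + Polynomial.X) +
      Polynomial.C ((b ^ 2 - δ).coeff (k + 2)) = Polynomial.C (2 * b.coeff (k + 1) * z +
        (b ^ 2 - δ).coeff (k + 2)) + Polynomial.C (2 * b.coeff (k + 1)) * Polynomial.X := by
    simp only [map_add, map_mul, map_ofNat]; ring
  rw [h4] at h1
  have h5 := h1 0 (by norm_num)
  have h6 := h1 1 (by norm_num)
  simp [Polynomial.coeff_C] at h5 h6
  simp [h6] at h5 hy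
  exact hy h5

end PointMultiplicity


/-! ### Curves in normal form -/

section NormalForm

open Polynomial

theorem Projectivization.exists_rep_eq {v : Fin 3 → ℂ} (hv : v ≠ 0) :
    ∃ ρ : ℂ, ρ ≠ 0 ∧ (Projectivization.mk ℂ v hv).rep = ρ • v := by
  obtain ⟨a, ha⟩ := Projectivization.exists_smul_eq_mk_rep ℂ v hv
  exact ⟨a, a.ne_zero, ha.symm⟩

theorem Projectivization.eq_mk_of_rep {p : ℙ ℂ (Fin 3 → ℂ)} {v : Fin 3 → ℂ} (hv : v ≠ 0) {ρ : ℂ}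
    (h : p.rep = ρ • v) : p = Projectivization.mk ℂ v hv := by
  rw [← Projectivization.mk_rep p, Projectivization.mk_eq_mk_iff']
  exact ⟨ρ, h.symm⟩

namespace PlaneCurve

/-- After the linear change of coordinates given by `A`, the curve `C` has the equation
`(z + b(x))² = δ(x)` in the affine chart `y = 1`. -/
structure IsNormalForm {k : ℕ} (C : PlaneCurve (k + 2)) (A B : Matrix (Fin 3) (Fin 3) ℂ)
    (b δ : ℂ[X]) : Prop where
  two_le : 2 ≤ k
  inv : B * A = 1
  eqn : ∃ u : ℂ, u ≠ 0 ∧ linSubst A C.poly = MvPolynomial.C u * quadForm k 1 b (b ^ 2 - δ)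
  degree_b : b.natDegree ≤ k + 1
  degree_c : (b ^ 2 - δ).natDegree ≤ k + 2
  ne_infinity : b.coeff (k + 1) ≠ 0 ∨ (b ^ 2 - δ).coeff (k + 2) ≠ 0

namespace IsNormalForm

variable {k : ℕ} {C : PlaneCurve (k + 2)} {A B : Matrix (Fin 3) (Fin 3) ℂ} {b δ : ℂ[X]}

theorem degree_δ (h : C.IsNormalForm A B b δ) : δ.natDegree ≤ 2 * k + 2 := by
  have : δ = b ^ 2 - (b ^ 2 - δ) := by ring
  rw [this]
  refine (natDegree_sub_le _ _).trans (max_le ?_ ?_)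
  · have := h.degree_b
    exact natDegree_pow_le.trans (by omega)
  · have := h.degree_c
    omega

theorem inv' (h : C.IsNormalForm A B b δ) : A * B = 1 := mul_eq_one_comm.1 h.inv

theorem mulVec_ne_zero (h : C.IsNormalForm A B b δ) {v : Fin 3 → ℂ} (hv : v ≠ 0) :
    A.mulVec v ≠ 0 := by
  intro h0
  apply hv
  rw [← Matrix.one_mulVec v, ← h.inv, ← Matrix.mulVec_mulVec, h0, Matrix.mulVec_zero]

/-- The point of the projective plane with coordinates `v` in the new coordinate system. -/
noncomputable def point (h : C.IsNormalForm A B b δ) (v : Fin 3 → ℂ) (hv : v ≠ 0) :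
    ℙ ℂ (Fin 3 → ℂ) :=
  Projectivization.mk ℂ (A.mulVec v) (h.mulVec_ne_zero hv)

theorem exists_rep (h : C.IsNormalForm A B b δ) (v : Fin 3 → ℂ) (hv : v ≠ 0) :
    ∃ ρ : ℂ, ρ ≠ 0 ∧ (h.point v hv).rep = ρ • A.mulVec v :=
  Projectivization.exists_rep_eq _

theorem le_mult_point_iff (h : C.IsNormalForm A B b δ) (v : Fin 3 → ℂ) (hv : v ≠ 0) (m : ℕ) :
    m ≤ C.mult (h.point v hv) ↔
      ∀ w, X ^ m ∣ MvPolynomial.aeval (lineThrough v w) (quadForm k 1 b (b ^ 2 - δ)) := by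
  obtain ⟨u, hu, hE⟩ := h.eqn
  obtain ⟨ρ, hρ, hp⟩ := h.exists_rep v hv
  exact C.le_mult_iff_of_linSubst h.inv hu hE hρ hp m

/-- The point of multiplicity `k`. -/
noncomputable def vertex (h : C.IsNormalForm A B b δ) : ℙ ℂ (Fin 3 → ℂ) :=
  h.point ![0, 0, 1] (fun h0 => by simpa using congrFun h0 2)

/-- The point `(t, -b(t))` of the affine chart. -/
noncomputable def pointAt (h : C.IsNormalForm A B b δ) (t : ℂ) : ℙ ℂ (Fin 3 → ℂ) :=
  h.point ![t, 1, -b.eval t] (fun h0 => by simpa using congrFun h0 1)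

theorem mult_vertex (h : C.IsNormalForm A B b δ) : C.mult h.vertex = k := by
  apply le_antisymm
  · by_contra hlt
    rw [not_le, ← Nat.succ_le_iff, vertex, le_mult_point_iff] at hlt
    have h2 := (X_pow_dvd_iff.1 (hlt ![0, 1, 0])) k (Nat.lt_succ_self k)
    rw [coeff_line_vertex (by simp) (by simp), binaryForm_one] at h2
    simp at h2
  · rw [vertex, le_mult_point_iff]
    exact fun w => X_pow_dvd_line_vertex (by simp) (by simp) _ _ _ w

theorem mult_pointAt (h : C.IsNormalForm A B b δ) {t : ℂ} (ht : (X - Polynomial.C t) ^ 2 ∣ δ) :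
    C.mult (h.pointAt t) = 2 := by
  apply le_antisymm
  · by_contra hlt
    rw [not_le, ← Nat.succ_le_iff, pointAt, le_mult_point_iff] at hlt
    exact not_three_dvd h.degree_b h.degree_c _ _ hlt
  · rw [pointAt, le_mult_point_iff]
    exact fun w => two_dvd_of_singular h.degree_b h.degree_c h.degree_δ ht w

theorem eq_point (h : C.IsNormalForm A B b δ) (p : ℙ ℂ (Fin 3 → ℂ)) (v : Fin 3 → ℂ) (hv : v ≠ 0)
    {ρ : ℂ} (hp : B.mulVec p.rep = ρ • v) : p = h.point v hv := by
  refine Projectivization.eq_mk_of_rep _ (ρ := ρ) ?_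
  rw [← Matrix.mulVec_smul, ← hp, Matrix.mulVec_mulVec, h.inv', Matrix.one_mulVec]

theorem mem_singularPoints_iff (h : C.IsNormalForm A B b δ) {p : ℙ ℂ (Fin 3 → ℂ)} :
    p ∈ C.singularPoints ↔ p = h.vertex ∨ ∃ t, (X - Polynomial.C t) ^ 2 ∣ δ ∧ p = h.pointAt t := by
  constructor
  · intro hp
    change 2 ≤ C.mult p at hp
    set q := B.mulVec p.rep with hq
    by_cases h1 : q 1 = 0
    · by_cases h0 : q 0 = 0
      · left
        refine h.eq_point p _ _ (ρ := q 2) ?_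
        funext i
        fin_cases i <;> simp [h0, h1, ← hq]
      · exfalso
        have hv : ![1, 0, q 2 / q 0] ≠ 0 := fun h0 => by simpa using congrFun h0 0
        have hpe : p = h.point _ hv := by
          refine h.eq_point p _ _ (ρ := q 0) ?_
          funext i
          fin_cases i <;> simp [h1, ← hq]
          field_simp
        rw [hpe, h.le_mult_point_iff] at hp
        exact not_two_dvd_of_infinity (by have := h.two_le; omega) h.ne_infinity _ hp
    · right
      have hv : ![q 0 / q 1, 1, q 2 / q 1] ≠ 0 := fun h0 => by simpa using congrFun h0 1
      have hpe : p = h.point _ hv := by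
        refine h.eq_point p _ _ (ρ := q 1) ?_
        funext i
        fin_cases i <;> simp [← hq] <;> field_simp
      rw [hpe, h.le_mult_point_iff] at hp
      obtain ⟨h2, h3⟩ := singular_of_two_dvd h.degree_b h.degree_c hp
      refine ⟨_, h3, ?_⟩
      rw [hpe, pointAt]
      congr 1
      rw [h2]
  · rintro (rfl | ⟨t, ht, rfl⟩)
    · change 2 ≤ C.mult _
      rw [h.mult_vertex]
      exact h.two_le
    · change 2 ≤ C.mult _
      rw [h.mult_pointAt ht]

theorem point_eq (h : C.IsNormalForm A B b δ) {v w : Fin 3 → ℂ} {hv : v ≠ 0} {hw : w ≠ 0}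
    (heq : h.point v hv = h.point w hw) : ∃ a : ℂ, a • w = v := by
  rw [point, point, Projectivization.mk_eq_mk_iff'] at heq
  obtain ⟨a, ha⟩ := heq
  refine ⟨a, ?_⟩
  have := congrArg B.mulVec ha
  rwa [Matrix.mulVec_smul, Matrix.mulVec_mulVec, Matrix.mulVec_mulVec, h.inv, Matrix.one_mulVec,
    Matrix.one_mulVec] at this

theorem pointAt_injective (h : C.IsNormalForm A B b δ) : Function.Injective h.pointAt := by
  intro t t' heq
  obtain ⟨a, ha⟩ := h.point_eq heq
  have h1 := congrFun ha 1
  have h0 := congrFun ha 0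
  simp at h0 h1
  rw [← h0, h1, one_mul]

theorem pointAt_ne_vertex (h : C.IsNormalForm A B b δ) (t : ℂ) : h.pointAt t ≠ h.vertex := by
  intro heq
  obtain ⟨a, ha⟩ := h.point_eq heq
  simpa using congrFun ha 1

theorem isOfType (h : C.IsNormalForm A B b δ) : C.IsOfType k := by
  constructor
  · exact ⟨h.vertex, h.mem_singularPoints_iff.2 (Or.inl rfl), h.mult_vertex⟩
  · rintro _ ⟨p, hp, rfl⟩
    rcases h.mem_singularPoints_iff.1 hp with rfl | ⟨t, ht, rfl⟩
    · exact h.mult_vertex.le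
    · rw [h.mult_pointAt ht]
      exact h.two_le

/-- Coordinate functions `x, 1, z` on the affine chart. -/
theorem exists_isChart (h : C.IsNormalForm A B b δ) :
    ∃ θ : Fin 3 → C.functionField, C.IsChart A θ ∧
      θ 2 ^ 2 + 2 * aeval (θ 0) b * θ 2 + aeval (θ 0) (b ^ 2 - δ) = 0 := by
  obtain ⟨u, hu, hE⟩ := h.eqn
  obtain ⟨θ, hθ, h0⟩ := C.exists_chart h.inv hu (by simp) h.degree_b h.degree_c one_ne_zero hE
  refine ⟨θ, hθ, ?_⟩
  rw [aeval_quadForm_of_eq_one hθ.one (by simp) h.degree_b h.degree_c] at h0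
  simpa using h0

variable {θ : Fin 3 → C.functionField}

theorem isCenteredAt_pointAt_iff (h : C.IsNormalForm A B b δ) (hθ : C.IsChart A θ)
    {V : CurvePlace C.functionField} (t : ℂ) :
    C.IsCenteredAt V (h.pointAt t) ↔ V.HasValue (θ 0) t ∧ V.HasValue (θ 2) (-b.eval t) := by
  obtain ⟨ρ, hρ, hp⟩ := h.exists_rep _ (fun h0 => by simpa using congrFun h0 1 :
    ![t, 1, -b.eval t] ≠ 0)
  rw [← Matrix.mulVec_smul] at hp
  have h1 : V.HasValue 1 1 := by simpa using CurvePlace.hasValue_const (V := V) 1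
  rw [pointAt, hθ.isCenteredAt_iff h.inv hp (k := 1) (by simpa using hρ)]
  simp only [hθ.one, div_one, Fin.forall_fin_succ, Pi.smul_apply, smul_eq_mul]
  have h2 : ρ * -b.eval t / ρ = -b.eval t := mul_div_cancel_left₀ _ hρ
  have h3 : ρ * t / ρ = t := mul_div_cancel_left₀ _ hρ
  simp [hρ, h1, h3, hθ.one, -mul_neg, h2]

theorem infinitelyNearRing_pointAt (h : C.IsNormalForm A B b δ) (hθ : C.IsChart A θ)
    {V : CurvePlace C.functionField} {t : ℂ} (hV : C.IsCenteredAt V (h.pointAt t)) :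
    C.infinitelyNearRing (h.pointAt t) V 0 =
      V.localizeAt (Algebra.adjoin ℂ {θ 0, θ 2}) := by
  obtain ⟨ρ, hρ, hp⟩ := h.exists_rep _ (fun h0 => by simpa using congrFun h0 1 :
    ![t, 1, -b.eval t] ≠ 0)
  rw [← Matrix.mulVec_smul] at hp
  have hk : (ρ • ![t, 1, -b.eval t]) 1 ≠ 0 := by simpa using hρ
  rw [pointAt] at hV ⊢
  rw [hθ.isCenteredAt_iff h.inv hp hk] at hV
  rw [hθ.infinitelyNearRing_zero h.inv hp hk hV]
  congr 1
  apply le_antisymm <;> rw [Algebra.adjoin_le_iff]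
  · rintro _ ⟨i, rfl⟩
    simp only [hθ.one, div_one]
    fin_cases i
    · exact Algebra.subset_adjoin (by simp)
    · change θ 1 ∈ _
      rw [hθ.one]
      exact one_mem _
    · exact Algebra.subset_adjoin (by simp)
  · rintro x (rfl | rfl)
    · exact Algebra.subset_adjoin ⟨0, by simp [hθ.one]⟩
    · exact Algebra.subset_adjoin ⟨2, by simp [hθ.one]⟩

theorem isCenteredAt_vertex_iff (h : C.IsNormalForm A B b δ) (hθ : C.IsChart A θ)
    {V : CurvePlace C.functionField} :
    C.IsCenteredAt V h.vertex ↔ V.HasValue (θ 0 / θ 2) 0 ∧ V.HasValue (1 / θ 2) 0 := by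
  obtain ⟨ρ, hρ, hp⟩ := h.exists_rep _ (fun h0 => by simpa using congrFun h0 2 :
    (![0, 0, 1] : Fin 3 → ℂ) ≠ 0)
  rw [← Matrix.mulVec_smul] at hp
  have h1 : V.HasValue 1 1 := by simpa using CurvePlace.hasValue_const (V := V) 1
  rw [vertex, hθ.isCenteredAt_iff h.inv hp (k := 2) (by simpa using hρ)]
  simp only [Fin.forall_fin_succ, Pi.smul_apply, smul_eq_mul]
  simp [hρ, h1, hθ.one, hθ.theta_ne_zero 2]

/-- The coordinate `1/z` is written as `u · (1/x)` with `u = x/z`, the shape required by the lemmas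
on the blow-up of `ℂ[u, u τ]`. -/
theorem infinitelyNearRing_vertex (h : C.IsNormalForm A B b δ) (hθ : C.IsChart A θ)
    {V : CurvePlace C.functionField} (hV : C.IsCenteredAt V h.vertex) :
    C.infinitelyNearRing h.vertex V 0 =
      V.localizeAt (Algebra.adjoin ℂ {θ 0 / θ 2, θ 0 / θ 2 * (θ 0)⁻¹}) := by
  obtain ⟨ρ, hρ, hp⟩ := h.exists_rep _ (fun h0 => by simpa using congrFun h0 2 :
    (![0, 0, 1] : Fin 3 → ℂ) ≠ 0)
  rw [← Matrix.mulVec_smul] at hp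
  have hk : (ρ • ![0, 0, 1] : Fin 3 → ℂ) 2 ≠ 0 := by simpa using hρ
  rw [vertex] at hV ⊢
  rw [hθ.isCenteredAt_iff h.inv hp hk] at hV
  rw [hθ.infinitelyNearRing_zero h.inv hp hk hV]
  have h0 := hθ.theta_ne_zero 0
  have h2 := hθ.theta_ne_zero 2
  have h3 : θ 0 / θ 2 * (θ 0)⁻¹ = 1 / θ 2 := by field_simp
  rw [h3]
  congr 1
  apply le_antisymm <;> rw [Algebra.adjoin_le_iff]
  · rintro _ ⟨i, rfl⟩
    fin_cases i
    · exact Algebra.subset_adjoin (by simp)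
    · exact Algebra.subset_adjoin (by simp [hθ.one])
    · change θ 2 / θ 2 ∈ _
      rw [div_self h2]
      exact one_mem _
  · rintro x (rfl | rfl)
    · exact Algebra.subset_adjoin ⟨0, rfl⟩
    · exact Algebra.subset_adjoin ⟨1, by simp [hθ.one]⟩

end IsNormalForm

end PlaneCurve

end NormalForm


/-! ### Branches of a curve in normal form -/

section NormalFormBranches

open Polynomial

theorem multSeq_replicate (n i : ℕ) : multSeq (List.replicate n 2) i = if i < n then 2 else 1 := by
  rw [multSeq, List.getD_eq_getElem?_getD, List.getElem?_replicate]
  split_ifs <;> rfl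

theorem multSeq_cons_zero (m : ℕ) (l : List ℕ) : multSeq (m :: l) 0 = m := rfl

theorem multSeq_cons_succ (m : ℕ) (l : List ℕ) (i : ℕ) :
    multSeq (m :: l) (i + 1) = multSeq l i := rfl

theorem Polynomial.eval_zero_reflect (N : ℕ) (p : ℂ[X]) : (reflect N p).eval 0 = p.coeff N := by
  rw [← coeff_zero_eq_eval_zero, coeff_reflect, revAt_le (Nat.zero_le N), Nat.sub_zero]

theorem CurvePlace.HasValue.aeval_reflect {K : Type*} [Field K] [Algebra ℂ K] {V : CurvePlace K}
    {r : K} (hr : V.HasValue r 0) (N : ℕ) (p : ℂ[X]) :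
    V.HasValue (Polynomial.aeval r (reflect N p)) (p.coeff N) := by
  have := hr.aeval (reflect N p)
  rwa [Polynomial.eval_zero_reflect] at this

/-- Both identities rewrite `z = Q w - b` and `(Q w - b)(Q w + b) = Q² f - b²` in terms of `1/x` and
`w / x^m`. Each serves one of the two places over infinity when `deg f` is even. -/
theorem QuadraticModel.reverse_identities {K : Type*} [Field K] [Algebra ℂ K] {s w z : K}
    {b Q f : ℂ[X]} (M : QuadraticModel K s w f) (hz : z = aeval s Q * w - aeval s b) (hz0 : z ≠ 0)
    {k m : ℕ} (hb : b.natDegree ≤ k + 1) (hd : (b ^ 2 - Q ^ 2 * f).natDegree ≤ k + 2)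
    (hmn : Q.natDegree + m = k + 1) :
    s / z = s⁻¹ ^ k / (aeval s⁻¹ (reflect Q.natDegree Q) * (w / s ^ m) -
        aeval s⁻¹ (reflect (k + 1) b)) ∧
      z / s * (aeval s⁻¹ (reflect Q.natDegree Q) * (w / s ^ m) +
        aeval s⁻¹ (reflect (k + 1) b)) = -aeval s⁻¹ (reflect (k + 2) (b ^ 2 - Q ^ 2 * f)) := by
  have h0 := M.s_ne_zero
  have hb' := QuadraticModel.aeval_inv_reflect h0 hb
  have hd' := QuadraticModel.aeval_inv_reflect h0 hd
  have hQ' := QuadraticModel.aeval_inv_reflect h0 (le_refl Q.natDegree)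
  have hsq : z * (aeval s Q * w + aeval s b) = - aeval s (b ^ 2 - Q ^ 2 * f) := by
    rw [hz]
    simp only [map_sub, map_mul, map_pow]
    linear_combination (aeval s Q) ^ 2 * M.sq
  rw [← hb', ← hd', ← hQ'] at hsq
  rw [← hb', ← hQ'] at hz
  generalize aeval s⁻¹ (reflect Q.natDegree Q) = q at *
  generalize aeval s⁻¹ (reflect (k + 1) b) = b' at *
  generalize aeval s⁻¹ (reflect (k + 2) (b ^ 2 - Q ^ 2 * f)) = d' at *
  have hpow : s ^ (k + 1) = s ^ Q.natDegree * s ^ m := by rw [← pow_add, hmn]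
  have h1 : q * (w / s ^ m) * s ^ (k + 1) = q * s ^ Q.natDegree * w := by
    rw [hpow]
    field_simp
  have hz' : z = s ^ (k + 1) * (q * (w / s ^ m) - b') := by
    rw [hz]
    linear_combination -h1
  constructor
  · rw [hz'] at hz0 ⊢
    have h3 := right_ne_zero_of_mul hz0
    rw [div_eq_div_iff hz0 h3, inv_pow]
    generalize q * (w / s ^ m) - b' = x
    field_simp
    ring
  · rw [div_mul_eq_mul_div, div_eq_iff h0]
    apply mul_right_cancel₀ (pow_ne_zero (k + 1) h0)
    linear_combination hsq + z * h1

namespace PlaneCurve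

namespace IsNormalForm

variable {k : ℕ} {C : PlaneCurve (k + 2)} {A B : Matrix (Fin 3) (Fin 3) ℂ} {b δ Q f : ℂ[X]}

theorem exists_model (h : C.IsNormalForm A B b δ) (hQ : Q ≠ 0) (hδ : δ = Q ^ 2 * f) :
    ∃ (θ : Fin 3 → C.functionField) (w : C.functionField), C.IsChart A θ ∧
      QuadraticModel C.functionField (θ 0) w f ∧
      θ 2 = aeval (θ 0) Q * w - aeval (θ 0) b := by
  obtain ⟨θ, hθ, heq⟩ := h.exists_isChart
  have M := hθ.quadraticModel (a := 1) (b := b) (c := b ^ 2 - δ) one_ne_zero (by simpa using heq) hQ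
    (f := f) (by rw [← hδ]; ring)
  refine ⟨θ, _, hθ, M, ?_⟩
  have := M.aeval_ne_zero hQ
  rw [mul_div_cancel₀ _ this]
  simp

theorem genus_eq (h : C.IsNormalForm A B b δ) (hQ : Q ≠ 0) (hδ : δ = Q ^ 2 * f) {g : ℕ}
    (hf : ∀ t, f.eval t = 0 → f.derivative.eval t ≠ 0)
    (hg : f.natDegree = 2 * g + 1 ∨ f.natDegree = 2 * g + 2) : C.genus = g := by
  obtain ⟨θ, w, -, M, -⟩ := h.exists_model hQ hδ
  exact M.genus_eq hf hg

/-- Here `z = -b + (x-t)^n Q₁ w` has an odd part of exact order `n`, so `x` and `z` generate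
`oddSubalgebra t n` as local ring. -/
theorem hasMultSeq_pointAt (h : C.IsNormalForm A B b δ) (hδ : δ = Q ^ 2 * f) {t : ℂ} {n : ℕ}
    {Q₁ : ℂ[X]} (hQ : Q = (X - Polynomial.C t) ^ n * Q₁) (hQ₁ : Q₁.eval t ≠ 0)
    (h0 : f.eval t = 0) (h1 : f.derivative.eval t ≠ 0) :
    C.HasMultSeq (h.pointAt t) (multSeq (List.replicate n 2)) := by
  have hQ0 : Q ≠ 0 := by
    rw [hQ]
    exact mul_ne_zero (pow_ne_zero _ (X_sub_C_ne_zero t)) (fun h => by simp [h] at hQ₁)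
  obtain ⟨θ, w, hθ, M, hz⟩ := h.exists_model hQ0 hδ
  have hc : ∀ V : CurvePlace C.functionField,
      C.IsCenteredAt V (h.pointAt t) ↔ V.LiesOver (θ 0) w t 0 := by
    intro V
    rw [h.isCenteredAt_pointAt_iff hθ]
    constructor
    · exact fun hV => M.liesOver_of_root h0 hV.1
    · intro hV
      refine ⟨hV.1, ?_⟩
      rw [hz]
      simpa using ((hV.1.aeval Q).mul hV.2).sub (hV.1.aeval b)
  constructor
  · obtain ⟨V, hV⟩ := M.exists_place (t := t) (c := 0) (by simp [h0])
    refine ⟨V, (hc V).2 hV, fun W hW => ?_⟩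
    exact (M.isUniformizerAt_of_root h0 h1).place_unique ((hc W).1 hW) hV
  · intro V hV n'
    have hV' := (hc V).1 hV
    have hO : C.infinitelyNearRing (h.pointAt t) V 0 = M.oddSubalgebra t n := by
      rw [h.infinitelyNearRing_pointAt hθ hV]
      have hD := M.dominates_oddSubalgebra hV' h0 n
      have hs : θ 0 ∈ M.oddSubalgebra t n := by simpa using M.aeval_mem_oddSubalgebra n X
      have hx : θ 2 = (aeval (θ 0) (-b) + aeval (θ 0) ((X - Polynomial.C t) ^ n * Q₁) * w) /
          aeval (θ 0) (1 : ℂ[X]) := by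
        rw [hz, ← hQ]
        simp
        ring
      apply le_antisymm
      · refine hD.localizeAt_le ?_
        rw [Algebra.adjoin_le_iff]
        rintro x (rfl | rfl)
        · exact hs
        · exact QuadraticModel.mem_oddSubalgebra.2 ⟨-b, Q₁, 1, by simp, hx⟩
      · refine M.oddSubalgebra_le hV' (p := -b) (q := Q₁) (r := 1)
          (fun x hx y hy hxy => CurvePlace.div_mem_localizeAt hx hy hxy) ?_ hQ₁ (by simp) ?_
        · exact CurvePlace.le_localizeAt _ _ (Algebra.subset_adjoin (by simp))
        · rw [← hx]
          exact CurvePlace.le_localizeAt _ _ (Algebra.subset_adjoin (by simp))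
    have := M.branchMultiplicity_of_oddSubalgebra h0 h1 hV' (fun i => rfl) hO n'
    rw [zero_add] at this
    rwa [multSeq_replicate]

/-- If `f(t) ≠ 0` there are two places over `x = t`, with opposite values of `w`. Since `Q(t) = 0`,
both send `z = Q w - b` to `-b(t)`. -/
theorem eval_eq_zero_of_isUnibranchedAt (h : C.IsNormalForm A B b δ) (hQ : Q ≠ 0)
    (hδ : δ = Q ^ 2 * f) {t : ℂ} (hQt : Q.eval t = 0) (hu : C.IsUnibranchedAt (h.pointAt t)) :
    f.eval t = 0 := by
  by_contra h0
  obtain ⟨θ, w, hθ, M, hz⟩ := h.exists_model hQ hδ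
  obtain ⟨c, hc⟩ := IsAlgClosed.exists_pow_nat_eq (f.eval t) (n := 2) (by norm_num)
  have hcen : ∀ (V : CurvePlace C.functionField) (e : ℂ), V.LiesOver (θ 0) w t e →
      C.IsCenteredAt V (h.pointAt t) := by
    intro V e hV
    rw [h.isCenteredAt_pointAt_iff hθ]
    refine ⟨hV.1, ?_⟩
    rw [hz]
    simpa [hQt] using ((hV.1.aeval Q).mul hV.2).sub (hV.1.aeval b)
  obtain ⟨V, hV⟩ := M.exists_place hc
  obtain ⟨W, hW⟩ := M.exists_place (t := t) (c := -c) (by simpa using hc)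
  have := hu.unique (hcen V _ hV) (hcen W _ hW)
  subst this
  have h2 := hV.2.unique hW.2
  apply h0
  rw [← hc, self_eq_neg.1 h2]
  norm_num

/-! ### Places over the line at infinity. -/

section Infinity

variable {θ : Fin 3 → C.functionField} {w : C.functionField}

/-- Over a finite value of `x` the function `z = Q w - b` is finite, so `1/z` does not vanish. -/
theorem hasValue_inv_of_isCenteredAt (h : C.IsNormalForm A B b δ) (hθ : C.IsChart A θ)
    (M : QuadraticModel C.functionField (θ 0) w f) (hz : θ 2 = aeval (θ 0) Q * w - aeval (θ 0) b)
    {V : CurvePlace C.functionField} (hV : C.IsCenteredAt V h.vertex) : V.HasValue (θ 0)⁻¹ 0 := by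
  rcases M.exists_value_or V with hr | ⟨t, ht⟩
  · exact hr
  · exfalso
    rw [h.isCenteredAt_vertex_iff hθ] at hV
    obtain ⟨c, hc⟩ := IsAlgClosed.exists_pow_nat_eq (f.eval t) (n := 2) (by norm_num)
    obtain ⟨e, he⟩ : ∃ e, V.HasValue w e := by
      rcases M.liesOver_or hc ht with h | h
      · exact ⟨_, h.2⟩
      · exact ⟨_, h.2⟩
    have h2 := (((ht.aeval Q).mul he).sub (ht.aeval b)).mul hV.2
    rw [← hz, mul_one_div_cancel (hθ.theta_ne_zero 2)] at h2
    have := h2.unique (by simpa using CurvePlace.hasValue_const (V := V) 1)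
    simp at this

theorem isCenteredAt_vertex_of_div (h : C.IsNormalForm A B b δ) (hθ : C.IsChart A θ)
    {V : CurvePlace C.functionField} (hr : V.HasValue (θ 0)⁻¹ 0)
    (hu : V.HasValue (θ 0 / θ 2) 0) : C.IsCenteredAt V h.vertex := by
  rw [h.isCenteredAt_vertex_iff hθ]
  refine ⟨hu, ?_⟩
  have := hu.mul hr
  have h0 := hθ.theta_ne_zero 0
  rwa [mul_zero, div_mul_eq_mul_div, mul_inv_cancel₀ h0] at this

/-- The equation near the line at infinity. -/
theorem equation_inv (h : C.IsNormalForm A B b δ) (hθ : C.IsChart A θ)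
    (M : QuadraticModel C.functionField (θ 0) w f) (hz : θ 2 = aeval (θ 0) Q * w - aeval (θ 0) b)
    (hδ : δ = Q ^ 2 * f) :
    (θ 2 / θ 0) ^ 2 * (θ 0)⁻¹ ^ k + 2 * aeval (θ 0)⁻¹ (reflect (k + 1) b) * (θ 2 / θ 0) +
      aeval (θ 0)⁻¹ (reflect (k + 2) (b ^ 2 - δ)) = 0 := by
  have h0 := hθ.theta_ne_zero 0
  have hb := QuadraticModel.aeval_inv_reflect h0 h.degree_b
  have hd := QuadraticModel.aeval_inv_reflect h0 h.degree_c
  have h1 : θ 2 ^ 2 + 2 * aeval (θ 0) b * θ 2 + aeval (θ 0) (b ^ 2 - δ) = 0 := by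
    have := M.sq
    rw [hz, hδ]
    simp only [map_sub, map_mul, map_pow]
    linear_combination (aeval (θ 0) Q) ^ 2 * this
  rw [← hb, ← hd] at h1
  have h2 : θ 0 ^ (k + 2) ≠ 0 := pow_ne_zero _ h0
  apply mul_right_cancel₀ h2
  rw [zero_mul, ← h1, inv_pow]
  generalize aeval (θ 0)⁻¹ (reflect (k + 1) b) = x
  generalize aeval (θ 0)⁻¹ (reflect (k + 2) (b ^ 2 - δ)) = y
  field_simp
  ring

/-- In `equation_inv`, where `1/x` vanishes, the coefficients of `(z/x)²` and `z/x` vanish and the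
constant term does not. Hence `z/x` cannot stay finite. -/
theorem isCenteredAt_vertex_iff_hasValue (h : C.IsNormalForm A B b δ) (hθ : C.IsChart A θ)
    (M : QuadraticModel C.functionField (θ 0) w f) (hz : θ 2 = aeval (θ 0) Q * w - aeval (θ 0) b)
    (hδ : δ = Q ^ 2 * f) (hb : b.coeff (k + 1) = 0) {V : CurvePlace C.functionField} :
    C.IsCenteredAt V h.vertex ↔ V.HasValue (θ 0)⁻¹ 0 := by
  refine ⟨h.hasValue_inv_of_isCenteredAt hθ M hz, fun hr => ?_⟩
  refine h.isCenteredAt_vertex_of_div hθ hr ?_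
  rw [CurvePlace.hasValue_zero_iff]
  by_contra hu
  have h0 := hθ.theta_ne_zero 0
  have h2 := hθ.theta_ne_zero 2
  have hy : V.ring.valuation (θ 2 / θ 0) ≤ 1 := by
    rw [← inv_div, map_inv₀]
    exact inv_le_one_of_one_le₀ (not_lt.1 hu)
  have hk : k ≠ 0 := by have := h.two_le; omega
  have t1 : V.HasValue ((θ 2 / θ 0) ^ 2 * (θ 0)⁻¹ ^ k) 0 := by
    rw [CurvePlace.hasValue_zero_iff, map_mul, map_pow]
    have := hr.pow k
    rw [zero_pow hk, CurvePlace.hasValue_zero_iff] at this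
    exact (mul_le_of_le_one_left zero_le (pow_le_one₀ zero_le hy)).trans_lt this
  have t2 : V.HasValue (2 * aeval (θ 0)⁻¹ (reflect (k + 1) b) * (θ 2 / θ 0)) 0 := by
    have h3 := (CurvePlace.hasValue_const (V := V) 2).mul (hr.aeval_reflect (k + 1) b)
    rw [hb, mul_zero, map_ofNat, CurvePlace.hasValue_zero_iff] at h3
    rw [CurvePlace.hasValue_zero_iff, map_mul]
    exact (mul_le_of_le_one_right zero_le hy).trans_lt h3
  have t3 := hr.aeval_reflect (k + 2) (b ^ 2 - δ)
  have h4 := (t1.add t2).add t3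
  rw [h.equation_inv hθ M hz hδ] at h4
  have h5 := h4.unique (by simpa using CurvePlace.hasValue_const (V := V) 0)
  rcases h.ne_infinity with h6 | h6
  · exact h6 hb
  · exact h6 (by simpa using h5)

end Infinity

/-- For even degree two places lie over infinity, and both are centered at the vertex. -/
theorem odd_natDegree_of_isUnibranchedAt (h : C.IsNormalForm A B b δ) (hQ : Q ≠ 0)
    (hδ : δ = Q ^ 2 * f) (hb : b.coeff (k + 1) = 0) (hu : C.IsUnibranchedAt h.vertex) :
    Odd f.natDegree := by
  by_contra hodd
  rw [Nat.not_odd_iff_even] at hodd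
  obtain ⟨n, hn⟩ := hodd
  rw [← two_mul] at hn
  obtain ⟨θ, w, hθ, M, hz⟩ := h.exists_model hQ hδ
  have M' := M.reverse hn.le
  have hc0 : (reflect (2 * n) f).eval 0 ≠ 0 := by
    rw [Polynomial.eval_zero_reflect, ← hn]
    exact leadingCoeff_ne_zero.2 M.f_ne_zero
  obtain ⟨c, hc⟩ := IsAlgClosed.exists_pow_nat_eq ((reflect (2 * n) f).eval 0) (n := 2)
    (by norm_num)
  obtain ⟨V, hV⟩ := M'.exists_place hc
  obtain ⟨W, hW⟩ := M'.exists_place (t := 0) (c := -c) (by simpa using hc)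
  have := hu.unique ((h.isCenteredAt_vertex_iff_hasValue hθ M hz hδ hb).2 hV.1)
    ((h.isCenteredAt_vertex_iff_hasValue hθ M hz hδ hb).2 hW.1)
  subst this
  have h2 := hV.2.unique hW.2
  apply hc0
  rw [← hc, self_eq_neg.1 h2]
  norm_num

/-! ### Multiplicity sequence at the vertex. -/

section VertexSequence

variable {θ : Fin 3 → C.functionField} {w : C.functionField}

/-- The local parameter `x / z` at the vertex, in terms of `1 / x` and `w / xᵐ`. -/
theorem div_eq_of_infinity (h : C.IsNormalForm A B b δ) (hθ : C.IsChart A θ)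
    (M : QuadraticModel C.functionField (θ 0) w f) (hz : θ 2 = aeval (θ 0) Q * w - aeval (θ 0) b)
    (hδ : δ = Q ^ 2 * f) (hd : b ^ 2 - δ ≠ 0) {m n : ℕ} (hmn : Q.natDegree + m + n = k + 1) :
    θ 0 / θ 2 = (aeval (θ 0)⁻¹ (-reflect (k + 1) b) +
      aeval (θ 0)⁻¹ ((X - Polynomial.C 0) ^ n * -reflect Q.natDegree Q) * (w / θ 0 ^ m)) /
        aeval (θ 0)⁻¹ (reflect (k + 2) (b ^ 2 - δ)) := by
  have h0 := hθ.theta_ne_zero 0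
  have h2 := hθ.theta_ne_zero 2
  have hb' := QuadraticModel.aeval_inv_reflect h0 h.degree_b
  have hd' := QuadraticModel.aeval_inv_reflect h0 h.degree_c
  have hQ' := QuadraticModel.aeval_inv_reflect h0 (le_refl Q.natDegree)
  have hd0 := M.aeval_ne_zero hd
  rw [← hd'] at hd0
  have hd1 := left_ne_zero_of_mul hd0
  have hsq : (aeval (θ 0) Q * w - aeval (θ 0) b) * (aeval (θ 0) Q * w + aeval (θ 0) b) =
      - aeval (θ 0) (b ^ 2 - δ) := by
    rw [hδ]
    simp only [map_sub, map_mul, map_pow]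
    linear_combination (aeval (θ 0) Q) ^ 2 * M.sq
  rw [← hz, ← hb', ← hd', ← hQ'] at hsq
  rw [div_eq_div_iff h2 hd1]
  have h3 : θ 0 ^ (k + 1) ≠ 0 := pow_ne_zero _ h0
  apply mul_right_cancel₀ h3
  rw [C_0, sub_zero]
  simp only [map_neg, map_mul, map_pow, aeval_X]
  have h4 : θ 0 ^ (k + 1) = θ 0 ^ Q.natDegree * θ 0 ^ m * θ 0 ^ n := by
    rw [← hmn, pow_add, pow_add]
  have h5 : (θ 0)⁻¹ ^ n * -aeval (θ 0)⁻¹ (reflect Q.natDegree Q) * (w / θ 0 ^ m) * θ 0 ^ (k + 1) =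
      -aeval (θ 0)⁻¹ (reflect Q.natDegree Q) * θ 0 ^ Q.natDegree * w := by
    rw [h4, inv_pow]
    generalize aeval (θ 0)⁻¹ (reflect Q.natDegree Q) = x
    field_simp
  linear_combination hsq - θ 2 * h5

/-- In terms of `1/x` and `w / x^(m+1)`, the function `x/z` has an even part coming from `b` and an
odd part of exact order `n`. Its order at the unique place over infinity is `k`. The first blow-up
is `oddSubalgebra 0 n`, which contributes the `n` twos. The alternatives in `hcase` belong to the
classes (b) and (c). -/
theorem hasMultSeq_vertex_of_odd (h : C.IsNormalForm A B b δ) (hQ : Q ≠ 0) (hδ : δ = Q ^ 2 * f)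
    (hb : b.coeff (k + 1) = 0) {m n : ℕ} (hf : f.natDegree = 2 * m + 1)
    (hmn : Q.natDegree + (m + 1) + n = k + 1)
    (hcase : k = 2 * n + 1 ∧ 2 * b.natDegree ≤ k + 1 ∨ k ≤ 2 * n ∧ 2 * b.natDegree = k + 2) :
    C.HasMultSeq h.vertex (multSeq (k :: List.replicate n 2)) := by
  obtain ⟨θ, w, hθ, M, hz⟩ := h.exists_model hQ hδ
  have hd2 : (b ^ 2 - δ).coeff (k + 2) ≠ 0 := h.ne_infinity.resolve_left (fun h1 => h1 hb)
  have hd : b ^ 2 - δ ≠ 0 := fun h1 => hd2 (by rw [h1, coeff_zero])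
  have M' := M.reverse (n := m + 1) (by omega)
  have hf0 : (reflect (2 * (m + 1)) f).eval 0 = 0 := by
    rw [Polynomial.eval_zero_reflect]
    exact coeff_eq_zero_of_natDegree_lt (by omega)
  have hf1 := QuadraticModel.reflect_simple_zero (f := f) (n := m) (Or.inl hf) hf0
  have hU := M'.isUniformizerAt_of_root hf0 hf1
  have hu := h.div_eq_of_infinity hθ M hz hδ hd hmn
  have hcen : ∀ V : CurvePlace C.functionField, C.IsCenteredAt V h.vertex ↔
      V.LiesOver (θ 0)⁻¹ (w / θ 0 ^ (m + 1)) 0 0 := fun V =>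
    (h.isCenteredAt_vertex_iff_hasValue hθ M hz hδ hb).trans
      ⟨fun hV => M'.liesOver_of_root hf0 hV, fun hV => hV.1⟩
  constructor
  · obtain ⟨V, hV⟩ := M'.exists_place (t := 0) (c := 0) (by rw [hf0]; simp)
    exact ⟨V, (hcen V).2 hV, fun W hW => hU.place_unique ((hcen W).1 hW) hV⟩
  · intro V hV i
    have hV' := (hcen V).1 hV
    have h0 := hθ.theta_ne_zero 0
    have hO := h.infinitelyNearRing_vertex hθ hV
    set π := w / θ 0 ^ (m + 1) with hπ
    have hπ1 := hU.val_lt_one hV'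
    have hπ0 : 0 < V.ring.valuation π := hU.val_pos
    have hr : V.ring.valuation (θ 0)⁻¹ = V.ring.valuation π ^ 2 := by
      simpa using M'.val_sub_eq_sq hf0 hf1 hV'.1
    -- The odd part has order `2n + 1`, and the even part has order `2(k + 1 - deg b)` if `b ≠ 0`.
    -- In the first case the odd part has the smaller order, in the second the even part, and that
    -- order is `k` each time.
    have hval : V.ring.valuation (θ 0 / θ 2) = V.ring.valuation π ^ k := by
      rw [hu, map_div₀, (hV'.1.aeval_reflect (k + 2) (b ^ 2 - δ)).val_eq_one hd2, div_one]
      have hQ1 : V.ring.valuation (aeval (θ 0)⁻¹ ((X - Polynomial.C 0) ^ n *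
          -reflect Q.natDegree Q) * π) = V.ring.valuation π ^ (2 * n + 1) := by
        have := (hV'.1.aeval_reflect Q.natDegree Q).val_eq_one (leadingCoeff_ne_zero.2 hQ)
        rw [C_0, sub_zero]
        simp only [map_mul, map_pow, map_neg, aeval_X, Valuation.map_neg]
        rw [this, hr, mul_one, ← pow_mul, ← pow_succ]
      have hb1 : aeval (θ 0)⁻¹ (reflect (k + 1) b) =
          (θ 0)⁻¹ ^ (k + 1 - b.natDegree) * aeval (θ 0)⁻¹ (reflect b.natDegree b) := by
        have h1 := QuadraticModel.aeval_inv_reflect h0 h.degree_b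
        have h2 := QuadraticModel.aeval_inv_reflect h0 (le_refl b.natDegree)
        rw [← h2] at h1
        apply mul_right_cancel₀ (pow_ne_zero (k + 1) h0)
        rw [h1]
        have h3 : θ 0 ^ (k + 1) = θ 0 ^ (k + 1 - b.natDegree) * θ 0 ^ b.natDegree := by
          rw [← pow_add, Nat.sub_add_cancel h.degree_b]
        rw [h3, inv_pow]
        generalize aeval (θ 0)⁻¹ (reflect b.natDegree b) = x
        field_simp
      have hb2 : V.ring.valuation (aeval (θ 0)⁻¹ (-reflect (k + 1) b)) =
          V.ring.valuation π ^ (2 * (k + 1 - b.natDegree)) *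
            V.ring.valuation (aeval (θ 0)⁻¹ (reflect b.natDegree b)) := by
        rw [map_neg, Valuation.map_neg, hb1, map_mul, map_pow, hr, ← pow_mul]
      rcases hcase with ⟨h1, h2⟩ | ⟨h1, h2⟩
      · rw [Valuation.map_add_eq_of_lt_right, hQ1, ← h1]
        rw [hb2, hQ1]
        refine (mul_le_of_le_one_right zero_le (hV'.1.aeval_reflect _ _).val_le_one).trans_lt ?_
        exact pow_lt_pow_right_of_lt_one₀ hπ0 hπ1 (by omega)
      · have hb0 : b ≠ 0 := by
          rintro rfl
          simp at h2
        rw [(hV'.1.aeval_reflect _ _).val_eq_one (leadingCoeff_ne_zero.2 hb0), mul_one] at hb2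
        have he : 2 * (k + 1 - b.natDegree) = k := by omega
        rw [he] at hb2
        rw [Valuation.map_add_eq_of_lt_left, hb2]
        rw [hb2, hQ1]
        exact pow_lt_pow_right_of_lt_one₀ hπ0 hπ1 (by omega)
    have hk : k ≠ 0 := by have := h.two_le; omega
    have hu1 : V.ring.valuation (θ 0 / θ 2) < 1 := by
      rw [hval]
      exact pow_lt_one₀ zero_le hπ1 hk
    rcases i with _ | i
    · rw [multSeq_cons_zero, hO]
      exact CurvePlace.branchMultiplicity_localizeAt (hU.mem hV') (hU.maximalIdeal_eq hV')
        hV'.1.mem hu1 hval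
    · rw [multSeq_cons_succ, multSeq_replicate]
      have hO1 : C.infinitelyNearRing h.vertex V 1 = M'.oddSubalgebra 0 n := by
        have hQ0 : (-reflect Q.natDegree Q).eval 0 ≠ 0 := by
          rw [eval_neg, Polynomial.eval_zero_reflect]
          exact neg_ne_zero.2 (leadingCoeff_ne_zero.2 hQ)
        have := M'.blowUp_localizeAt_eq hf0 hV' hQ0
          (by rw [Polynomial.eval_zero_reflect]; exact hd2) hu
          (div_ne_zero h0 (hθ.theta_ne_zero 2)) hu1
        rw [map_zero, sub_zero, ← hO] at this
        exact this
      have := M'.branchMultiplicity_of_oddSubalgebra hf0 hf1 hV' (fun i => rfl) hO1 i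
      rwa [add_comm 1 i] at this

/-- At the two places over infinity `w / x^m` takes the values `± b_{k+1} / lc(Q)`. With the minus
sign, `z` is `x^(k+1)` times a unit, and the place is centered at the vertex. With the plus sign the
leading terms of `Q w - b` cancel and `z/x` stays finite. -/
theorem exists_model_of_even (h : C.IsNormalForm A B b δ) (hQ : Q ≠ 0) (hδ : δ = Q ^ 2 * f)
    (hb : b.coeff (k + 1) ≠ 0) {m : ℕ} (hf : f.natDegree = 2 * m)
    (hmn : Q.natDegree + m = k + 1) :
    ∃ (θ : Fin 3 → C.functionField) (w : C.functionField) (c : ℂ), C.IsChart A θ ∧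
      QuadraticModel C.functionField (θ 0)⁻¹ w (reflect (2 * m) f) ∧ c ≠ 0 ∧
      c ^ 2 = (reflect (2 * m) f).eval 0 ∧ ∀ V : CurvePlace C.functionField,
        (C.IsCenteredAt V h.vertex ↔ V.LiesOver (θ 0)⁻¹ w 0 c) ∧
        (V.LiesOver (θ 0)⁻¹ w 0 c →
          V.ring.valuation (θ 0 / θ 2) = V.ring.valuation (θ 0)⁻¹ ^ k) := by
  obtain ⟨θ, w, hθ, M, hz⟩ := h.exists_model hQ hδ
  have M' := M.reverse (n := m) hf.le
  have h0 := hθ.theta_ne_zero 0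
  have h2 := hθ.theta_ne_zero 2
  have hk : k ≠ 0 := by have := h.two_le; omega
  have hQ0 : Q.leadingCoeff ≠ 0 := leadingCoeff_ne_zero.2 hQ
  -- Since `b² - δ` has degree at most `k + 2 < 2k + 2`, the coefficients of `x^(2k+2)` in `b²` and
  -- `δ` agree.
  have hlc : Q.leadingCoeff ^ 2 * f.leadingCoeff = b.coeff (k + 1) ^ 2 := by
    have h1 : (b ^ 2 - δ).coeff (2 * (k + 1)) = 0 :=
      coeff_eq_zero_of_natDegree_lt (h.degree_c.trans_lt (by omega))
    rw [coeff_sub, sub_eq_zero, pow_two, two_mul,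
      coeff_mul_add_eq_of_natDegree_le h.degree_b h.degree_b, hδ] at h1
    have h2 : (Q ^ 2 * f).natDegree = k + 1 + (k + 1) := by
      rw [natDegree_mul (pow_ne_zero 2 hQ) M.f_ne_zero, natDegree_pow]
      omega
    rw [← leadingCoeff_pow, ← leadingCoeff_mul, leadingCoeff, h2, ← h1, pow_two]
  obtain ⟨hudiv, hprod⟩ := M.reverse_identities hz h2 h.degree_b (hδ ▸ h.degree_c) hmn
  rw [← hδ] at hprod
  obtain ⟨c, hc⟩ : ∃ c, c = -b.coeff (k + 1) / Q.leadingCoeff := ⟨_, rfl⟩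
  have hc0 : c ≠ 0 := hc ▸ div_ne_zero (neg_ne_zero.2 hb) hQ0
  have hc1 : Q.leadingCoeff * c = -b.coeff (k + 1) := by
    rw [hc]
    exact mul_div_cancel₀ _ hQ0
  have hc2 : c ^ 2 = (reflect (2 * m) f).eval 0 := by
    rw [Polynomial.eval_zero_reflect, ← hf, hc, div_pow, neg_sq, ← hlc]
    exact mul_div_cancel_left₀ _ (pow_ne_zero 2 hQ0)
  have h2b : 2 * b.coeff (k + 1) ≠ 0 := mul_ne_zero two_ne_zero hb
  have hplus : ∀ V : CurvePlace C.functionField, V.LiesOver (θ 0)⁻¹ (w / θ 0 ^ m) 0 c →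
      V.HasValue (aeval (θ 0)⁻¹ (reflect Q.natDegree Q) * (w / θ 0 ^ m) -
        aeval (θ 0)⁻¹ (reflect (k + 1) b)) (-(2 * b.coeff (k + 1))) := by
    intro V hV
    have := ((hV.1.aeval_reflect Q.natDegree Q).mul hV.2).sub (hV.1.aeval_reflect (k + 1) b)
    rwa [coeff_natDegree, hc1, ← neg_add', ← two_mul] at this
  refine ⟨θ, _, c, hθ, M', hc0, hc2, fun V => ⟨⟨fun hV => ?_, fun hV => ?_⟩, fun hV => ?_⟩⟩
  · have hr := h.hasValue_inv_of_isCenteredAt hθ M hz hV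
    refine (M'.liesOver_or hc2 hr).resolve_right fun hV' => ?_
    -- At the other place the conjugate factor is a unit, so `hprod` makes `z/x` finite, although
    -- `x/z` has the value `0`.
    have h1 := ((hV'.1.aeval_reflect Q.natDegree Q).mul hV'.2).add
      (hV'.1.aeval_reflect (k + 1) b)
    rw [coeff_natDegree, mul_neg, hc1, neg_neg, ← two_mul] at h1
    have h3 := (hV'.1.aeval_reflect (k + 2) (b ^ 2 - δ)).neg.div h1 h2b
    rw [← hprod, mul_div_cancel_right₀ _ (h1.ne_zero h2b)] at h3
    have h6 := h3.mul ((h.isCenteredAt_vertex_iff hθ).1 hV).1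
    rw [div_mul_div_cancel₀ h0, div_self h2, mul_zero] at h6
    have := h6.unique (by simpa using CurvePlace.hasValue_const (V := V) 1)
    simp at this
  · refine h.isCenteredAt_vertex_of_div hθ hV.1 ?_
    rw [hudiv]
    have := (hV.1.pow k).div (hplus V hV) (neg_ne_zero.2 h2b)
    rwa [zero_pow hk, zero_div] at this
  · rw [hudiv, map_div₀, (hplus V hV).val_eq_one (neg_ne_zero.2 h2b), div_one, map_pow]

/-- Infinity is not a branch point, so `1/x` is a uniformizer and `x/z` has order `k`. The first
blow-up already contains `1/x`, so it is smooth. -/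
theorem hasMultSeq_vertex_of_even (h : C.IsNormalForm A B b δ) (hQ : Q ≠ 0) (hδ : δ = Q ^ 2 * f)
    (hb : b.coeff (k + 1) ≠ 0) {m : ℕ} (hf : f.natDegree = 2 * m)
    (hmn : Q.natDegree + m = k + 1) : C.HasMultSeq h.vertex (multSeq [k]) := by
  obtain ⟨θ, w, c, hθ, M, hc0, hc2, hV⟩ := h.exists_model_of_even hQ hδ hb hf hmn
  have hU := M.isUniformizerAt_of_ne (t := 0) hc0
  rw [map_zero, sub_zero] at hU
  have hk : k ≠ 0 := by have := h.two_le; omega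
  constructor
  · obtain ⟨V, hV'⟩ := M.exists_place hc2
    exact ⟨V, (hV V).1.2 hV', fun W hW => hU.place_unique ((hV W).1.1 hW) hV'⟩
  · intro V hcen i
    have hV' := (hV V).1.1 hcen
    have hval := (hV V).2 hV'
    have hO := h.infinitelyNearRing_vertex hθ hcen
    have hu1 : V.ring.valuation (θ 0 / θ 2) < 1 := by
      rw [hval]
      exact pow_lt_one₀ zero_le (hU.val_lt_one hV') hk
    rcases i with _ | i
    · rw [multSeq_cons_zero, hO]
      exact CurvePlace.branchMultiplicity_localizeAt (hU.mem hV') (hU.maximalIdeal_eq hV')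
        hV'.1.mem hu1 hval
    · have hmem : ∀ i, (θ 0)⁻¹ ∈ C.infinitelyNearRing h.vertex V (i + 1) := by
        intro i
        induction i with
        | zero =>
          rw [infinitelyNearRing, hO]
          exact CurvePlace.mem_blowUp_localizeAt hV'.1.mem
            (div_ne_zero (hθ.theta_ne_zero 0) (hθ.theta_ne_zero 2)) hu1
        | succ i ih => exact CurvePlace.le_blowUp _ _ ih
      exact hU.branchMultiplicity_one hV' (hmem i)

end VertexSequence

end IsNormalForm

end PlaneCurve

end NormalFormBranches


/-! ### Irreducibility -/

section Irreducibility

open MvPolynomial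

/-- Polynomials in `x, y, z` as polynomials in `z` over `ℂ[x, y]`. -/
noncomputable def lastVarEquiv :
    MvPolynomial (Fin 3) ℂ ≃ₐ[ℂ] Polynomial (MvPolynomial (Fin 2) ℂ) :=
  (renameEquiv ℂ (finSuccEquivLast (n := 2))).trans (optionEquivLeft ℂ (Fin 2))

theorem lastVarEquiv_X_two : lastVarEquiv (X 2) = Polynomial.X := by
  change optionEquivLeft ℂ (Fin 2) (rename finSuccEquivLast (X (Fin.last 2))) = _
  rw [rename_X, finSuccEquivLast_last, optionEquivLeft_X_none]

theorem lastVarEquiv_rename (p : MvPolynomial (Fin 2) ℂ) :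
    lastVarEquiv (rename Fin.castSucc p) = Polynomial.C p := by
  change optionEquivLeft ℂ (Fin 2) (rename finSuccEquivLast (rename Fin.castSucc p)) = _
  rw [rename_rename]
  have : (finSuccEquivLast ∘ Fin.castSucc : Fin 2 → Option (Fin 2)) = some := by
    funext i
    simp
  rw [this]
  induction p using MvPolynomial.induction_on with
  | C a => simp [optionEquivLeft_C]
  | add p q hp hq => simp only [map_add, hp, hq]
  | mul_X p i hp => simp only [map_mul, hp, rename_X, optionEquivLeft_X_some]

theorem lastVarEquiv_quadForm (k : ℕ) (a b c : Polynomial ℂ) :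
    lastVarEquiv (quadForm k a b c) = Polynomial.C (a.homogenize k) * Polynomial.X ^ 2 +
      Polynomial.C (2 * b.homogenize (k + 1)) * Polynomial.X +
      Polynomial.C (c.homogenize (k + 2)) := by
  simp only [quadForm, binaryForm, map_add, map_mul, map_pow, lastVarEquiv_X_two,
    lastVarEquiv_rename, map_ofNat]

theorem homogenize_one_eq (k : ℕ) : (1 : Polynomial ℂ).homogenize k = X 1 ^ k := by
  simp

theorem not_X_dvd_homogenize {N : ℕ} {p : Polynomial ℂ} (h : p.coeff N ≠ 0) :
    ¬ (X 1 : MvPolynomial (Fin 2) ℂ) ∣ p.homogenize N := by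
  rintro ⟨q, hq⟩
  apply h
  have h1 := aeval_binaryForm_of_eq_zero (θ := (![1, 0, 0] : Fin 3 → ℂ)) rfl N p
  rw [binaryForm, hq, map_mul, rename_X, map_mul, aeval_X] at h1
  simpa using h1.symm

theorem Polynomial.coeff_quadratic {R : Type*} [CommRing R] (a b c : R) :
    (Polynomial.C a * Polynomial.X ^ 2 + Polynomial.C b * Polynomial.X + Polynomial.C c).coeff 2 =
      a ∧
    (Polynomial.C a * Polynomial.X ^ 2 + Polynomial.C b * Polynomial.X + Polynomial.C c).coeff 1 =
      b ∧
    (Polynomial.C a * Polynomial.X ^ 2 + Polynomial.C b * Polynomial.X + Polynomial.C c).coeff 0 =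
      c := by
  simp [Polynomial.coeff_X, Polynomial.coeff_C]

/-- Viewed as a quadratic polynomial in `z` over `ℂ[x, y]`, the form is primitive because `y` does
not divide it. Two factors linear in `z` would make its discriminant, hence `δ`, a square. -/
theorem irreducible_quadForm {k : ℕ} {b δ : Polynomial ℂ} (hb : b.natDegree ≤ k + 1)
    (hd : (b ^ 2 - δ).natDegree ≤ k + 2)
    (hinf : b.coeff (k + 1) ≠ 0 ∨ (b ^ 2 - δ).coeff (k + 2) ≠ 0) (hsq : ¬ IsSquare δ) :
    Irreducible (quadForm k 1 b (b ^ 2 - δ)) := by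
  rw [← MulEquiv.irreducible_iff lastVarEquiv, lastVarEquiv_quadForm, homogenize_one_eq]
  have hX : Prime (X 1 : MvPolynomial (Fin 2) ℂ) := X_prime
  set F : Polynomial (MvPolynomial (Fin 2) ℂ) := Polynomial.C (X 1 ^ k) * Polynomial.X ^ 2 +
      Polynomial.C (2 * b.homogenize (k + 1)) * Polynomial.X +
      Polynomial.C ((b ^ 2 - δ).homogenize (k + 2)) with hF
  have hdeg : F.natDegree = 2 := Polynomial.natDegree_quadratic (pow_ne_zero k hX.ne_zero)
  have hF0 : F ≠ 0 := fun h => by simp [h] at hdeg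
  obtain ⟨c2, c1, c0⟩ := Polynomial.coeff_quadratic (X 1 ^ k) (2 * b.homogenize (k + 1))
    ((b ^ 2 - δ).homogenize (k + 2))
  rw [← hF] at c2 c1 c0
  have h2u : IsUnit (2 : MvPolynomial (Fin 2) ℂ) := by
    have := (IsUnit.mk0 (2 : ℂ) two_ne_zero).map (C : ℂ →+* MvPolynomial (Fin 2) ℂ)
    rwa [map_ofNat] at this
  -- A factor free of `z` divides the leading coefficient `y^k`, so it is a power of `y` up to a
  -- unit; `hinf` excludes a positive power.
  have hunit : ∀ p q, F = p * q → p.natDegree = 0 → IsUnit p := by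
    intro p q hpq hp
    rw [Polynomial.eq_C_of_natDegree_eq_zero hp] at hpq ⊢
    set r := p.coeff 0
    have hr : ∀ i, r ∣ F.coeff i := fun i => ⟨q.coeff i, by rw [hpq, Polynomial.coeff_C_mul]⟩
    obtain ⟨i, -, hi⟩ := (dvd_prime_pow hX k).1 (c2 ▸ hr 2)
    rcases Nat.eq_zero_or_pos i with rfl | hi0
    · rw [pow_zero] at hi
      exact (associated_one_iff_isUnit.1 hi).map Polynomial.C
    · exfalso
      have hXr : X 1 ∣ r := (dvd_pow_self _ hi0.ne').trans hi.symm.dvd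
      rcases hinf with h | h
      · have := hXr.trans (c1 ▸ hr 1)
        rw [h2u.dvd_mul_left] at this
        exact not_X_dvd_homogenize h this
      · exact not_X_dvd_homogenize h (hXr.trans (c0 ▸ hr 0))
  refine ⟨fun hu => ?_, fun p q hpq => ?_⟩
  · have := Polynomial.natDegree_eq_zero_of_isUnit hu
    omega
  · have hp0 : p ≠ 0 := fun h => hF0 (by rw [hpq, h, zero_mul])
    have hq0 : q ≠ 0 := fun h => hF0 (by rw [hpq, h, mul_zero])
    have hsum : p.natDegree + q.natDegree = 2 := by
      rw [← Polynomial.natDegree_mul hp0 hq0, ← hpq, hdeg]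
    by_cases hp : p.natDegree = 0
    · exact Or.inl (hunit p q hpq hp)
    by_cases hq : q.natDegree = 0
    · exact Or.inr (hunit q p (by rw [hpq, mul_comm]) hq)
    exfalso
    obtain ⟨p1, p0, hp'⟩ := Polynomial.exists_eq_X_add_C_of_natDegree_le_one
      (show p.natDegree ≤ 1 by omega)
    obtain ⟨q1, q0, hq'⟩ := Polynomial.exists_eq_X_add_C_of_natDegree_le_one
      (show q.natDegree ≤ 1 by omega)
    have e : F = Polynomial.C (p1 * q1) * Polynomial.X ^ 2 +
        Polynomial.C (p1 * q0 + p0 * q1) * Polynomial.X + Polynomial.C (p0 * q0) := by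
      rw [hpq, hp', hq']
      simp only [map_mul, map_add]
      ring
    obtain ⟨e2, e1, e0⟩ := Polynomial.coeff_quadratic (p1 * q1) (p1 * q0 + p0 * q1) (p0 * q0)
    rw [← e, c2] at e2
    rw [← e, c1] at e1
    rw [← e, c0] at e0
    have hev : ∀ (N : ℕ) (r : Polynomial ℂ), r.natDegree ≤ N →
        aeval ![Polynomial.X, (1 : Polynomial ℂ)] (r.homogenize N) = r := by
      intro N r hr
      rw [Polynomial.aeval_homogenize_of_eq_one hr _ (by simp)]
      simp
    have d2 := congrArg (aeval ![Polynomial.X, (1 : Polynomial ℂ)]) e2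
    have d1 := congrArg (aeval ![Polynomial.X, (1 : Polynomial ℂ)]) e1
    have d0 := congrArg (aeval ![Polynomial.X, (1 : Polynomial ℂ)]) e0
    rw [map_pow, aeval_X] at d2
    simp only [map_mul, map_add, map_ofNat, hev _ _ hb, Matrix.cons_val, one_pow] at d2 d1
    rw [hev _ _ hd, map_mul] at d0
    generalize aeval ![Polynomial.X, (1 : Polynomial ℂ)] p0 = P0 at *
    generalize aeval ![Polynomial.X, (1 : Polynomial ℂ)] p1 = P1 at *
    generalize aeval ![Polynomial.X, (1 : Polynomial ℂ)] q0 = Q0 at *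
    generalize aeval ![Polynomial.X, (1 : Polynomial ℂ)] q1 = Q1 at *
    apply hsq
    have hC : (Polynomial.C (1 / 2 : ℂ)) * 2 = 1 := by
      have : (2 : Polynomial ℂ) = Polynomial.C 2 := (map_ofNat Polynomial.C 2).symm
      rw [this, ← map_mul]
      norm_num
    refine ⟨Polynomial.C (1 / 2) * (P1 * Q0 - P0 * Q1), ?_⟩
    -- The discriminant of a product of two linear polynomials, in the chart `y = 1` where `P1 * Q1
    -- = 1`.
    have h4 : 4 * δ = (P1 * Q0 - P0 * Q1) ^ 2 := by
      linear_combination -(4 : Polynomial ℂ) * d0 + (2 * b + P1 * Q0 + P0 * Q1) * d1 -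
        4 * P0 * Q0 * d2
    linear_combination -(1 + 2 * Polynomial.C (1 / 2 : ℂ)) * δ * hC +
      (Polynomial.C (1 / 2 : ℂ)) ^ 2 * h4

theorem isHomogeneous_linSubst {P : MvPolynomial (Fin 3) ℂ} {n : ℕ} (hP : P.IsHomogeneous n)
    (A : Matrix (Fin 3) (Fin 3) ℂ) : (linSubst A P).IsHomogeneous n := by
  have h := hP.aeval (fun i => ∑ j, C (A i j) * X j : Fin 3 → MvPolynomial (Fin 3) ℂ) (n := 1)
    fun i => IsHomogeneous.sum _ _ _ fun j _ => by
      simpa using (isHomogeneous_C (Fin 3) (A i j)).mul (isHomogeneous_X ℂ j)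
  rwa [one_mul] at h

/-- An invertible linear change of variables. -/
noncomputable def linSubstEquiv {A B : Matrix (Fin 3) (Fin 3) ℂ} (h : B * A = 1) :
    MvPolynomial (Fin 3) ℂ ≃* MvPolynomial (Fin 3) ℂ where
  toFun := linSubst A
  invFun := linSubst B
  left_inv P := by rw [linSubst_linSubst, mul_eq_one_comm.1 h, linSubst_one]
  right_inv P := by rw [linSubst_linSubst, h, linSubst_one]
  map_mul' := map_mul _

/-- The curves with an equation in normal form. -/
theorem exists_planeCurve_isNormalForm {k : ℕ} (hk : 2 ≤ k) {A B : Matrix (Fin 3) (Fin 3) ℂ}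
    (hBA : B * A = 1) {P : MvPolynomial (Fin 3) ℂ} {u : ℂ} (hu : u ≠ 0) {b δ : Polynomial ℂ}
    (hE : linSubst A P = C u * quadForm k 1 b (b ^ 2 - δ)) (hb : b.natDegree ≤ k + 1)
    (hd : (b ^ 2 - δ).natDegree ≤ k + 2)
    (hinf : b.coeff (k + 1) ≠ 0 ∨ (b ^ 2 - δ).coeff (k + 2) ≠ 0) (hsq : ¬ IsSquare δ) :
    ∃ Γ : PlaneCurve (k + 2), Γ.poly = P ∧ Γ.IsNormalForm A B b δ := by
  have hirr : Irreducible P := by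
    rw [← MulEquiv.irreducible_iff (linSubstEquiv hBA)]
    change Irreducible (linSubst A P)
    rw [hE, irreducible_isUnit_mul ((IsUnit.mk0 u hu).map C)]
    exact irreducible_quadForm hb hd hinf hsq
  have hhom : P.IsHomogeneous (k + 2) := by
    have h1 : P = linSubst B (linSubst A P) := ((linSubstEquiv hBA).left_inv P).symm
    rw [h1, hE]
    refine isHomogeneous_linSubst ?_ B
    simpa using (isHomogeneous_C (Fin 3) u).mul (isHomogeneous_quadForm k 1 b (b ^ 2 - δ))
  exact ⟨⟨P, hhom, hirr⟩, rfl, hk, hBA, ⟨u, hu, hE⟩, hb, hd, hinf⟩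

end Irreducibility


/-! ### The equations of the families in normal form -/

section RootProduct

open Polynomial

/-- `∏ᵢ (x - λᵢ)^{βᵢ}`. -/
noncomputable def rootProduct {N : ℕ} (lam : Fin N → ℂ) (β : Fin N → ℕ) : ℂ[X] :=
  ∏ i, (X - C (lam i)) ^ β i

/-- The exponents `b₁, …, bₙ, 0, …, 0`. -/
def extendMult {n : ℕ} (b : Fin n → ℕ) (N : ℕ) : Fin N → ℕ :=
  fun i => if h : (i : ℕ) < n then b ⟨i, h⟩ else 0

theorem sum_extendMult {n N : ℕ} (b : Fin n → ℕ) (h : n ≤ N) :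
    ∑ i, extendMult b N i = ∑ i, b i := by
  obtain ⟨m, rfl⟩ := Nat.exists_eq_add_of_le h
  rw [Fin.sum_univ_add]
  simp [extendMult]

theorem extendMult_castLE {n N : ℕ} (b : Fin n → ℕ) (h : n ≤ N) (i : Fin n) :
    extendMult b N (Fin.castLE h i) = b i := by
  simp [extendMult]

theorem exists_castLE_of_extendMult_ne {n N : ℕ} (b : Fin n → ℕ) (h : n ≤ N) {i : Fin N}
    (hi : extendMult b N i ≠ 0) : ∃ j : Fin n, i = Fin.castLE h j := by
  rw [extendMult] at hi
  split_ifs at hi with h1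
  · exact ⟨⟨i, h1⟩, rfl⟩
  · exact absurd rfl hi

variable {N : ℕ} {lam : Fin N → ℂ}

theorem monic_rootProduct (lam : Fin N → ℂ) (β : Fin N → ℕ) : (rootProduct lam β).Monic :=
  monic_prod_of_monic _ _ fun _ _ => (monic_X_sub_C _).pow _

theorem natDegree_rootProduct (lam : Fin N → ℂ) (β : Fin N → ℕ) :
    (rootProduct lam β).natDegree = ∑ i, β i := by
  rw [rootProduct, natDegree_prod_of_monic _ _ fun i _ => (monic_X_sub_C _).pow _]
  simp

theorem exists_of_eval_rootProduct {β : Fin N → ℕ} {t : ℂ} (h : (rootProduct lam β).eval t = 0) :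
    ∃ i, β i ≠ 0 ∧ t = lam i := by
  rw [rootProduct, eval_prod, Finset.prod_eq_zero_iff] at h
  obtain ⟨i, -, hi⟩ := h
  rw [eval_pow, eval_sub, eval_X, eval_C] at hi
  refine ⟨i, fun h0 => by simp [h0] at hi, sub_eq_zero.1 (eq_zero_of_pow_eq_zero hi)⟩

theorem rootProduct_factor (hlam : Function.Injective lam) (β : Fin N → ℕ) (i : Fin N) :
    ∃ g : ℂ[X], rootProduct lam β = (X - C (lam i)) ^ β i * g ∧ g.eval (lam i) ≠ 0 := by
  classical
  refine ⟨∏ j ∈ Finset.univ.erase i, (X - C (lam j)) ^ β j,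
    (Finset.mul_prod_erase _ _ (Finset.mem_univ i)).symm, ?_⟩
  rw [eval_prod, Finset.prod_ne_zero_iff]
  intro j hj
  rw [eval_pow, eval_sub, eval_X, eval_C]
  exact pow_ne_zero _ (sub_ne_zero.2 fun h => (Finset.mem_erase.1 hj).1 (hlam h).symm)

theorem rootMultiplicity_rootProduct (hlam : Function.Injective lam) (β : Fin N → ℕ) (i : Fin N) :
    (rootProduct lam β).rootMultiplicity (lam i) = β i := by
  obtain ⟨g, hg, hg0⟩ := rootProduct_factor hlam β i
  have hg1 : g ≠ 0 := fun h => by simp [h] at hg0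
  rw [hg, mul_comm, rootMultiplicity_mul_X_sub_C_pow hg1, rootMultiplicity_eq_zero hg0, zero_add]

theorem derivative_rootProduct_one_ne (hlam : Function.Injective lam) {t : ℂ}
    (h : (rootProduct lam fun _ => 1).eval t = 0) :
    (rootProduct lam fun _ => 1).derivative.eval t ≠ 0 := by
  obtain ⟨i, -, rfl⟩ := exists_of_eval_rootProduct h
  obtain ⟨g, hg, hg0⟩ := rootProduct_factor hlam (fun _ => 1) i
  rw [hg]
  simpa using hg0

theorem rootProduct_odd (lam : Fin N → ℂ) (β : Fin N → ℕ) :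
    rootProduct lam (fun i => 2 * β i + 1) =
      rootProduct lam β ^ 2 * rootProduct lam fun _ => 1 := by
  rw [rootProduct, rootProduct, rootProduct, ← Finset.prod_pow, ← Finset.prod_mul_distrib]
  refine Finset.prod_congr rfl fun i _ => ?_
  ring

theorem not_isSquare_rootProduct (hlam : Function.Injective lam) (β : Fin N → ℕ) (hN : 0 < N) :
    ¬ IsSquare (rootProduct lam fun i => 2 * β i + 1) := by
  rintro ⟨g, hg⟩
  have h1 := rootMultiplicity_rootProduct hlam (fun i => 2 * β i + 1) ⟨0, hN⟩
  have h0 := (monic_rootProduct lam fun i => 2 * β i + 1).ne_zero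
  rw [hg] at h1 h0
  rw [rootMultiplicity_mul h0] at h1
  omega

theorem sq_dvd_rootProduct_odd_iff (hlam : Function.Injective lam) (β : Fin N → ℕ) (t : ℂ) :
    (X - C t) ^ 2 ∣ rootProduct lam (fun i => 2 * β i + 1) ↔ ∃ i, β i ≠ 0 ∧ t = lam i := by
  rw [← le_rootMultiplicity_iff (monic_rootProduct _ _).ne_zero]
  constructor
  · intro h
    have h0 : (rootProduct lam fun i => 2 * β i + 1).eval t = 0 := by
      by_contra h1
      rw [rootMultiplicity_eq_zero h1] at h
      omega
    obtain ⟨i, -, rfl⟩ := exists_of_eval_rootProduct h0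
    rw [rootMultiplicity_rootProduct hlam] at h
    exact ⟨i, by omega, rfl⟩
  · rintro ⟨i, hi, rfl⟩
    rw [rootMultiplicity_rootProduct hlam]
    omega

theorem binaryForm_X_sub_C_pow (t : ℂ) (n : ℕ) :
    binaryForm n ((X - C t) ^ n) =
      (MvPolynomial.X 0 - MvPolynomial.C t * MvPolynomial.X 1) ^ n := by
  induction n with
  | zero => simpa using binaryForm_one 0
  | succ n ih =>
    rw [pow_succ, pow_succ, binaryForm_mul (by simp) (by simp), ih, binaryForm_X_sub_C]

theorem binaryForm_rootProduct (lam : Fin N → ℂ) (β : Fin N → ℕ) :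
    binaryForm (∑ i, β i) (rootProduct lam β) =
      ∏ i, (MvPolynomial.X 0 - MvPolynomial.C (lam i) * MvPolynomial.X 1) ^ β i := by
  rw [rootProduct]
  classical
  induction (Finset.univ : Finset (Fin N)) using Finset.induction_on with
  | empty => simpa using binaryForm_one 0
  | insert i s hi ih =>
    rw [Finset.prod_insert hi, Finset.sum_insert hi, Finset.prod_insert hi, ← ih,
      ← binaryForm_X_sub_C_pow, binaryForm_mul (by simp)]
    rw [natDegree_prod_of_monic _ _ fun i _ => (monic_X_sub_C _).pow _]
    simp

theorem oddProduct_eq {n : ℕ} (b : Fin n → ℕ) (hn : n ≤ N) (lam : Fin N → ℂ) {M : ℕ}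
    (hM : M = N + 2 * ∑ i, b i) :
    oddProduct b lam = binaryForm M (rootProduct lam fun i => 2 * extendMult b N i + 1) := by
  have h1 : M = ∑ i, (2 * extendMult b N i + 1) := by
    rw [Finset.sum_add_distrib, ← Finset.mul_sum, sum_extendMult b hn, hM]
    simp [add_comm]
  rw [h1, binaryForm_rootProduct, oddProduct]
  refine Finset.prod_congr rfl fun i _ => ?_
  congr 1
  rw [extendMult]
  split_ifs <;> rfl

theorem natDegree_rootProduct_odd {n : ℕ} (b : Fin n → ℕ) (hn : n ≤ N) (lam : Fin N → ℂ) :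
    (rootProduct lam fun i => 2 * extendMult b N i + 1).natDegree = N + 2 * ∑ i, b i := by
  rw [natDegree_rootProduct, Finset.sum_add_distrib, ← Finset.mul_sum, sum_extendMult b hn]
  simp [add_comm]

/-- `G(x, 1)`. -/
noncomputable def gBase (k : ℕ) (c : ℕ → ℂ) : ℂ[X] :=
  ∑ h ∈ Finset.range (k + 2), C (c h) * X ^ (k + 1 - h)

theorem natDegree_gBase_le (k : ℕ) (c : ℕ → ℂ) : (gBase k c).natDegree ≤ k + 1 :=
  natDegree_sum_le_of_forall_le _ _ fun _ _ =>
    (natDegree_C_mul_X_pow_le _ _).trans (Nat.sub_le _ _)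

theorem coeff_gBase (k : ℕ) (c : ℕ → ℂ) {j : ℕ} (hj : j ≤ k + 1) :
    (gBase k c).coeff j = c (k + 1 - j) := by
  rw [gBase, finsetSum_coeff, Finset.sum_eq_single_of_mem (k + 1 - j) (by simp; omega)]
  · rw [coeff_C_mul_X_pow, if_pos (by omega)]
  · intro i hi hij
    rw [Finset.mem_range] at hi
    rw [coeff_C_mul_X_pow, if_neg (by omega)]

theorem gBase_coeff {k : ℕ} {b : ℂ[X]} (hb : b.natDegree ≤ k + 1) :
    gBase k (fun h => b.coeff (k + 1 - h)) = b := by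
  ext j
  by_cases hj : j ≤ k + 1
  · rw [coeff_gBase _ _ hj, Nat.sub_sub_self hj]
  · rw [coeff_eq_zero_of_natDegree_lt ((natDegree_gBase_le _ _).trans_lt (not_le.1 hj)),
      coeff_eq_zero_of_natDegree_lt (hb.trans_lt (not_le.1 hj))]

theorem gPoly_eq (k : ℕ) (c : ℕ → ℂ) : gPoly k c = binaryForm (k + 1) (gBase k c) := by
  have hsum : ∀ s : Finset ℕ, binaryForm (k + 1) (∑ h ∈ s, C (c h) * X ^ (k + 1 - h)) =
      ∑ h ∈ s, binaryForm (k + 1) (C (c h) * X ^ (k + 1 - h)) := by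
    intro s
    induction s using Finset.induction_on with
    | empty => simp [binaryForm]
    | insert i s hi ih => rw [Finset.sum_insert hi, Finset.sum_insert hi, binaryForm_add, ih]
  rw [gPoly, gBase, hsum]
  refine Finset.sum_congr rfl fun h hh => ?_
  rw [Finset.mem_range] at hh
  have h1 := binaryForm_X_sub_C_pow 0 (k + 1 - h)
  rw [C_0, sub_zero, map_zero, zero_mul, sub_zero] at h1
  have h2 := binaryForm_mul (M := k + 1 - h) (N := h) (p := X ^ (k + 1 - h)) (q := 1) (by simp)
    (by simp)
  rw [mul_one, Nat.sub_add_cancel (by omega), h1, binaryForm_one] at h2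
  rw [binaryForm_C_mul, h2, mul_assoc]

theorem binaryForm_add_left {N : ℕ} (M : ℕ) {p : ℂ[X]} (hp : p.natDegree ≤ N) :
    binaryForm (M + N) p = MvPolynomial.X 1 ^ M * binaryForm N p := by
  have := binaryForm_mul (M := M) (p := 1) (by simp) hp
  rwa [one_mul, binaryForm_one] at this

theorem dehom_binaryForm {N : ℕ} {p : ℂ[X]} (hp : p.natDegree ≤ N) :
    dehom (binaryForm N p) = reflect N p := by
  rw [dehom, binaryForm, MvPolynomial.aeval_rename]
  rw [Polynomial.homogenize, map_sum]
  refine (Finset.sum_congr rfl (g := fun i => C (p.coeff i.1) * X ^ i.2) fun i _ => ?_).trans ?_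
  · rw [MvPolynomial.aeval_monomial, Finsupp.prod_fintype _ _ (fun _ => pow_zero _)]
    simp [Fin.prod_univ_two, algebraMap_eq]
  ext d
  rw [finsetSum_coeff, coeff_reflect]
  by_cases hd : d ≤ N
  · rw [Finset.sum_eq_single_of_mem (N - d, d) (by simp; omega), revAt_le hd]
    · simp
    · rintro ⟨i, j⟩ hij hne
      rw [Finset.HasAntidiagonal.mem_antidiagonal] at hij
      rw [coeff_C_mul_X_pow, if_neg]
      rintro rfl
      simp only at hij
      exact hne (by rw [← hij, Nat.add_sub_cancel])
  · rw [revAt_eq_self_of_lt (not_le.1 hd),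
      coeff_eq_zero_of_natDegree_lt (hp.trans_lt (not_le.1 hd))]
    refine Finset.sum_eq_zero fun i hi => ?_
    rw [Finset.HasAntidiagonal.mem_antidiagonal] at hi
    rw [coeff_C_mul_X_pow, if_neg (by omega)]

end RootProduct

/-! ### The equations (a), (b), (c) as normal forms. -/

section Families

open Polynomial

/-- The discriminant of a curve of one of the families. -/
noncomputable def discPoly {n N : ℕ} (b : Fin n → ℕ) (lam : Fin N → ℂ) : ℂ[X] :=
  rootProduct lam fun i => 2 * extendMult b N i + 1

variable {n N k : ℕ} {b : Fin n → ℕ} {lam : Fin N → ℂ} {c : ℕ → ℂ}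

theorem gPoly_sq_sub_oddProduct (hn : n ≤ N) (hN : 2 * k + 2 = N + 2 * ∑ i, b i) :
    gPoly k c ^ 2 - oddProduct b lam = binaryForm (2 * k + 2) (gBase k c ^ 2 - discPoly b lam) := by
  have h : k + 1 + (k + 1) = 2 * k + 2 := by ring
  rw [oddProduct_eq b hn lam hN, gPoly_eq, binaryForm_sub, pow_two, pow_two,
    ← binaryForm_mul (natDegree_gBase_le _ _) (natDegree_gBase_le _ _), h]
  rfl

theorem natDegree_gBase_sq_sub_le (hn : n ≤ N) (hN : 2 * k + 2 = N + 2 * ∑ i, b i) :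
    (gBase k c ^ 2 - discPoly b lam).natDegree ≤ 2 * k + 2 := by
  refine (natDegree_sub_le _ _).trans (max_le ?_ ?_)
  · have := natDegree_gBase_le k c
    exact natDegree_pow_le.trans (by omega)
  · rw [discPoly, natDegree_rootProduct_odd b hn, hN]

/-- Passing from `P(1, y)` to `P(x, 1)` reverses the coefficients, so divisibility by `y^k` becomes
a bound on the degree in `x`. -/
theorem divCond_iff (hn : n ≤ N) (hN : 2 * k + 2 = N + 2 * ∑ i, b i) :
    DivCond k b lam c ↔ (gBase k c ^ 2 - discPoly b lam).natDegree ≤ k + 2 := by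
  have hd := natDegree_gBase_sq_sub_le (c := c) (lam := lam) hn hN
  have h1 : dehom (gPoly k c) ^ 2 - dehom (oddProduct b lam) =
      reflect (2 * k + 2) (gBase k c ^ 2 - discPoly b lam) := by
    rw [← dehom_binaryForm hd, ← gPoly_sq_sub_oddProduct hn hN]
    simp [dehom]
  rw [DivCond, h1, X_pow_dvd_iff, natDegree_le_iff_coeff_eq_zero]
  constructor
  · intro h j hj
    by_cases hj2 : j ≤ 2 * k + 2
    · have := h (2 * k + 2 - j) (by omega)
      rwa [coeff_reflect, revAt_le (by omega), Nat.sub_sub_self hj2] at this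
    · exact coeff_eq_zero_of_natDegree_lt (by omega)
  · intro h j hj
    rw [coeff_reflect, revAt_le (by omega)]
    exact h _ (by omega)

theorem X_pow_mul_hPoly (hn : n ≤ N) (hN : 2 * k + 2 = N + 2 * ∑ i, b i)
    (hd : (gBase k c ^ 2 - discPoly b lam).natDegree ≤ k + 2) :
    hPoly k b lam c = binaryForm (k + 2) (gBase k c ^ 2 - discPoly b lam) ∧
      MvPolynomial.X 1 ^ k * hPoly k b lam c = gPoly k c ^ 2 - oddProduct b lam := by
  have h1 : gPoly k c ^ 2 - oddProduct b lam =
      MvPolynomial.X 1 ^ k * binaryForm (k + 2) (gBase k c ^ 2 - discPoly b lam) := by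
    rw [gPoly_sq_sub_oddProduct hn hN, ← binaryForm_add_left _ hd]
    congr 1
    ring
  have h2 : hPoly k b lam c = binaryForm (k + 2) (gBase k c ^ 2 - discPoly b lam) := by
    rw [hPoly, h1, MvPolynomial.X_pow_eq_monomial, MvPolynomial.divMonomial_monomial_mul]
  exact ⟨h2, by rw [h2, h1]⟩

theorem eqnA_eq (hn : n ≤ N) (hN : 2 * k + 2 = N + 2 * ∑ i, b i)
    (hd : (gBase k c ^ 2 - discPoly b lam).natDegree ≤ k + 2) :
    eqnA k b lam c = quadForm k 1 (gBase k c) (gBase k c ^ 2 - discPoly b lam) := by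
  rw [eqnA, quadForm, (X_pow_mul_hPoly hn hN hd).1, gPoly_eq, binaryForm_one]

/-- Expanding the square, the coefficient of `z` is `2 y^(k+1) G`: here `b = G(x, 1)` has degree at
most `k + 1` where `2k + 2` would be allowed. -/
theorem eqnB_eq (hn : n ≤ N) (hN : 2 * k + 3 = N + 2 * ∑ i, b i) :
    eqnB k b lam c = quadForm (2 * k + 1) 1 (gBase k c) (gBase k c ^ 2 - discPoly b lam) := by
  have hb := natDegree_gBase_le k c
  have h1 : binaryForm (2 * k + 1 + 1) (gBase k c) = MvPolynomial.X 1 ^ (k + 1) * gPoly k c := by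
    rw [gPoly_eq, ← binaryForm_add_left _ hb]
    congr 1
    ring
  have h2 : binaryForm (2 * k + 1 + 2) (gBase k c ^ 2) = MvPolynomial.X 1 * gPoly k c ^ 2 := by
    rw [gPoly_eq, pow_two, pow_two, ← binaryForm_mul hb hb, ← pow_one (MvPolynomial.X 1),
      ← binaryForm_add_left]
    · congr 1
      ring
    · exact natDegree_mul_le_of_le hb hb
  rw [eqnB, quadForm, binaryForm_one, binaryForm_sub, h1, h2, oddProduct_eq b hn lam hN, discPoly]
  ring

/-- The factor `y^(2j+1)` records by how much `deg δ` falls short of `2k + 2`; it disappears at `y =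
1`. -/
theorem eqnC_eq {j : ℕ} (hn : n ≤ N) (hN : 2 * k + 1 = N + 2 * j + 2 * ∑ i, b i) :
    eqnC k j b lam c = quadForm (2 * k) 1 (gBase k c) (gBase k c ^ 2 - discPoly b lam) := by
  have hb := natDegree_gBase_le k c
  have h1 : binaryForm (2 * k + 1) (gBase k c) = MvPolynomial.X 1 ^ k * gPoly k c := by
    rw [gPoly_eq, ← binaryForm_add_left _ hb]
    congr 1
    ring
  have h2 : binaryForm (2 * k + 2) (gBase k c ^ 2) = gPoly k c ^ 2 := by
    rw [gPoly_eq, pow_two, pow_two, ← binaryForm_mul hb hb]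
    congr 1
    ring
  have h3 : binaryForm (2 * k + 2) (discPoly b lam) =
      MvPolynomial.X 1 ^ (2 * j + 1) * oddProduct b lam := by
    rw [oddProduct_eq b hn lam rfl, ← binaryForm_add_left, discPoly]
    · congr 1
      omega
    · rw [natDegree_rootProduct_odd b hn]
  rw [eqnC, quadForm, binaryForm_one, binaryForm_sub, h1, h2, h3]
  ring

end Families

/-! ### Singular points and `Data` of a curve in normal form. -/

section Cusps

open Polynomial

theorem PlaneCurve.hasData_cuspData_iff {d : ℕ} (C : PlaneCurve d) (l : List ℕ) {n : ℕ}
    (b : Fin n → ℕ) : C.HasData (cuspData l b) ↔ ∃ e : Fin (n + 1) ≃ C.singularPoints,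
      C.HasMultSeq (e 0 : ℙ ℂ (Fin 3 → ℂ)) (multSeq l) ∧
      ∀ i : Fin n, C.HasMultSeq (e i.succ : ℙ ℂ (Fin 3 → ℂ)) (multSeq (List.replicate (b i) 2)) := by
  have hlen : n + 1 = (cuspData l b).length := by simp [cuspData]
  have h0 : (cuspData l b).get (finCongr hlen 0) = multSeq l := rfl
  have hs : ∀ i : Fin n, (cuspData l b).get (finCongr hlen i.succ) =
      multSeq (List.replicate (b i) 2) := by
    intro i
    change (List.ofFn fun i => multSeq (List.replicate (b i) 2))[(i : ℕ)]'(by simp) = _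
    rw [List.getElem_ofFn]
  constructor
  · rintro ⟨e, he⟩
    refine ⟨(finCongr hlen).trans e, ?_, fun i => ?_⟩
    · have := he (finCongr hlen 0)
      rwa [h0] at this
    · have := he (finCongr hlen i.succ)
      rwa [hs] at this
  · rintro ⟨e, he0, he⟩
    refine ⟨(finCongr hlen).symm.trans e, fun i => ?_⟩
    obtain ⟨i, rfl⟩ := (finCongr hlen).surjective i
    rw [Equiv.trans_apply, Equiv.symm_apply_apply]
    cases i using Fin.cases with
    | zero => rwa [h0]
    | succ i => rw [hs]; exact he i

namespace PlaneCurve.IsNormalForm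

variable {k : ℕ} {C : PlaneCurve (k + 2)} {A B : Matrix (Fin 3) (Fin 3) ℂ} {p : ℂ[X]}
  {n N : ℕ} {b : Fin n → ℕ} {lam : Fin N → ℂ}

theorem hasMultSeq_root (h : C.IsNormalForm A B p (discPoly b lam)) (hlam : Function.Injective lam)
    (i : Fin N) :
    C.HasMultSeq (h.pointAt (lam i)) (multSeq (List.replicate (extendMult b N i) 2)) := by
  obtain ⟨g, hg, hg0⟩ := rootProduct_factor hlam (extendMult b N) i
  have h0 : (rootProduct lam fun _ => 1).eval (lam i) = 0 := by
    obtain ⟨g, hg, -⟩ := rootProduct_factor hlam (fun _ => 1) i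
    rw [hg]
    simp
  exact h.hasMultSeq_pointAt (rootProduct_odd lam _) hg hg0 h0
    (derivative_rootProduct_one_ne hlam h0)

/-- The numbering of the singular points: first the vertex, then the points over `λ₁, …, λₙ`. -/
noncomputable def singularEquiv (h : C.IsNormalForm A B p (discPoly b lam))
    (hlam : Function.Injective lam) (hn : n ≤ N) (hb : ∀ i, 0 < b i) :
    Fin (n + 1) ≃ C.singularPoints :=
  Equiv.ofBijective
    (Fin.cases ⟨h.vertex, h.mem_singularPoints_iff.2 (Or.inl rfl)⟩ fun i =>
      ⟨h.pointAt (lam (Fin.castLE hn i)), h.mem_singularPoints_iff.2 (Or.inr ⟨_,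
        (sq_dvd_rootProduct_odd_iff hlam _ _).2 ⟨_, by
          rw [extendMult_castLE]; exact (hb i).ne', rfl⟩, rfl⟩)⟩) <| by
    constructor
    · intro i j hij
      cases i using Fin.cases with
      | zero =>
        cases j using Fin.cases with
        | zero => rfl
        | succ j => exact absurd (congrArg Subtype.val hij).symm (h.pointAt_ne_vertex _)
      | succ i =>
        cases j using Fin.cases with
        | zero => exact absurd (congrArg Subtype.val hij) (h.pointAt_ne_vertex _)
        | succ j =>
          have h1 := hlam (h.pointAt_injective (congrArg Subtype.val hij))
          exact congrArg Fin.succ (Fin.castLE_injective hn h1)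
    · rintro ⟨q, hq⟩
      rcases h.mem_singularPoints_iff.1 hq with rfl | ⟨t, ht, rfl⟩
      · exact ⟨0, rfl⟩
      · obtain ⟨i, hi, rfl⟩ := (sq_dvd_rootProduct_odd_iff hlam _ _).1 ht
        obtain ⟨j, rfl⟩ := exists_castLE_of_extendMult_ne b hn hi
        exact ⟨j.succ, rfl⟩

theorem hasData (h : C.IsNormalForm A B p (discPoly b lam)) (hlam : Function.Injective lam)
    (hn : n ≤ N) (hb : ∀ i, 0 < b i) {l : List ℕ} (hl : C.HasMultSeq h.vertex (multSeq l)) :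
    C.HasData (cuspData l b) := by
  rw [hasData_cuspData_iff]
  refine ⟨h.singularEquiv hlam hn hb, hl, fun i => ?_⟩
  have := h.hasMultSeq_root hlam (Fin.castLE hn i)
  rwa [extendMult_castLE] at this

theorem _root_.PlaneCurve.HasData.isCuspidal {d : ℕ} {C : PlaneCurve d} {M : List (ℕ → ℕ)}
    (h : C.HasData M) : C.IsCuspidal := by
  obtain ⟨e, he⟩ := h
  intro q hq
  obtain ⟨i, hi⟩ := e.surjective ⟨q, hq⟩
  have := (he i).1
  rwa [hi] at this

theorem genus_eq_of_discr (h : C.IsNormalForm A B p (discPoly b lam)) (hlam : Function.Injective lam)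
    {g : ℕ} (hN : N = 2 * g + 1 ∨ N = 2 * g + 2) : C.genus = g := by
  refine h.genus_eq (monic_rootProduct _ _).ne_zero (rootProduct_odd lam _)
    (fun t => derivative_rootProduct_one_ne hlam) ?_
  rw [natDegree_rootProduct]
  simpa using hN

end PlaneCurve.IsNormalForm

end Cusps


/-! ### The curves of the families -/

section FamilyCurves

open Polynomial

theorem projEquiv_iff {P E : MvPolynomial (Fin 3) ℂ} :
    ProjEquiv P E ↔ ∃ (A B : Matrix (Fin 3) (Fin 3) ℂ) (u : ℂ), B * A = 1 ∧ u ≠ 0 ∧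
      linSubst A P = MvPolynomial.C u * E := by
  constructor
  · rintro ⟨A, u, h⟩
    exact ⟨A, (A⁻¹ : GL (Fin 3) ℂ), u, by rw [← Units.val_mul, inv_mul_cancel]; rfl, u.ne_zero, h⟩
  · rintro ⟨A, B, u, hBA, hu, h⟩
    exact ⟨⟨A, B, mul_eq_one_comm.1 hBA, hBA⟩, Units.mk0 u hu, h⟩

theorem natDegree_discPoly {n N : ℕ} {b : Fin n → ℕ} (hn : n ≤ N) (lam : Fin N → ℂ) :
    (discPoly b lam).natDegree = N + 2 * ∑ i, b i := natDegree_rootProduct_odd b hn lam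

theorem monic_discPoly {n N : ℕ} (b : Fin n → ℕ) (lam : Fin N → ℂ) : (discPoly b lam).Monic :=
  monic_rootProduct _ _

theorem coeff_sq_sub_of_monic {p δ : ℂ[X]} {k : ℕ} (hp : p.natDegree ≤ k + 1) (hδ : δ.Monic)
    (hdeg : δ.natDegree = 2 * k + 2) : (p ^ 2 - δ).coeff (2 * k + 2) = p.coeff (k + 1) ^ 2 - 1 := by
  have h2 : k + 1 + (k + 1) = 2 * k + 2 := by ring
  rw [coeff_sub, ← hdeg, hδ.coeff_natDegree, hdeg, pow_two, ← h2,
    coeff_mul_add_eq_of_natDegree_le hp hp, pow_two]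

namespace PlaneCurve.IsNormalForm

variable {k : ℕ} {C : PlaneCurve (k + 2)} {A B : Matrix (Fin 3) (Fin 3) ℂ} {p : ℂ[X]}
  {n N g : ℕ} {b : Fin n → ℕ} {lam : Fin N → ℂ}

theorem hasMultSeq_vertex_A (h : C.IsNormalForm A B p (discPoly b lam)) (hn : n ≤ N)
    (hN : N = 2 * g + 2) (hk : k = g + ∑ i, b i) (hp : p.coeff (k + 1) ≠ 0) :
    C.HasMultSeq h.vertex (multSeq [k]) := by
  refine h.hasMultSeq_vertex_of_even (monic_rootProduct lam _).ne_zero (rootProduct_odd lam _) hp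
    (m := g + 1) ?_ ?_
  · rw [natDegree_rootProduct]
    simp [hN]
    ring
  · rw [natDegree_rootProduct, sum_extendMult b hn, hk]
    ring

theorem hasMultSeq_vertex_odd (h : C.IsNormalForm A B p (discPoly b lam)) (hn : n ≤ N)
    (hN : N = 2 * g + 1) {m : ℕ} (hk : ∑ i, b i + g + m = k) (hp : p.coeff (k + 1) = 0)
    (hcase : k = 2 * m + 1 ∧ 2 * p.natDegree ≤ k + 1 ∨ k ≤ 2 * m ∧ 2 * p.natDegree = k + 2) :
    C.HasMultSeq h.vertex (multSeq (k :: List.replicate m 2)) := by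
  refine h.hasMultSeq_vertex_of_odd (monic_rootProduct lam _).ne_zero (rootProduct_odd lam _) hp
    (m := g) ?_ ?_ hcase
  · rw [natDegree_rootProduct]
    simp [hN]
  · rw [natDegree_rootProduct, sum_extendMult b hn, ← hk]
    ring

/-- Without roots the discriminant is `1`, so `w = ±1`, against the independence of `1` and `w`. -/
theorem pos_of_discPoly (h : C.IsNormalForm A B p (discPoly b lam)) : 0 < N := by
  rw [Nat.pos_iff_ne_zero]
  rintro rfl
  obtain ⟨θ, w, -, M, -⟩ := h.exists_model (Q := 1) (f := 1) one_ne_zero (by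
    rw [discPoly, rootProduct]
    simp)
  have h1 := M.sq
  rw [map_one, pow_two] at h1
  rcases mul_self_eq_one_iff.1 h1 with h2 | h2
  · exact one_ne_zero (M.indep (-1) 1 (by simp [h2])).2
  · exact one_ne_zero (M.indep 1 1 (by simp [h2])).2

theorem projEquiv (h : C.IsNormalForm A B p (discPoly b lam)) {E : MvPolynomial (Fin 3) ℂ}
    (hE : E = quadForm k 1 p (p ^ 2 - discPoly b lam)) : ProjEquiv C.poly E := by
  obtain ⟨u, hu, h1⟩ := h.eqn
  exact projEquiv_iff.2 ⟨A, B, u, h.inv, hu, hE ▸ h1⟩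

/-- The three classes of curves. -/
theorem classification (h : C.IsNormalForm A B p (discPoly b lam)) (hlam : Function.Injective lam)
    (hn : n ≤ N) (hb : ∀ i, 0 < b i) (hu : C.IsUnibranchedAt h.vertex) (hg : C.genus = g) :
    (AdmissibleA g k b ∧ IsInFamilyA g k b C.poly ∧ C.HasMultSeq h.vertex (multSeq [k])) ∨
    (∃ l, k = 2 * l + 1 ∧ AdmissibleB g l b ∧ IsInFamilyB g l b C.poly ∧
      C.HasMultSeq h.vertex (multSeq (k :: List.replicate l 2))) ∨
    (∃ l j, k = 2 * l ∧ AdmissibleC g l j b ∧ IsInFamilyC g l j b C.poly ∧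
      C.HasMultSeq h.vertex (multSeq (k :: List.replicate (l + j) 2))) := by
  have hk2 := h.two_le
  have hN0 := h.pos_of_discPoly
  have hdeg := natDegree_discPoly (b := b) hn lam
  have hmon := monic_discPoly b lam
  have hpd := h.degree_b
  have hdd := h.degree_c
  -- Any positive `N` has one of these two shapes for some `g`, and the genus formula identifies
  -- that `g`.
  have hg' : N = 2 * g + 1 ∨ N = 2 * g + 2 := by
    have h1 : N = 2 * ((N - 1) / 2) + 1 ∨ N = 2 * ((N - 1) / 2) + 2 := by omega
    have h2 := h.genus_eq_of_discr hlam h1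
    rw [hg] at h2
    rwa [← h2] at h1
  by_cases hp : p.coeff (k + 1) = 0
  · have hf : (rootProduct lam fun _ => 1).natDegree = N := by
      rw [natDegree_rootProduct]
      simp
    have hodd := h.odd_natDegree_of_isUnibranchedAt (monic_rootProduct lam _).ne_zero
      (rootProduct_odd lam _) hp hu
    rw [hf] at hodd
    have hN : N = 2 * g + 1 := by
      rcases hg' with h1 | h1
      · exact h1
      · rw [h1] at hodd
        obtain ⟨m, hm⟩ := hodd
        omega
    subst hN
    have hd2 : (p ^ 2 - discPoly b lam).coeff (k + 2) ≠ 0 :=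
      h.ne_infinity.resolve_left (fun h1 => h1 hp)
    have hle := le_natDegree_of_ne_zero hd2
    have hsub := natDegree_sub_le (p ^ 2) (discPoly b lam)
    have hpp : (p ^ 2).natDegree = 2 * p.natDegree := natDegree_pow p 2
    -- The degree of `p²` is even and that of the discriminant is odd, so there is no tie. The
    -- larger is the degree of the difference, which is exactly `k + 2`; its parity separates (b)
    -- from (c).
    rcases lt_trichotomy (p ^ 2).natDegree (discPoly b lam).natDegree with hlt | heq | hlt
    · have h1 := natDegree_sub_eq_right_of_natDegree_lt hlt
      obtain ⟨l, rfl⟩ : ∃ l, k = 2 * l + 1 := ⟨(k - 1) / 2, by omega⟩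
      have hpl : p.natDegree ≤ l + 1 := by omega
      have hN : 2 * l + 3 = 2 * g + 1 + 2 * ∑ i, b i := by omega
      refine Or.inr (Or.inl ⟨l, rfl, ⟨by omega, hb, hn, by omega⟩, ?_, ?_⟩)
      · refine ⟨lam, hlam, fun i => p.coeff (l + 1 - i), h.projEquiv ?_⟩
        rw [eqnB_eq hn hN, gBase_coeff hpl]
      · exact h.hasMultSeq_vertex_odd hn rfl (by omega) hp (Or.inl ⟨rfl, by omega⟩)
    · omega
    · have h1 := natDegree_sub_eq_left_of_natDegree_lt hlt
      obtain ⟨l, rfl⟩ : ∃ l, k = 2 * l := ⟨p.natDegree - 1, by omega⟩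
      have hpl : p.natDegree = l + 1 := by omega
      -- The discriminant has degree `2g + 1 + 2 ∑ b i`, and `2j + 1` is what it lacks to `2l + 2`.
      obtain ⟨j, hj⟩ : ∃ j, l = g + j + ∑ i, b i := ⟨l - (g + ∑ i, b i), by omega⟩
      have hN : 2 * l + 1 = 2 * g + 1 + 2 * j + 2 * ∑ i, b i := by omega
      refine Or.inr (Or.inr ⟨l, j, rfl, ⟨by omega, hb, hn, hj⟩, ?_, ?_⟩)
      · refine ⟨lam, hlam, fun i => p.coeff (l + 1 - i), ?_, h.projEquiv ?_⟩
        · simp only [Nat.sub_zero, ← hpl, coeff_natDegree]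
          exact leadingCoeff_ne_zero.2 (fun h0 => by simp [h0] at hpl)
        · rw [eqnC_eq hn hN, gBase_coeff hpl.le]
      · exact h.hasMultSeq_vertex_odd hn rfl (by omega) hp (Or.inr ⟨by omega, by omega⟩)
  · left
    -- The nonzero term of degree `2k + 2` in `p²` must cancel, so the discriminant has this even
    -- degree. Hence `N` is even.
    have h1 : (p ^ 2 - discPoly b lam).coeff (2 * k + 2) = 0 :=
      coeff_eq_zero_of_natDegree_lt (hdd.trans_lt (by omega))
    have h2 : (discPoly b lam).natDegree = 2 * k + 2 := by
      apply le_antisymm h.degree_δ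
      apply le_natDegree_of_ne_zero
      have h3 : (p ^ 2).coeff (k + 1 + (k + 1)) = p.coeff (k + 1) ^ 2 := by
        rw [pow_two, coeff_mul_add_eq_of_natDegree_le hpd hpd, pow_two]
      have h4 : k + 1 + (k + 1) = 2 * k + 2 := by ring
      rw [coeff_sub, sub_eq_zero, ← h4, h3] at h1
      rw [← h4, ← h1]
      exact pow_ne_zero 2 hp
    have hN : N = 2 * g + 2 := by omega
    subst hN
    have hN' : 2 * k + 2 = 2 * g + 2 + 2 * ∑ i, b i := by omega
    refine ⟨⟨hk2, hb, hn, by omega⟩, ?_, h.hasMultSeq_vertex_A hn rfl (by omega) hp⟩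
    have hbase := gBase_coeff hpd
    refine ⟨lam, hlam, fun i => p.coeff (k + 1 - i), ?_, h.projEquiv ?_⟩
    · rw [divCond_iff hn hN', hbase]
      exact hdd
    · rw [eqnA_eq hn hN' (by rw [hbase]; exact hdd), hbase]

end PlaneCurve.IsNormalForm

variable {g k n : ℕ} {b : Fin n → ℕ} {P : MvPolynomial (Fin 3) ℂ}

theorem exists_planeCurve_A (ha : AdmissibleA g k b) (hP : IsInFamilyA g k b P) :
    ∃ C : PlaneCurve (k + 2), C.poly = P ∧ C.IsOfType k ∧ C.genus = g ∧
      C.HasData (cuspData [k] b) := by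
  obtain ⟨hk, hb, hn, hkg⟩ := ha
  obtain ⟨lam, hlam, c, hc, hE⟩ := hP
  obtain ⟨A, B, u, hBA, hu, hE⟩ := projEquiv_iff.1 hE
  have hN : 2 * k + 2 = 2 * g + 2 + 2 * ∑ i, b i := by omega
  rw [divCond_iff hn hN] at hc
  rw [eqnA_eq hn hN hc] at hE
  -- The degree bound forces `c₀² = 1`, the discriminant being monic of degree `2k + 2`.
  have hp : (gBase k c).coeff (k + 1) ≠ 0 := by
    intro h0
    have h1 := coeff_sq_sub_of_monic (natDegree_gBase_le k c) (monic_discPoly b lam)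
      ((natDegree_discPoly hn lam).trans hN.symm)
    rw [coeff_eq_zero_of_natDegree_lt (hc.trans_lt (by omega)), h0] at h1
    norm_num at h1
  obtain ⟨C, rfl, h⟩ := exists_planeCurve_isNormalForm hk hBA hu hE (natDegree_gBase_le k c) hc
    (Or.inl hp) (not_isSquare_rootProduct hlam _ (by omega))
  exact ⟨C, rfl, h.isOfType, h.genus_eq_of_discr hlam (Or.inr rfl),
    h.hasData hlam hn hb (h.hasMultSeq_vertex_A hn rfl hkg hp)⟩

theorem exists_planeCurve_B (ha : AdmissibleB g k b) (hP : IsInFamilyB g k b P) :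
    ∃ C : PlaneCurve (2 * k + 3), C.poly = P ∧ C.IsOfType (2 * k + 1) ∧ C.genus = g ∧
      C.HasData (cuspData ((2 * k + 1) :: List.replicate k 2) b) := by
  obtain ⟨hk, hb, hn, hkg⟩ := ha
  obtain ⟨lam, hlam, c, hE⟩ := hP
  obtain ⟨A, B, u, hBA, hu, hE⟩ := projEquiv_iff.1 hE
  have hN : 2 * k + 3 = 2 * g + 1 + 2 * ∑ i, b i := by omega
  rw [eqnB_eq hn hN] at hE
  have hpd := natDegree_gBase_le k c
  have hdeg : (discPoly b lam).natDegree = 2 * k + 3 := (natDegree_discPoly hn lam).trans hN.symm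
  have hsq : (gBase k c ^ 2).natDegree < 2 * k + 3 := by
    rw [natDegree_pow]
    omega
  have hp : (gBase k c).coeff (2 * k + 1 + 1) = 0 := coeff_eq_zero_of_natDegree_lt (by omega)
  have hd : (gBase k c ^ 2 - discPoly b lam).natDegree ≤ 2 * k + 1 + 2 :=
    (natDegree_sub_le _ _).trans (max_le hsq.le hdeg.le)
  have hd2 : (gBase k c ^ 2 - discPoly b lam).coeff (2 * k + 1 + 2) ≠ 0 := by
    change (gBase k c ^ 2 - discPoly b lam).coeff (2 * k + 3) ≠ 0
    rw [coeff_sub, coeff_eq_zero_of_natDegree_lt hsq, ← hdeg, (monic_discPoly b lam).coeff_natDegree]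
    norm_num
  obtain ⟨C, rfl, h⟩ := exists_planeCurve_isNormalForm (by omega) hBA hu hE (by omega) hd
    (Or.inr hd2) (not_isSquare_rootProduct hlam _ (by omega))
  exact ⟨C, rfl, h.isOfType, h.genus_eq_of_discr hlam (Or.inl rfl), h.hasData hlam hn hb
    (h.hasMultSeq_vertex_odd hn rfl (by omega) hp (Or.inl ⟨rfl, by omega⟩))⟩

theorem exists_planeCurve_C {j : ℕ} (ha : AdmissibleC g k j b) (hP : IsInFamilyC g k j b P) :
    ∃ C : PlaneCurve (2 * k + 2), C.poly = P ∧ C.IsOfType (2 * k) ∧ C.genus = g ∧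
      C.HasData (cuspData ((2 * k) :: List.replicate (k + j) 2) b) := by
  obtain ⟨hk, hb, hn, hkg⟩ := ha
  obtain ⟨lam, hlam, c, hc, hE⟩ := hP
  obtain ⟨A, B, u, hBA, hu, hE⟩ := projEquiv_iff.1 hE
  have hN : 2 * k + 1 = 2 * g + 1 + 2 * j + 2 * ∑ i, b i := by omega
  rw [eqnC_eq hn hN] at hE
  have hpd := natDegree_gBase_le k c
  have hpc : (gBase k c).coeff (k + 1) = c 0 := by rw [coeff_gBase _ _ le_rfl, Nat.sub_self]
  -- The condition `c₀ ≠ 0` gives `G(x, 1)` its full degree, so that its square has larger degree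
  -- than the discriminant.
  have hpd' : (gBase k c).natDegree = k + 1 :=
    le_antisymm hpd (le_natDegree_of_ne_zero (by rwa [hpc]))
  have hdeg := natDegree_discPoly (b := b) hn lam
  have hsq : (gBase k c ^ 2).natDegree = 2 * k + 2 := by
    rw [natDegree_pow, hpd']
    ring
  have hp : (gBase k c).coeff (2 * k + 1) = 0 := coeff_eq_zero_of_natDegree_lt (by omega)
  have hd : (gBase k c ^ 2 - discPoly b lam).natDegree = 2 * k + 2 := by
    rw [natDegree_sub_eq_left_of_natDegree_lt (by omega), hsq]
  have hd2 : (gBase k c ^ 2 - discPoly b lam).coeff (2 * k + 2) ≠ 0 := by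
    rw [← hd, coeff_natDegree, leadingCoeff_ne_zero]
    rintro h0
    rw [h0, natDegree_zero] at hd
    omega
  obtain ⟨C, rfl, h⟩ := exists_planeCurve_isNormalForm (by omega) hBA hu hE (by omega) hd.le
    (Or.inr hd2) (not_isSquare_rootProduct hlam _ (by omega))
  exact ⟨C, rfl, h.isOfType, h.genus_eq_of_discr hlam (Or.inl rfl), h.hasData hlam hn hb
    (h.hasMultSeq_vertex_odd hn rfl (by omega) hp (Or.inr ⟨by omega, by omega⟩))⟩

end FamilyCurves


/-! ### Curves with a unibranched point of multiplicity `d - 2` -/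

section ConeForm

open MvPolynomial

theorem binaryForm_C_mul_X_pow {i N : ℕ} (h : i ≤ N) (c : ℂ) :
    binaryForm N (Polynomial.C c * Polynomial.X ^ i) = C c * (X 0 ^ i * X 1 ^ (N - i)) := by
  have h1 := binaryForm_X_sub_C_pow 0 i
  rw [Polynomial.C_0, sub_zero, map_zero, zero_mul, sub_zero] at h1
  have h2 := binaryForm_mul (M := i) (N := N - i) (p := Polynomial.X ^ i) (q := 1) (by simp)
    (by simp)
  rw [mul_one, Nat.add_sub_cancel' h, h1, binaryForm_one] at h2
  rw [binaryForm_C_mul, h2]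

theorem quadForm_add (k : ℕ) (a b c a' b' c' : Polynomial ℂ) :
    quadForm k (a + a') (b + b') (c + c') = quadForm k a b c + quadForm k a' b' c' := by
  simp only [quadForm, binaryForm_add]
  ring

theorem binaryForm_zero (N : ℕ) : binaryForm N 0 = 0 := by
  simp [binaryForm]

theorem monomial_fin_three (m : Fin 3 →₀ ℕ) (c : ℂ) :
    monomial m c = C c * (X 0 ^ m 0 * X 1 ^ m 1 * X 2 ^ m 2) := by
  rw [monomial_eq, Finsupp.prod_fintype _ _ (fun _ => pow_zero _), Fin.prod_univ_three]

theorem sum_eq_of_isHomogeneous {P : MvPolynomial (Fin 3) ℂ} {n : ℕ} (hP : P.IsHomogeneous n)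
    {m : Fin 3 →₀ ℕ} (hm : coeff m P ≠ 0) : m 0 + m 1 + m 2 = n := by
  rw [← hP hm]
  simp [Finsupp.weight_apply, Finsupp.sum_fintype, Fin.sum_univ_three]

/-- The Taylor expansion at the vertex is `P(x, y, 1)`, whose parts of degree below `k` vanish. By
homogeneity setting `z = 1` loses nothing: the exponents of `x` and `y` determine that of `z`. -/
theorem coeff_eq_zero_of_line {k : ℕ} {P : MvPolynomial (Fin 3) ℂ} (hP : P.IsHomogeneous (k + 2))
    (h : ∀ w, Polynomial.X ^ k ∣ aeval (lineThrough ![0, 0, 1] w) P) {m : Fin 3 →₀ ℕ}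
    (hm : m 0 + m 1 < k) : coeff m P = 0 := by
  set P₁ := bind₁ (![X 0, X 1, 1] : Fin 3 → MvPolynomial (Fin 3) ℂ) P with hP₁
  have h1 : ∀ j < k, homogeneousComponent j P₁ = 0 := by
    intro j hj
    refine MvPolynomial.funext fun v => ?_
    rw [map_zero]
    have h2 := (Polynomial.X_pow_dvd_iff.1 (h ![v 0, v 1, 0])) j hj
    have h3 : aeval (lineThrough ![0, 0, 1] ![v 0, v 1, 0]) P =
        aeval (fun i => Polynomial.C (v i) * Polynomial.X) P₁ := by
      rw [hP₁, aeval_bind₁]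
      congr 2
      funext i
      fin_cases i <;> simp [lineThrough]
    rw [h3, aeval_C_mul_X] at h2
    exact h2
  have h4 : P₁ = ∑ d ∈ P.support, monomial (Finsupp.single 0 (d 0) + Finsupp.single 1 (d 1))
      (coeff d P) := by
    rw [hP₁, bind₁, aeval_def, eval₂_eq']
    refine Finset.sum_congr rfl fun d _ => ?_
    rw [monomial_fin_three]
    simp [Fin.prod_univ_three, algebraMap_eq]
  by_contra hne
  have h5 := congrArg (coeff (Finsupp.single 0 (m 0) + Finsupp.single 1 (m 1))) (h1 _ hm)
  rw [coeff_homogeneousComponent, if_pos (by simp [Finsupp.degree_eq_sum, Fin.sum_univ_three]),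
    coeff_zero, h4, coeff_sum, Finset.sum_eq_single_of_mem m (mem_support_iff.2 hne)] at h5
  · rw [coeff_monomial, if_pos rfl] at h5
    exact hne h5
  · intro d hd hdm
    rw [coeff_monomial, if_neg]
    intro heq
    apply hdm
    have e0 : d 0 = m 0 := by simpa using DFunLike.congr_fun heq 0
    have e1 : d 1 = m 1 := by simpa using DFunLike.congr_fun heq 1
    have d1 := sum_eq_of_isHomogeneous hP (mem_support_iff.1 hd)
    have d2 := sum_eq_of_isHomogeneous hP hne
    ext i
    fin_cases i
    · exact e0
    · exact e1
    · change d 2 = m 2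
      omega

/-- A form with a zero of order `k` at `(0 : 0 : 1)` and of degree `k + 2`. -/
theorem exists_quadForm {k : ℕ} {P : MvPolynomial (Fin 3) ℂ} (hP : P.IsHomogeneous (k + 2))
    (h : ∀ w, Polynomial.X ^ k ∣ aeval (lineThrough ![0, 0, 1] w) P) :
    ∃ a b c : Polynomial ℂ, a.natDegree ≤ k ∧ b.natDegree ≤ k + 1 ∧ c.natDegree ≤ k + 2 ∧
      P = quadForm k a b c := by
  rw [P.as_sum]
  refine Finset.sum_induction _ (fun P => ∃ a b c : Polynomial ℂ, a.natDegree ≤ k ∧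
    b.natDegree ≤ k + 1 ∧ c.natDegree ≤ k + 2 ∧ P = quadForm k a b c) ?_ ?_ ?_
  · rintro _ _ ⟨a, b, c, ha, hb, hc, rfl⟩ ⟨a', b', c', ha', hb', hc', rfl⟩
    exact ⟨a + a', b + b', c + c', Polynomial.natDegree_add_le_of_degree_le ha ha',
      Polynomial.natDegree_add_le_of_degree_le hb hb',
      Polynomial.natDegree_add_le_of_degree_le hc hc', (quadForm_add _ _ _ _ _ _ _).symm⟩
  · exact ⟨0, 0, 0, by simp, by simp, by simp, by simp [quadForm, binaryForm_zero]⟩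
  · intro m hm
    have hne := mem_support_iff.1 hm
    have h1 : k ≤ m 0 + m 1 := by
      by_contra hlt
      exact hne (coeff_eq_zero_of_line hP h (not_le.1 hlt))
    have d2 := sum_eq_of_isHomogeneous hP hne
    rw [monomial_fin_three]
    generalize coeff m P = e
    obtain h2 | h2 | h2 : m 2 = 0 ∨ m 2 = 1 ∨ m 2 = 2 := by omega
    · refine ⟨0, 0, Polynomial.C e * Polynomial.X ^ m 0, by simp, by simp,
        (Polynomial.natDegree_C_mul_X_pow_le _ _).trans (by omega), ?_⟩
      have h3 : k + 2 - m 0 = m 1 := by omega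
      rw [quadForm, binaryForm_C_mul_X_pow (by omega), binaryForm_zero, binaryForm_zero, h2, h3]
      ring
    · refine ⟨0, Polynomial.C (e / 2) * Polynomial.X ^ m 0, 0, by simp,
        (Polynomial.natDegree_C_mul_X_pow_le _ _).trans (by omega), by simp, ?_⟩
      have h3 : k + 1 - m 0 = m 1 := by omega
      have h4 : C e = 2 * (C (e / 2) : MvPolynomial (Fin 3) ℂ) := by
        have : (2 : MvPolynomial (Fin 3) ℂ) = C 2 := (map_ofNat C 2).symm
        rw [this, ← map_mul, mul_div_cancel₀ _ two_ne_zero]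
      rw [quadForm, binaryForm_C_mul_X_pow (by omega), binaryForm_zero, binaryForm_zero, h2, h3, h4]
      ring
    · refine ⟨Polynomial.C e * Polynomial.X ^ m 0, 0, 0,
        (Polynomial.natDegree_C_mul_X_pow_le _ _).trans (by omega), by simp, by simp, ?_⟩
      have h3 : k - m 0 = m 1 := by omega
      rw [quadForm, binaryForm_C_mul_X_pow (by omega), binaryForm_zero, binaryForm_zero, h2, h3]
      ring

/-- Some standard basis vector completes `v, p` to a basis: otherwise all `2 × 2` minors of the pair
vanish and `v` is a multiple of `p`. -/
theorem exists_matrix {v p : Fin 3 → ℂ} (hp : p ≠ 0) (hv : ∀ c : ℂ, v ≠ c • p) :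
    ∃ A B : Matrix (Fin 3) (Fin 3) ℂ, B * A = 1 ∧ A.mulVec ![1, 0, 0] = v ∧
      A.mulVec ![0, 0, 1] = p := by
  suffices h : ∃ e : Fin 3 → ℂ,
      (Matrix.of fun i j => ![v i, e i, p i] j : Matrix (Fin 3) (Fin 3) ℂ).det ≠ 0 by
    obtain ⟨e, he⟩ := h
    refine ⟨_, _, Matrix.nonsing_inv_mul _ (IsUnit.mk0 _ he), ?_, ?_⟩ <;>
    · funext i
      simp [Matrix.mulVec, dotProduct, Fin.sum_univ_three]
  by_contra! h
  have h0 := h ![1, 0, 0]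
  have h1 := h ![0, 1, 0]
  have h2 := h ![0, 0, 1]
  simp only [Matrix.det_fin_three, Matrix.of_apply, Matrix.cons_val] at h0 h1 h2
  obtain ⟨j, hj⟩ := Function.ne_iff.1 hp
  apply hv (v j / p j)
  funext i
  rw [Pi.smul_apply, smul_eq_mul, div_mul_eq_mul_div, eq_div_iff hj]
  fin_cases i <;> fin_cases j <;> simp only [Fin.zero_eta, Fin.mk_one, Fin.reduceFinMk] <;>
    first
    | ring1
    | linear_combination h0
    | linear_combination -h0
    | linear_combination h1
    | linear_combination -h1
    | linear_combination h2
    | linear_combination -h2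

end ConeForm

/-! ### The square part of a polynomial. -/

section Squares

open Polynomial

theorem Polynomial.exists_sq_mul_simple {δ : ℂ[X]} (h : δ ≠ 0) : ∃ Q f : ℂ[X], Q ≠ 0 ∧
    δ = Q ^ 2 * f ∧ ∀ t, f.eval t = 0 → f.derivative.eval t ≠ 0 := by
  induction hn : δ.natDegree using Nat.strong_induction_on generalizing δ with
  | _ n ih =>
    by_cases hs : ∀ t, δ.eval t = 0 → δ.derivative.eval t ≠ 0
    · exact ⟨1, δ, one_ne_zero, by simp, hs⟩
    · push Not at hs
      obtain ⟨t, h0, h1⟩ := hs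
      have h2 := (one_lt_rootMultiplicity_iff_isRoot h).2 ⟨h0, h1⟩
      obtain ⟨δ₁, rfl⟩ := (le_rootMultiplicity_iff h).1 (Nat.succ_le_of_lt h2)
      have h3 : δ₁ ≠ 0 := right_ne_zero_of_mul h
      have hX : (X - C t) ^ 2 ≠ 0 := left_ne_zero_of_mul h
      have hdeg : ((X - C t) ^ 2 * δ₁).natDegree = 2 + δ₁.natDegree := by
        rw [natDegree_mul hX h3, natDegree_pow, natDegree_X_sub_C]
      obtain ⟨Q, f, hQ, hf, hs⟩ := ih δ₁.natDegree (by simp at *; omega) h3 rfl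
      refine ⟨(X - C t) * Q, f, mul_ne_zero (X_sub_C_ne_zero t) hQ, ?_, hs⟩
      rw [hf]
      simp
      ring

end Squares


/-! ### Existence of the normal form -/

section ExistsNormalForm

open Polynomial

namespace PlaneCurve

/-- Where `a` vanishes a root `z` of the quadratic equation escapes to infinity. If `b(t) = 0`, a
finite `z` would force `c(t) = 0`. If `b(t) ≠ 0`, on the branch `Q w = -b` the function `a z = Q w -
b` tends to `-2 b(t) ≠ 0` while `a` tends to `0`. -/
theorem IsChart.exists_place_of_root {d : ℕ} {C : PlaneCurve d} {A : Matrix (Fin 3) (Fin 3) ℂ}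
    {θ : Fin 3 → C.functionField} (h : C.IsChart A θ) {a b c : ℂ[X]} (ha0 : a ≠ 0)
    (heq : aeval (θ 0) a * θ 2 ^ 2 + 2 * aeval (θ 0) b * θ 2 + aeval (θ 0) c = 0) {t : ℂ}
    (ha : a.eval t = 0) (hbc : b.eval t = 0 → c.eval t ≠ 0) :
    ∃ V : CurvePlace C.functionField, V.HasValue (θ 0) t ∧ V.HasValue (1 / θ 2) 0 := by
  have hδ : b ^ 2 - a * c ≠ 0 := by
    intro h0
    have h1 : (aeval (θ 0) b + aeval (θ 0) a * θ 2) ^ 2 = 0 := by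
      have h2 := congrArg (aeval (θ 0)) h0
      simp only [map_sub, map_mul, map_pow, map_zero] at h2
      linear_combination aeval (θ 0) a * heq + h2
    exact ha0 (h.indep b a (pow_eq_zero_iff two_ne_zero |>.1 h1)).2
  obtain ⟨Q, f, hQ, hf, -⟩ := Polynomial.exists_sq_mul_simple hδ
  have M := h.quadraticModel ha0 heq hQ hf
  have ha1 := M.aeval_ne_zero ha0
  have hQ1 := M.aeval_ne_zero hQ
  have h2 := h.theta_ne_zero 2
  have hev : b.eval t ^ 2 = Q.eval t ^ 2 * f.eval t := by
    have := congrArg (Polynomial.eval t) hf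
    simpa [ha] using this
  by_cases hb : b.eval t = 0
  · obtain ⟨e, he⟩ := IsAlgClosed.exists_pow_nat_eq (f.eval t) (n := 2) (by norm_num)
    obtain ⟨V, hV⟩ := M.exists_place he
    refine ⟨V, hV.1, ?_⟩
    rw [CurvePlace.hasValue_zero_iff]
    by_contra hlt
    have hz : V.ring.valuation (θ 2) ≤ 1 := by
      rw [← one_div_one_div (θ 2), one_div (1 / θ 2), map_inv₀]
      exact inv_le_one_of_one_le₀ (not_lt.1 hlt)
    have t1 : V.HasValue (aeval (θ 0) a * θ 2 ^ 2) 0 := by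
      have := hV.1.aeval a
      rw [ha, CurvePlace.hasValue_zero_iff] at this
      rw [CurvePlace.hasValue_zero_iff, map_mul, map_pow]
      exact (mul_le_of_le_one_right zero_le (pow_le_one₀ zero_le hz)).trans_lt this
    have t2 : V.HasValue (2 * aeval (θ 0) b * θ 2) 0 := by
      have := (CurvePlace.hasValue_const (V := V) 2).mul (hV.1.aeval b)
      rw [hb, mul_zero, map_ofNat, CurvePlace.hasValue_zero_iff] at this
      rw [CurvePlace.hasValue_zero_iff, map_mul]
      exact (mul_le_of_le_one_right zero_le hz).trans_lt this
    have h4 := (t1.add t2).add (hV.1.aeval c)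
    rw [heq] at h4
    have h5 := h4.unique (by simpa using CurvePlace.hasValue_const (V := V) 0)
    exact hbc hb (by simpa using h5)
  · have hQt : Q.eval t ≠ 0 := by
      intro h0
      rw [h0] at hev
      exact hb (by simpa using hev)
    obtain ⟨V, hV⟩ := M.exists_place (t := t) (c := -b.eval t / Q.eval t) (by
      rw [div_pow, neg_sq, hev]
      exact mul_div_cancel_left₀ _ (pow_ne_zero 2 hQt))
    refine ⟨V, hV.1, ?_⟩
    have h3 := ((hV.1.aeval Q).mul hV.2).sub (hV.1.aeval b)
    rw [mul_div_cancel₀ _ hQt, mul_div_cancel₀ _ hQ1, add_sub_cancel_right, ← neg_add',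
      ← two_mul] at h3
    have h5 := (hV.1.aeval a).div h3 (neg_ne_zero.2 (mul_ne_zero two_ne_zero hb))
    rwa [ha, zero_div, div_mul_cancel_left₀ ha1, ← one_div] at h5

variable {k : ℕ} (C : PlaneCurve (k + 2)) {A B : Matrix (Fin 3) (Fin 3) ℂ} {a b c : ℂ[X]}

theorem not_dvd_of_isHomogeneous_one (hBA : B * A = 1) {u : ℂ} (hu : u ≠ 0)
    (hE : linSubst A C.poly = MvPolynomial.C u * quadForm k a b c) {L : MvPolynomial (Fin 3) ℂ}
    (hL : L.IsHomogeneous 1) : ¬ L ∣ quadForm k a b c := by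
  have hirr : Irreducible (quadForm k a b c) := by
    rw [← irreducible_isUnit_mul ((IsUnit.mk0 u hu).map MvPolynomial.C), ← hE]
    exact (MulEquiv.irreducible_iff (linSubstEquiv hBA)).2 C.irreducible
  rintro ⟨R, hR⟩
  have h0 := hirr.ne_zero
  have hdeg := (isHomogeneous_quadForm k a b c).totalDegree h0
  rw [hR] at h0
  have hL0 := left_ne_zero_of_mul h0
  have hR0 := right_ne_zero_of_mul h0
  have hL1 := hL.totalDegree hL0
  rw [hR, MvPolynomial.totalDegree_mul_of_isDomain hL0 hR0, hL1] at hdeg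
  rcases hirr.isUnit_or_isUnit hR with h1 | h1
  · have := (MvPolynomial.isUnit_iff_totalDegree_of_isReduced.1 h1).2
    omega
  · have := (MvPolynomial.isUnit_iff_totalDegree_of_isReduced.1 h1).2
    omega

variable {p : ℙ ℂ (Fin 3 → ℂ)}

theorem exists_linSubst_eq_quadForm (hm : k ≤ C.mult p) (hBA : B * A = 1) {ρ : ℂ} (hρ : ρ ≠ 0)
    (hp : p.rep = ρ • A.mulVec ![0, 0, 1]) :
    ∃ a b c : ℂ[X], a.natDegree ≤ k ∧ b.natDegree ≤ k + 1 ∧ c.natDegree ≤ k + 2 ∧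
      linSubst A C.poly = quadForm k a b c := by
  refine exists_quadForm (isHomogeneous_linSubst C.homogeneous A) ?_
  exact (C.le_mult_iff_of_linSubst hBA one_ne_zero (by simp) hρ hp k).1 hm

/-- The multiplicity being exactly `k`, some direction `v` lies off the tangent cone. Taking it as
the direction of `x` makes `a` of exact degree `k`, so that all tangents correspond to finite roots
of `a`. -/
theorem exists_first_coordinates (hk : 0 < k) (hm : C.mult p = k) :
    ∃ (A B : Matrix (Fin 3) (Fin 3) ℂ) (a b c : ℂ[X]), B * A = 1 ∧
      p.rep = A.mulVec ![0, 0, 1] ∧ a.natDegree ≤ k ∧ b.natDegree ≤ k + 1 ∧ c.natDegree ≤ k + 2 ∧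
      linSubst A C.poly = quadForm k a b c ∧ a.coeff k ≠ 0 := by
  have h1 : ¬ ∀ v, X ^ (k + 1) ∣ MvPolynomial.aeval (lineThrough p.rep v) C.poly := by
    rw [← C.le_mult_iff, hm]
    omega
  push Not at h1
  obtain ⟨v, hv⟩ := h1
  -- Along the direction of `p` itself the form is a power of `1 + e X` times its value at `p`,
  -- which is zero.
  have hv' : ∀ e : ℂ, v ≠ e • p.rep := by
    rintro e rfl
    apply hv
    have h2 := (C.le_mult_iff p 1).1 (by omega) 0
    have h3 : ∀ w, lineThrough p.rep (w • p.rep) = fun i => (1 + Polynomial.C w * X) *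
        (Polynomial.C (p.rep i) : ℂ[X]) := by
      intro w
      funext i
      simp [lineThrough]
      ring
    have h4 := h3 0
    simp only [zero_smul, map_zero, zero_mul, add_zero, one_mul] at h4
    rw [h3, aeval_mul_of_isHomogeneous C.homogeneous, ← h4]
    have h5 : MvPolynomial.aeval (lineThrough p.rep 0) C.poly = 0 := by
      rw [h4] at h2 ⊢
      have h6 : (MvPolynomial.aeval (fun i => (Polynomial.C (p.rep i) : ℂ[X])) C.poly : ℂ[X]) =
          Polynomial.C (MvPolynomial.aeval p.rep C.poly) :=
        MvPolynomial.aeval_algebraMap_apply (A := ℂ) ℂ[X] p.rep C.poly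
      rw [h6] at h2 ⊢
      rw [pow_one, X_dvd_iff, coeff_C_zero] at h2
      rw [h2, map_zero]
    rw [h5, mul_zero]
    exact dvd_zero _
  obtain ⟨A, B, hBA, hA0, hA2⟩ := exists_matrix p.rep_nonzero hv'
  obtain ⟨a, b, c, ha, hb, hc, hE⟩ := C.exists_linSubst_eq_quadForm (ρ := 1) hm.ge hBA one_ne_zero
    (by rw [one_smul, hA2])
  refine ⟨A, B, a, b, c, hBA, hA2.symm, ha, hb, hc, hE, fun h0 => hv ?_⟩
  have h2 : MvPolynomial.aeval (lineThrough p.rep v) C.poly =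
      MvPolynomial.aeval (lineThrough ![0, 0, 1] ![1, 0, 0]) (quadForm k a b c) := by
    rw [← hE, aeval_linSubst]
    congr 2
    funext i
    rw [← hA0, ← hA2]
    simp [lineThrough, Matrix.mulVec, dotProduct, Fin.sum_univ_three, algebraMap_eq]
    ring
  rw [h2, X_pow_dvd_iff]
  intro j hj
  rcases (Nat.lt_succ_iff.1 hj).eq_or_lt with rfl | hj
  · rw [coeff_line_vertex (by simp) (by simp), aeval_binaryForm_of_eq_zero (by simp), h0]
    simp
  · exact X_pow_dvd_iff.1 (X_pow_dvd_line_vertex (by simp) (by simp) a b c _) j hj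

/-- Each root `t` of `a` yields a place with `x = t` and `z = ∞`, centered at the vertex; different
roots give different places. -/
theorem root_unique (hBA : B * A = 1) (hp : p.rep = A.mulVec ![0, 0, 1])
    (ha : a.natDegree ≤ k) (hb : b.natDegree ≤ k + 1) (hc : c.natDegree ≤ k + 2) (ha0 : a ≠ 0)
    (hE : linSubst A C.poly = quadForm k a b c) (hu : C.IsUnibranchedAt p) {t t' : ℂ}
    (ht : a.eval t = 0) (ht' : a.eval t' = 0) : t = t' := by
  have hE' : linSubst A C.poly = MvPolynomial.C 1 * quadForm k a b c := by simpa using hE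
  obtain ⟨θ, hθ, h0⟩ := C.exists_chart hBA one_ne_zero ha hb hc ha0 hE'
  rw [aeval_quadForm_of_eq_one hθ.one ha hb hc] at h0
  have h2 := hθ.theta_ne_zero 2
  have key : ∀ t, a.eval t = 0 → ∃ V : CurvePlace C.functionField, V.HasValue (θ 0) t ∧
      C.IsCenteredAt V p := by
    intro t ht
    -- A common root of `a, b, c` would split the line `x = t y` off the irreducible curve.
    have hbc : b.eval t = 0 → c.eval t ≠ 0 := by
      intro hbt hct
      obtain ⟨a', rfl⟩ := dvd_iff_isRoot.2 ht
      obtain ⟨b', rfl⟩ := dvd_iff_isRoot.2 hbt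
      obtain ⟨c', rfl⟩ := dvd_iff_isRoot.2 hct
      have hfac : ∀ {N : ℕ} {q : ℂ[X]}, ((X - Polynomial.C t) * q).natDegree ≤ N →
          binaryForm 1 (X - Polynomial.C t) ∣ binaryForm N ((X - Polynomial.C t) * q) := by
        intro N q hq
        by_cases hq0 : q = 0
        · rw [hq0, mul_zero, binaryForm_zero]
          exact dvd_zero _
        · rw [natDegree_mul (X_sub_C_ne_zero t) hq0, natDegree_X_sub_C] at hq
          obtain ⟨M, rfl⟩ := Nat.exists_eq_add_of_le ((Nat.le_add_right _ _).trans hq)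
          rw [binaryForm_mul (by simp) (by omega)]
          exact dvd_mul_right _ _
      refine C.not_dvd_of_isHomogeneous_one hBA one_ne_zero hE'
        (isHomogeneous_binaryForm 1 (X - Polynomial.C t)) ?_
      exact dvd_add (dvd_add ((hfac ha).mul_right _) (((hfac hb).mul_left _).mul_right _)) (hfac hc)
    obtain ⟨V, hV, hV2⟩ := hθ.exists_place_of_root ha0 h0 ht hbc
    refine ⟨V, hV, ?_⟩
    rw [hθ.isCenteredAt_iff hBA hp (k := 2) (by simp)]
    intro i
    fin_cases i
    · have := hV.mul hV2
      rw [mul_zero, mul_one_div] at this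
      simpa using this
    · simpa [hθ.one] using hV2
    · have : V.HasValue 1 1 := by simpa using CurvePlace.hasValue_const (V := V) 1
      simpa [h2] using this
  obtain ⟨V, hV, hVp⟩ := key t ht
  obtain ⟨W, hW, hWp⟩ := key t' ht'
  have := hu.unique hVp hWp
  subst this
  exact hV.unique hW

theorem _root_.Polynomial.eq_C_mul_X_sub_C_pow {a : ℂ[X]} {k : ℕ} (ha : a.natDegree = k)
    (h : ∀ t t', a.eval t = 0 → a.eval t' = 0 → t = t') :
    ∃ μ : ℂ, a = Polynomial.C a.leadingCoeff * (X - Polynomial.C μ) ^ k := by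
  have h1 := (IsAlgClosed.splits a).eq_prod_roots
  have hcard : a.roots.card = k := by rw [← ha, (IsAlgClosed.splits a).natDegree_eq_card_roots]
  rcases Nat.eq_zero_or_pos k with rfl | hk
  · refine ⟨0, ?_⟩
    rw [pow_zero, mul_one, leadingCoeff, ha]
    exact eq_C_of_natDegree_eq_zero ha
  · obtain ⟨μ, hμ⟩ := Multiset.card_pos_iff_exists_mem.1 (hcard ▸ hk)
    refine ⟨μ, ?_⟩
    have h2 : a.roots = Multiset.replicate k μ := by
      rw [Multiset.eq_replicate]
      exact ⟨hcard, fun x hx => h x μ (isRoot_of_mem_roots hx) (isRoot_of_mem_roots hμ)⟩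
    rw [h2] at h1
    simpa using h1

theorem exists_second_coordinates (hk : 0 < k) (hm : C.mult p = k) (hu : C.IsUnibranchedAt p) :
    ∃ (A B : Matrix (Fin 3) (Fin 3) ℂ) (α : ℂ) (b c : ℂ[X]), B * A = 1 ∧ α ≠ 0 ∧
      p.rep = A.mulVec ![0, 0, 1] ∧ b.natDegree ≤ k + 1 ∧ c.natDegree ≤ k + 2 ∧
      linSubst A C.poly = quadForm k (Polynomial.C α) b c := by
  obtain ⟨A, B, a, b, c, hBA, hp, ha, hb, hc, hE, hak⟩ := C.exists_first_coordinates hk hm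
  have ha0 : a ≠ 0 := fun h0 => hak (by rw [h0, coeff_zero])
  have hdeg : a.natDegree = k := le_antisymm ha (le_natDegree_of_ne_zero hak)
  obtain ⟨μ, hμ⟩ := Polynomial.eq_C_mul_X_sub_C_pow hdeg fun t t' ht ht' =>
    C.root_unique hBA hp ha hb hc ha0 hE hu ht ht'
  -- The substitution `x ↦ μ x + y`, `y ↦ x` turns `x - μ y` into `y`.
  have hS : (!![0, 1, 0; 1, -μ, 0; 0, 0, 1] * !![μ, 1, 0; 1, 0, 0; 0, 0, 1] :
      Matrix (Fin 3) (Fin 3) ℂ) = 1 := by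
    ext i j
    fin_cases i <;> fin_cases j <;> simp [Matrix.mul_apply, Fin.sum_univ_three]
  set S : Matrix (Fin 3) (Fin 3) ℂ := !![μ, 1, 0; 1, 0, 0; 0, 0, 1] with hSdef
  have hS2 : S.mulVec ![0, 0, 1] = ![0, 0, 1] := by
    funext i
    fin_cases i <;> simp [hSdef, Matrix.mulVec, dotProduct, Fin.sum_univ_three]
  have hBA' : (!![0, 1, 0; 1, -μ, 0; 0, 0, 1] * B) * (A * S) = 1 := by
    rw [Matrix.mul_assoc, ← Matrix.mul_assoc B, hBA, Matrix.one_mul, hS]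
  have hp' : p.rep = (A * S).mulVec ![0, 0, 1] := by
    rw [← Matrix.mulVec_mulVec, hS2, hp]
  obtain ⟨a', b', c', ha', hb', hc', hE'⟩ := C.exists_linSubst_eq_quadForm (ρ := 1) hm.ge hBA'
    one_ne_zero (by rw [one_smul, hp'])
  -- Tangent cones are compared: in the direction `(t, 1, 0)` the new one is the leading coefficient
  -- times `((μ t + 1) - μ t)^k`.
  have hconst : a' = Polynomial.C a.leadingCoeff := by
    refine Polynomial.funext fun t => ?_
    have h1 : MvPolynomial.aeval (lineThrough ![0, 0, 1] ![t, 1, 0]) (quadForm k a' b' c') =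
        MvPolynomial.aeval (lineThrough ![0, 0, 1] ![μ * t + 1, t, 0]) (quadForm k a b c) := by
      rw [← hE', ← linSubst_linSubst, hE, aeval_linSubst]
      congr 2
      funext i
      fin_cases i <;> simp [hSdef, lineThrough, Fin.sum_univ_three, algebraMap_eq]
      ring
    have h2 := congrArg (fun q => q.coeff k) h1
    rw [coeff_line_vertex (by simp) (by simp), coeff_line_vertex (by simp) (by simp),
      aeval_binaryForm_of_eq_one (by simp) ha', hμ, binaryForm_C_mul, binaryForm_X_sub_C_pow] at h2
    simpa using h2
  rw [hconst] at hE'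
  exact ⟨_, _, _, b', c', hBA', leadingCoeff_ne_zero.2 ha0, hp', hb', hc', hE'⟩

theorem linSubst_binaryForm {D : Matrix (Fin 3) (Fin 3) ℂ}
    (h0 : ∑ j, MvPolynomial.C (D 0 j) * MvPolynomial.X j = (MvPolynomial.X 0 : MvPolynomial (Fin 3) ℂ))
    (h1 : ∑ j, MvPolynomial.C (D 1 j) * MvPolynomial.X j = (MvPolynomial.X 1 : MvPolynomial (Fin 3) ℂ))
    (N : ℕ) (q : ℂ[X]) : linSubst D (binaryForm N q) = binaryForm N q := by
  change MvPolynomial.aeval _ (MvPolynomial.rename _ _) = MvPolynomial.rename _ _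
  rw [MvPolynomial.aeval_rename, MvPolynomial.aeval_unique (MvPolynomial.rename Fin.castSucc)]
  congr 2
  funext i
  fin_cases i
  · simpa using h0
  · simpa using h1

/-- The normal form of a curve with a unibranched point of multiplicity `d - 2`. -/
theorem exists_isNormalForm (hk : 2 ≤ k) (hm : C.mult p = k) (hu : C.IsUnibranchedAt p) :
    ∃ (A B : Matrix (Fin 3) (Fin 3) ℂ) (b δ : ℂ[X]) (h : C.IsNormalForm A B b δ),
      δ.Monic ∧ h.vertex = p := by
  obtain ⟨A, B, α, b, c, hBA, hα, hp, hb, hc, hE⟩ :=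
    C.exists_second_coordinates (by omega) hm hu
  have hscale : quadForm k (Polynomial.C α) b c = MvPolynomial.C α *
      quadForm k 1 (Polynomial.C α⁻¹ * b) (Polynomial.C α⁻¹ * c) := by
    have hαα : (MvPolynomial.C α * MvPolynomial.C α⁻¹ : MvPolynomial (Fin 3) ℂ) = 1 := by
      rw [← map_mul, mul_inv_cancel₀ hα, map_one]
    rw [quadForm, quadForm, binaryForm_C, binaryForm_one, binaryForm_C_mul, binaryForm_C_mul]
    linear_combination -(2 * binaryForm (k + 1) b * MvPolynomial.X 2 + binaryForm (k + 2) c) * hαα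
  rw [hscale] at hE
  have hb1 := (natDegree_C_mul_le α⁻¹ b).trans hb
  have hc1 := (natDegree_C_mul_le α⁻¹ c).trans hc
  generalize Polynomial.C α⁻¹ * b = b₁ at *
  generalize Polynomial.C α⁻¹ * c = c₁ at *
  -- Otherwise `(z + b₁)² = 0` on the curve, against the independence of `1` and `z`.
  have hδ : b₁ ^ 2 - c₁ ≠ 0 := by
    intro h0
    obtain ⟨θ, hθ, h1⟩ := C.exists_chart hBA hα (by simp) hb1 hc1 one_ne_zero hE
    rw [aeval_quadForm_of_eq_one hθ.one (by simp) hb1 hc1] at h1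
    have h2 : (aeval (θ 0) b₁ + aeval (θ 0) (1 : ℂ[X]) * θ 2) ^ 2 = 0 := by
      have h3 := congrArg (aeval (θ 0)) h0
      simp only [map_sub, map_pow, map_zero, map_one] at h3 h1 ⊢
      linear_combination h1 + h3
    exact one_ne_zero (hθ.indep b₁ 1 (pow_eq_zero_iff two_ne_zero |>.1 h2)).2
  -- Replacing `z` by `γ z` divides the discriminant by `γ²` and makes it monic.
  obtain ⟨γ, hγ⟩ := IsAlgClosed.exists_pow_nat_eq (b₁ ^ 2 - c₁).leadingCoeff (n := 2) (by norm_num)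
  have hγ0 : γ ≠ 0 := by
    rintro rfl
    exact leadingCoeff_ne_zero.2 hδ (by rw [← hγ]; norm_num)
  have hD : (!![1, 0, 0; 0, 1, 0; 0, 0, γ⁻¹] * !![1, 0, 0; 0, 1, 0; 0, 0, γ] :
      Matrix (Fin 3) (Fin 3) ℂ) = 1 := by
    ext i j
    fin_cases i <;> fin_cases j <;> simp [Matrix.mul_apply, Fin.sum_univ_three, hγ0]
  set D : Matrix (Fin 3) (Fin 3) ℂ := !![1, 0, 0; 0, 1, 0; 0, 0, γ] with hDdef
  have hD2 : D.mulVec ![0, 0, 1] = γ • ![0, 0, 1] := by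
    funext i
    fin_cases i <;> simp [hDdef, Matrix.mulVec, dotProduct, Fin.sum_univ_three]
  have hBA' : (!![1, 0, 0; 0, 1, 0; 0, 0, γ⁻¹] * B) * (A * D) = 1 := by
    rw [Matrix.mul_assoc, ← Matrix.mul_assoc B, hBA, Matrix.one_mul, hD]
  have hE' : linSubst (A * D) C.poly = MvPolynomial.C (α * γ ^ 2) *
      quadForm k 1 (Polynomial.C γ⁻¹ * b₁) (Polynomial.C (γ⁻¹ ^ 2) * c₁) := by
    have hbin := fun N q => linSubst_binaryForm (D := D) (by simp [hDdef, Fin.sum_univ_three])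
      (by simp [hDdef, Fin.sum_univ_three]) N q
    have hX2 : linSubst D (MvPolynomial.X 2) = MvPolynomial.C γ * MvPolynomial.X 2 := by
      rw [linSubst, MvPolynomial.bind₁_X_right]
      simp [hDdef, Fin.sum_univ_three]
    have hγγ : (MvPolynomial.C γ * MvPolynomial.C γ⁻¹ : MvPolynomial (Fin 3) ℂ) = 1 := by
      rw [← map_mul, mul_inv_cancel₀ hγ0, map_one]
    rw [← linSubst_linSubst, hE, map_mul, quadForm, quadForm, binaryForm_C_mul, binaryForm_C_mul]
    simp only [map_add, map_mul, map_pow, hbin, hX2, map_ofNat]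
    rw [linSubst, MvPolynomial.bind₁_C_right]
    linear_combination -(MvPolynomial.C α * (2 * binaryForm (k + 1) b₁ * MvPolynomial.X 2 *
      MvPolynomial.C γ + binaryForm (k + 2) c₁ *
        (MvPolynomial.C γ * MvPolynomial.C γ⁻¹ + 1))) * hγγ
  have hu0 : α * γ ^ 2 ≠ 0 := mul_ne_zero hα (pow_ne_zero 2 hγ0)
  have hδ' : (Polynomial.C γ⁻¹ * b₁) ^ 2 - Polynomial.C (γ⁻¹ ^ 2) * (b₁ ^ 2 - c₁) =
      Polynomial.C (γ⁻¹ ^ 2) * c₁ := by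
    rw [map_pow]
    ring
  have hdegb := (natDegree_C_mul_le γ⁻¹ b₁).trans hb1
  have hdegc := (natDegree_C_mul_le (γ⁻¹ ^ 2) c₁).trans hc1
  rw [← hδ'] at hE' hdegc
  have hmonic : (Polynomial.C (γ⁻¹ ^ 2) * (b₁ ^ 2 - c₁)).Monic := by
    rw [Monic, leadingCoeff_mul, leadingCoeff_C, ← hγ, ← mul_pow, inv_mul_cancel₀ hγ0, one_pow]
  generalize Polynomial.C γ⁻¹ * b₁ = b₂ at *
  generalize Polynomial.C (γ⁻¹ ^ 2) * (b₁ ^ 2 - c₁) = δ at *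
  -- If both vanished, `y` would divide the irreducible equation.
  have hinf : b₂.coeff (k + 1) ≠ 0 ∨ (b₂ ^ 2 - δ).coeff (k + 2) ≠ 0 := by
    by_contra! h0
    refine C.not_dvd_of_isHomogeneous_one hBA' hu0 hE' (MvPolynomial.isHomogeneous_X ℂ 1) ?_
    have hdiv : ∀ {N : ℕ} {q : ℂ[X]}, q.natDegree ≤ N + 1 → q.coeff (N + 1) = 0 →
        MvPolynomial.X 1 ∣ binaryForm (N + 1) q := by
      intro N q hq hq0
      have h1 : q.natDegree ≤ N := by
        rw [natDegree_le_iff_coeff_eq_zero] at hq ⊢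
        intro j hj
        rcases (Nat.succ_le_of_lt hj).eq_or_lt with rfl | h2
        · exact hq0
        · exact hq j h2
      rw [add_comm, binaryForm_add_left 1 h1, pow_one]
      exact dvd_mul_right _ _
    refine dvd_add (dvd_add ?_ (((hdiv hdegb h0.1).mul_left _).mul_right _)) (hdiv hdegc h0.2)
    rw [binaryForm_one]
    exact (dvd_pow_self _ (by omega)).mul_right _
  refine ⟨_, _, b₂, δ, ⟨hk, hBA', ⟨_, hu0, hE'⟩, hdegb, hdegc, hinf⟩, hmonic, ?_⟩
  refine (Projectivization.eq_mk_of_rep _ (ρ := γ⁻¹) ?_).symm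
  rw [← Matrix.mulVec_mulVec, hD2, Matrix.mulVec_smul, ← hp, smul_smul, inv_mul_cancel₀ hγ0,
    one_smul]

end PlaneCurve

end ExistsNormalForm


/-! ### Cuspidal curves of type `(d, d - 2)` -/

section Classification

open Polynomial

theorem multSeq_replicate_injective {m n : ℕ}
    (h : multSeq (List.replicate m 2) = multSeq (List.replicate n 2)) : m = n := by
  by_contra hne
  wlog hlt : m < n generalizing m n
  · exact this h.symm (Ne.symm hne) (by omega)
  have h1 := congrFun h m
  rw [multSeq_replicate, multSeq_replicate, if_neg (lt_irrefl m), if_pos hlt] at h1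
  omega

theorem multSeq_cons_tail {m m' : ℕ} {l l' : List ℕ} (h : multSeq (m :: l) = multSeq (m' :: l')) :
    multSeq l = multSeq l' :=
  funext fun i => congrFun h (i + 1)

theorem QuadraticModel.exists_uniformizer {K : Type*} [Field K] [Algebra ℂ K] {s w : K} {f : ℂ[X]}
    (M : QuadraticModel K s w f) (hf : ∀ t, f.eval t = 0 → f.derivative.eval t ≠ 0) {g : ℕ}
    (hg : f.natDegree = 2 * g + 1 ∨ f.natDegree = 2 * g + 2) (V : CurvePlace K) :
    ∃ (π : K) (hπ : π ∈ V.ring), π ≠ 0 ∧ V.ring.valuation π < 1 ∧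
      IsLocalRing.maximalIdeal V.ring = Ideal.span {⟨π, hπ⟩} := by
  have key : ∀ {s w : K} {f : ℂ[X]} {t : ℂ}, QuadraticModel K s w f →
      (f.eval t = 0 → f.derivative.eval t ≠ 0) → V.HasValue s t →
      ∃ (π : K) (hπ : π ∈ V.ring), π ≠ 0 ∧ V.ring.valuation π < 1 ∧
        IsLocalRing.maximalIdeal V.ring = Ideal.span {⟨π, hπ⟩} := by
    intro s w f t M hf hV
    obtain ⟨c, hc⟩ := IsAlgClosed.exists_pow_nat_eq (f.eval t) (n := 2) (by norm_num)
    by_cases h0 : f.eval t = 0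
    · have hU := M.isUniformizerAt_of_root h0 (hf h0)
      have hV' := M.liesOver_of_root h0 hV
      exact ⟨w, hU.mem hV', hU.ne_zero, hU.val_lt_one hV', hU.maximalIdeal_eq hV'⟩
    · have hc0 : c ≠ 0 := by
        rintro rfl
        exact h0 (by rw [← hc]; norm_num)
      rcases M.liesOver_or hc hV with hV' | hV'
      · have hU := M.isUniformizerAt_of_ne (t := t) hc0
        exact ⟨_, hU.mem hV', hU.ne_zero, hU.val_lt_one hV', hU.maximalIdeal_eq hV'⟩
      · have hU := M.isUniformizerAt_of_ne (t := t) (neg_ne_zero.2 hc0)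
        exact ⟨_, hU.mem hV', hU.ne_zero, hU.val_lt_one hV', hU.maximalIdeal_eq hV'⟩
  rcases M.exists_value_or V with hV | ⟨t, hV⟩
  · exact key (M.reverse (n := g + 1) (by omega)) (QuadraticModel.reflect_simple_zero hg) hV
  · exact key M (hf t) hV

/-- The multiple roots come first, in the prescribed order `t`, and the simple roots follow; oddness
gives every exponent the form `2β + 1`. Keeping the order of `t` is what allows a comparison with a
given `Data`. -/
theorem exists_discPoly {δ : ℂ[X]} (hm : δ.Monic)
    (hodd : ∀ t, δ.eval t = 0 → Odd (δ.rootMultiplicity t)) {n : ℕ} {t : Fin n → ℂ}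
    (ht : Function.Injective t) (hmem : ∀ x, 2 ≤ δ.rootMultiplicity x ↔ ∃ i, x = t i) :
    ∃ (N : ℕ) (lam : Fin N → ℂ) (hn : n ≤ N), Function.Injective lam ∧
      δ = discPoly (fun i => (δ.rootMultiplicity (t i) - 1) / 2) lam ∧
      ∀ i, lam (Fin.castLE hn i) = t i := by
  classical
  set b : Fin n → ℕ := fun i => (δ.rootMultiplicity (t i) - 1) / 2 with hb
  set S := δ.roots.toFinset.filter fun x => δ.rootMultiplicity x = 1 with hS
  have hSmem : ∀ x, x ∈ S ↔ δ.rootMultiplicity x = 1 := by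
    intro x
    rw [hS, Finset.mem_filter, Multiset.mem_toFinset, mem_roots hm.ne_zero,
      ← rootMultiplicity_pos hm.ne_zero]
    omega
  set m := S.card with hmdef
  set r : Fin m → ℂ := fun i => (S.equivFin.symm i : ℂ) with hr
  have hr1 : ∀ i, δ.rootMultiplicity (r i) = 1 := fun i => (hSmem _).1 (S.equivFin.symm i).2
  have hrinj : Function.Injective r := Subtype.val_injective.comp S.equivFin.symm.injective
  set lam : Fin (n + m) → ℂ := Fin.append t r with hlamdef
  have hlam : Function.Injective lam := by
    intro i j hij
    have hne : ∀ i j, t i ≠ r j := by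
      intro i j h
      have h1 := (hmem _).2 ⟨i, rfl⟩
      rw [h, hr1] at h1
      omega
    induction i using Fin.addCases with
    | left i =>
      induction j using Fin.addCases with
      | left j =>
        rw [hlamdef, Fin.append_left, Fin.append_left] at hij
        rw [ht hij]
      | right j =>
        rw [hlamdef, Fin.append_left, Fin.append_right] at hij
        exact absurd hij (hne _ _)
    | right i =>
      induction j using Fin.addCases with
      | left j =>
        rw [hlamdef, Fin.append_left, Fin.append_right] at hij
        exact absurd hij.symm (hne _ _)
      | right j =>
        rw [hlamdef, Fin.append_right, Fin.append_right] at hij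
        rw [hrinj hij]
  have hleft : ∀ i : Fin n, Fin.castLE (Nat.le_add_right n m) i = Fin.castAdd m i := fun i => rfl
  refine ⟨n + m, lam, Nat.le_add_right n m, hlam, ?_, fun i => ?_⟩
  · have hmon := monic_discPoly b lam
    have hroots : δ.roots = (discPoly b lam).roots := by
      ext x
      rw [count_roots, count_roots]
      by_cases h0 : (discPoly b lam).eval x = 0
      · obtain ⟨i, -, rfl⟩ := exists_of_eval_rootProduct h0
        rw [discPoly, rootMultiplicity_rootProduct hlam]
        induction i using Fin.addCases with
        | left i =>
          rw [← hleft, extendMult_castLE, hleft, hlamdef, Fin.append_left, hb]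
          have h2 := (hmem _).2 ⟨i, rfl⟩
          obtain ⟨j, hj⟩ := hodd (t i) ((rootMultiplicity_pos hm.ne_zero).1 (by omega))
          beta_reduce
          rw [hj]
          omega
        | right i =>
          rw [hlamdef, Fin.append_right, hr1, extendMult, dif_neg (by simp)]
      · rw [rootMultiplicity_eq_zero h0]
        by_contra h1
        have h2 : δ.rootMultiplicity x = 1 ∨ 2 ≤ δ.rootMultiplicity x := by omega
        have h3 : ∃ i, x = lam i := by
          rcases h2 with h2 | h2
          · refine ⟨Fin.natAdd n (S.equivFin ⟨x, (hSmem x).2 h2⟩), ?_⟩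
            rw [hlamdef, Fin.append_right, hr]
            simp
          · obtain ⟨i, hi⟩ := (hmem x).1 h2
            exact ⟨Fin.castAdd m i, by rw [hlamdef, Fin.append_left, hi]⟩
        obtain ⟨i, rfl⟩ := h3
        have h4 := rootMultiplicity_rootProduct hlam (fun i => 2 * extendMult b (n + m) i + 1) i
        apply h0
        apply (rootMultiplicity_pos hmon.ne_zero).1
        rw [discPoly, h4]
        omega
    rw [(IsAlgClosed.splits δ).eq_prod_roots_of_monic hm, hroots,
      ← (IsAlgClosed.splits (discPoly b lam)).eq_prod_roots_of_monic hmon]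
  · rw [hleft, hlamdef, Fin.append_left]

namespace PlaneCurve

namespace IsNormalForm

variable {k : ℕ} {C : PlaneCurve (k + 2)} {A B : Matrix (Fin 3) (Fin 3) ℂ} {p δ : ℂ[X]}

/-- With `δ = Q² f`, a root of `δ` that is not a root of `f` is a root of `Q` and gives a singular
point with two branches. So `f(t) = 0`, and this root of `f` is simple. -/
theorem odd_rootMultiplicity (h : C.IsNormalForm A B p δ) (hδ : δ ≠ 0) (hc : C.IsCuspidal) {t : ℂ}
    (ht : δ.eval t = 0) : Odd (δ.rootMultiplicity t) := by
  obtain ⟨Q, f, hQ, hf, hs⟩ := Polynomial.exists_sq_mul_simple hδ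
  have hf0 : f ≠ 0 := by
    rintro rfl
    exact hδ (by rw [hf, mul_zero])
  have hft : f.eval t = 0 := by
    by_contra h0
    have hQt : Q.eval t = 0 := by
      rw [hf, eval_mul, eval_pow] at ht
      simpa [h0] using ht
    have hdvd : (X - Polynomial.C t) ^ 2 ∣ δ := by
      rw [hf]
      exact (pow_dvd_pow_of_dvd (dvd_iff_isRoot.2 hQt) 2).mul_right f
    exact h0 (h.eval_eq_zero_of_isUnibranchedAt hQ hf hQt
      (hc _ (h.mem_singularPoints_iff.2 (Or.inr ⟨t, hdvd, rfl⟩))))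
  have h1 : f.rootMultiplicity t = 1 := by
    have h2 := (rootMultiplicity_pos hf0).2 hft
    have h3 : ¬ 1 < f.rootMultiplicity t := fun h3 =>
      hs t hft ((one_lt_rootMultiplicity_iff_isRoot hf0).1 h3).2
    omega
  rw [hf, rootMultiplicity_mul (hf ▸ hδ), h1, pow_two, rootMultiplicity_mul (mul_ne_zero hQ hQ)]
  exact ⟨Q.rootMultiplicity t, by ring⟩

theorem hasMultSeq_unique {n N : ℕ} {b : Fin n → ℕ} {lam : Fin N → ℂ}
    (h : C.IsNormalForm A B p (discPoly b lam)) (hlam : Function.Injective lam)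
    {q : ℙ ℂ (Fin 3 → ℂ)} {m m' : ℕ → ℕ} (h1 : C.HasMultSeq q m) (h2 : C.HasMultSeq q m') :
    m = m' := by
  obtain ⟨θ, w, hθ, M, -⟩ := h.exists_model (monic_rootProduct lam _).ne_zero (rootProduct_odd lam _)
  obtain ⟨V, hV, -⟩ := h1.1
  have hN := h.pos_of_discPoly
  obtain ⟨π, hπ, hπ0, hπ1, hmax⟩ := M.exists_uniformizer
    (fun t => derivative_rootProduct_one_ne hlam) (g := (N - 1) / 2) (by
      rw [natDegree_rootProduct]
      simp
      omega) V
  funext i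
  exact CurvePlace.branchMultiplicity_unique hπ hπ0 hπ1 hmax (h1.2 V hV i) (h2.2 V hV i)

/-- An enumeration of the roots of the discriminant. -/
theorem exists_enumeration (h : C.IsNormalForm A B p δ) (hm : δ.Monic) (hc : C.IsCuspidal) :
    ∃ (n N : ℕ) (b : Fin n → ℕ) (lam : Fin N → ℂ), n ≤ N ∧ Function.Injective lam ∧
      (∀ i, 0 < b i) ∧ δ = discPoly b lam := by
  classical
  set S := δ.roots.toFinset.filter fun x => 2 ≤ δ.rootMultiplicity x with hS
  have hSmem : ∀ x, x ∈ S ↔ 2 ≤ δ.rootMultiplicity x := by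
    intro x
    rw [hS, Finset.mem_filter, Multiset.mem_toFinset, mem_roots hm.ne_zero,
      ← rootMultiplicity_pos hm.ne_zero]
    omega
  have hodd : ∀ t, δ.eval t = 0 → Odd (δ.rootMultiplicity t) := fun t =>
    h.odd_rootMultiplicity hm.ne_zero hc
  obtain ⟨N, lam, hn, hlam, hδ, -⟩ := exists_discPoly hm hodd
    (t := fun i => (S.equivFin.symm i : ℂ))
    (Subtype.val_injective.comp S.equivFin.symm.injective) (by
      intro x
      rw [← hSmem]
      constructor
      · intro hx
        exact ⟨S.equivFin ⟨x, hx⟩, by simp⟩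
      · rintro ⟨i, rfl⟩
        exact (S.equivFin.symm i).2)
  refine ⟨_, N, _, lam, hn, hlam, fun i => ?_, hδ⟩
  have h2 := (hSmem _).1 (S.equivFin.symm i).2
  obtain ⟨j, hj⟩ := hodd (S.equivFin.symm i : ℂ) ((rootMultiplicity_pos hm.ne_zero).1 (by omega))
  rw [hj] at h2 ⊢
  omega

end IsNormalForm

theorem IsOfType.exists_point {d ν : ℕ} {C : PlaneCurve d} (h : C.IsOfType ν) :
    2 ≤ ν ∧ ∃ p ∈ C.singularPoints, C.mult p = ν := by
  obtain ⟨⟨p, hp, hm⟩, -⟩ := h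
  exact ⟨hm ▸ hp, p, hp, hm⟩

variable {k g : ℕ} {C : PlaneCurve (k + 2)}

/-- A cuspidal curve of type `(d, d - 2)` belongs to one of the families. -/
theorem exists_family (ht : C.IsOfType k) (hg : C.genus = g) (hc : C.IsCuspidal) :
    ∃ (n : ℕ) (b : Fin n → ℕ), (AdmissibleA g k b ∧ IsInFamilyA g k b C.poly) ∨
      (∃ l, k = 2 * l + 1 ∧ AdmissibleB g l b ∧ IsInFamilyB g l b C.poly) ∨
      (∃ l j, k = 2 * l ∧ AdmissibleC g l j b ∧ IsInFamilyC g l j b C.poly) := by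
  obtain ⟨hk, p, hp, hm⟩ := ht.exists_point
  obtain ⟨A, B, q, δ, h, hδ, hv⟩ := C.exists_isNormalForm hk hm (hc p hp)
  obtain ⟨n, N, b, lam, hn, hlam, hb, rfl⟩ := h.exists_enumeration hδ hc
  refine ⟨n, b, ?_⟩
  rcases h.classification hlam hn hb (hv ▸ hc p hp) hg with h1 | ⟨l, h1⟩ | ⟨l, j, h1⟩
  · exact Or.inl ⟨h1.1, h1.2.1⟩
  · exact Or.inr (Or.inl ⟨l, h1.1, h1.2.1, h1.2.2.1⟩)
  · exact Or.inr (Or.inr ⟨l, j, h1.1, h1.2.1, h1.2.2.1⟩)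

/-- A normal form is taken at some point of multiplicity `k`, perhaps another one. The given point
is either its vertex or a double point whose sequence begins with `2`, in which case `k = 2`. -/
theorem mult_eq_of_hasMultSeq (ht : C.IsOfType k) (hc : C.IsCuspidal) {p : ℙ ℂ (Fin 3 → ℂ)}
    (hp : p ∈ C.singularPoints) {l : List ℕ} (hs : C.HasMultSeq p (multSeq (k :: l))) :
    C.mult p = k := by
  obtain ⟨hk, p', hp', hm'⟩ := ht.exists_point
  obtain ⟨A, B, q, δ, h, hδ, hv⟩ := C.exists_isNormalForm hk hm' (hc p' hp')
  obtain ⟨n, N, b, lam, hn, hlam, hb, rfl⟩ := h.exists_enumeration hδ hc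
  rcases h.mem_singularPoints_iff.1 hp with rfl | ⟨t, ht, rfl⟩
  · exact h.mult_vertex
  · obtain ⟨i, hi, rfl⟩ := (sq_dvd_rootProduct_odd_iff hlam _ t).1 ht
    have h1 := congrFun (h.hasMultSeq_unique hlam hs (h.hasMultSeq_root hlam i)) 0
    rw [multSeq_cons_zero, multSeq_replicate, if_pos (Nat.pos_of_ne_zero hi)] at h1
    rw [h.mult_pointAt ht, h1]

/-- The numbers in `Data(C)` are the parameters of the family. -/
theorem family_of_hasData (ht : C.IsOfType k) (hg : C.genus = g) {n : ℕ} {b : Fin n → ℕ}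
    (hb : ∀ i, 0 < b i) {l : List ℕ} (hD : C.HasData (cuspData (k :: l) b)) :
    (AdmissibleA g k b ∧ IsInFamilyA g k b C.poly ∧ multSeq l = multSeq []) ∨
      (∃ m, k = 2 * m + 1 ∧ AdmissibleB g m b ∧ IsInFamilyB g m b C.poly ∧
        multSeq l = multSeq (List.replicate m 2)) ∨
      (∃ m j, k = 2 * m ∧ AdmissibleC g m j b ∧ IsInFamilyC g m j b C.poly ∧
        multSeq l = multSeq (List.replicate (m + j) 2)) := by
  have hc := hD.isCuspidal
  obtain ⟨e, he0, he⟩ := (C.hasData_cuspData_iff _ _).1 hD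
  have hk := ht.exists_point.1
  have hm := mult_eq_of_hasMultSeq ht hc (e 0).2 he0
  -- The vertex must be the point numbered `0`: when `k = 2`, all singular points have multiplicity
  -- `k`.
  obtain ⟨A, B, q, δ, h, hδ, hv⟩ := C.exists_isNormalForm hk hm (hc _ (e 0).2)
  have hpt : ∀ i : Fin n, ∃ t, (X - Polynomial.C t) ^ 2 ∣ δ ∧
      (e i.succ : ℙ ℂ (Fin 3 → ℂ)) = h.pointAt t := by
    intro i
    refine (h.mem_singularPoints_iff.1 (e i.succ).2).resolve_left fun h1 => ?_
    rw [hv] at h1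
    exact Fin.succ_ne_zero i (e.injective (Subtype.ext h1))
  choose t ht1 ht2 using hpt
  have htinj : Function.Injective t := by
    intro i j hij
    have h1 : (e i.succ : ℙ ℂ (Fin 3 → ℂ)) = e j.succ := by rw [ht2, ht2, hij]
    exact Fin.succ_injective _ (e.injective (Subtype.ext h1))
  obtain ⟨N, lam, hn, hlam, hdisc, hlt⟩ := exists_discPoly hδ
    (fun t => h.odd_rootMultiplicity hδ.ne_zero hc) htinj (by
      intro x
      rw [le_rootMultiplicity_iff hδ.ne_zero]
      constructor
      · intro hx
        obtain ⟨j, hj⟩ := e.surjective ⟨_, h.mem_singularPoints_iff.2 (Or.inr ⟨x, hx, rfl⟩)⟩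
        have hj' := congrArg Subtype.val hj
        cases j using Fin.cases with
        | zero =>
          rw [← hv] at hj'
          exact absurd hj'.symm (h.pointAt_ne_vertex x)
        | succ j =>
          rw [ht2] at hj'
          exact ⟨j, (h.pointAt_injective hj').symm⟩
      · rintro ⟨i, rfl⟩
        exact ht1 i)
  generalize hb' : (fun i => (δ.rootMultiplicity (t i) - 1) / 2) = b' at hdisc
  clear hb'
  subst hdisc
  obtain rfl : b' = b := by
    funext i
    apply multSeq_replicate_injective
    refine h.hasMultSeq_unique hlam (q := e i.succ) ?_ (he i)
    have h1 := h.hasMultSeq_root hlam (Fin.castLE hn i)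
    rwa [extendMult_castLE, hlt, ← ht2] at h1
  rw [← hv] at he0
  have huniq : ∀ {l' : List ℕ}, C.HasMultSeq h.vertex (multSeq (k :: l')) →
      multSeq l = multSeq l' := fun h1 => multSeq_cons_tail (h.hasMultSeq_unique hlam he0 h1)
  rcases h.classification hlam hn hb he0.1 hg with ⟨h1, h2, h3⟩ | ⟨m, h0, h1, h2, h3⟩ |
      ⟨m, j, h0, h1, h2, h3⟩
  · exact Or.inl ⟨h1, h2, huniq h3⟩
  · exact Or.inr (Or.inl ⟨m, h0, h1, h2, huniq h3⟩)
  · exact Or.inr (Or.inr ⟨m, j, h0, h1, h2, huniq h3⟩)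

end PlaneCurve

theorem multSeq_nil_ne_replicate {m : ℕ} (hm : 0 < m) :
    multSeq [] ≠ multSeq (List.replicate m 2) := by
  intro h
  have := multSeq_replicate_injective (m := 0) h
  omega

theorem coeff_dehom_gPoly (k : ℕ) (c : ℕ → ℂ) {j : ℕ} (hj : j ≤ k + 1) :
    (dehom (gPoly k c)).coeff j = c j := by
  rw [gPoly_eq, dehom_binaryForm (natDegree_gBase_le k c), coeff_reflect, revAt_le hj,
    coeff_gBase _ _ (Nat.sub_le _ _), Nat.sub_sub_self hj]

theorem coeff_zero_dehom_oddProduct {n N : ℕ} (b : Fin n → ℕ) (hn : n ≤ N) (lam : Fin N → ℂ) :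
    (dehom (oddProduct b lam)).coeff 0 = 1 := by
  have hdeg := natDegree_discPoly (b := b) hn lam
  rw [oddProduct_eq b hn lam rfl]
  change (dehom (binaryForm _ (discPoly b lam))).coeff 0 = 1
  rw [dehom_binaryForm hdeg.le, coeff_reflect, revAt_le (Nat.zero_le _), Nat.sub_zero]
  have := (monic_discPoly b lam).coeff_natDegree
  rwa [hdeg] at this

/-- The condition `yᵏ ∣ G(1, y)² - Δ(1, y)` in terms of the coefficients. -/
theorem divCond_iff_recursion {n N k : ℕ} (hk : 0 < k) (b : Fin n → ℕ) (hn : n ≤ N)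
    (lam : Fin N → ℂ) (c : ℕ → ℂ) : DivCond k b lam c ↔
      (c 0 = 1 ∨ c 0 = -1) ∧ ∀ j, 1 ≤ j → j < k →
        c j = ((dehom (oddProduct b lam)).coeff j -
          ∑ i ∈ Finset.Ico 1 j, c i * c (j - i)) / (2 * c 0) := by
  have h0 : ∀ j < k, (dehom (gPoly k c) ^ 2 - dehom (oddProduct b lam)).coeff j =
      (∑ i ∈ Finset.range (j + 1), c i * c (j - i)) - (dehom (oddProduct b lam)).coeff j := by
    intro j hj
    rw [coeff_sub, pow_two, coeff_mul, Finset.Nat.sum_antidiagonal_eq_sum_range_succ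
      (fun i l => (dehom (gPoly k c)).coeff i * (dehom (gPoly k c)).coeff l)]
    congr 1
    refine Finset.sum_congr rfl fun i hi => ?_
    rw [Finset.mem_range] at hi
    rw [coeff_dehom_gPoly k c (by omega), coeff_dehom_gPoly k c (by omega)]
  -- Only the terms `i = 0` and `i = j` contain `c j`, which makes the equation for `c j` linear.
  -- The equation for `j = 0` is `c₀² = 1`.
  have hsplit : ∀ j, 1 ≤ j → ∑ i ∈ Finset.range (j + 1), c i * c (j - i) =
      2 * c 0 * c j + ∑ i ∈ Finset.Ico 1 j, c i * c (j - i) := by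
    intro j hj
    rw [Finset.sum_range_succ, Finset.range_eq_Ico, Finset.sum_eq_sum_Ico_succ_bot (by omega)]
    simp
    ring
  rw [DivCond, X_pow_dvd_iff]
  have hc0 : (dehom (gPoly k c) ^ 2 - dehom (oddProduct b lam)).coeff 0 = 0 ↔
      c 0 = 1 ∨ c 0 = -1 := by
    rw [h0 0 hk, coeff_zero_dehom_oddProduct b hn, ← mul_self_eq_one_iff]
    simp [sub_eq_zero]
  have hcj : ∀ j, 1 ≤ j → j < k → c 0 ≠ 0 →
      ((dehom (gPoly k c) ^ 2 - dehom (oddProduct b lam)).coeff j = 0 ↔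
        c j = ((dehom (oddProduct b lam)).coeff j -
          ∑ i ∈ Finset.Ico 1 j, c i * c (j - i)) / (2 * c 0)) := by
    intro j hj hjk h
    rw [h0 j hjk, hsplit j hj, eq_div_iff (mul_ne_zero two_ne_zero h)]
    constructor
    · intro h1
      linear_combination h1
    · intro h1
      linear_combination h1
  have hne : (c 0 = 1 ∨ c 0 = -1) → c 0 ≠ 0 := by
    rintro (h | h) <;> rw [h] <;> norm_num
  constructor
  · intro h
    have h1 := hc0.1 (h 0 hk)
    exact ⟨h1, fun j hj hjk => (hcj j hj hjk (hne h1)).1 (h j hjk)⟩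
  · rintro ⟨h1, h2⟩ j hj
    rcases Nat.eq_zero_or_pos j with rfl | hj0
    · exact hc0.2 h1
    · exact (hcj j hj0 hj (hne h1)).2 (h2 j hj0 hj)

end Classification

theorem mainTheorem4 (g : ℕ) :
    -- all cuspidal curves of type `(d, d - 2)` and genus `g`
    (∀ (d : ℕ) (P : MvPolynomial (Fin 3) ℂ),
      (∃ C : PlaneCurve d, C.poly = P ∧ C.IsOfType (d - 2) ∧ C.genus = g ∧ C.IsCuspidal) ↔
        (∃ (k n : ℕ) (b : Fin n → ℕ), d = k + 2 ∧ AdmissibleA g k b ∧ IsInFamilyA g k b P) ∨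
        (∃ (k n : ℕ) (b : Fin n → ℕ), d = 2 * k + 3 ∧ AdmissibleB g k b ∧ IsInFamilyB g k b P) ∨
        (∃ (k j n : ℕ) (b : Fin n → ℕ),
          d = 2 * k + 2 ∧ AdmissibleC g k j b ∧ IsInFamilyC g k j b P)) ∧
    -- class (a)
    (∀ (k n : ℕ) (b : Fin n → ℕ) (P : MvPolynomial (Fin 3) ℂ), AdmissibleA g k b →
      ((∃ C : PlaneCurve (k + 2), C.poly = P ∧ C.IsOfType k ∧ C.genus = g ∧
          C.HasData (cuspData [k] b)) ↔ IsInFamilyA g k b P)) ∧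
    -- class (b)
    (∀ (k n : ℕ) (b : Fin n → ℕ) (P : MvPolynomial (Fin 3) ℂ), AdmissibleB g k b →
      ((∃ C : PlaneCurve (2 * k + 3), C.poly = P ∧ C.IsOfType (2 * k + 1) ∧ C.genus = g ∧
          C.HasData (cuspData ((2 * k + 1) :: List.replicate k 2) b)) ↔ IsInFamilyB g k b P)) ∧
    -- class (c)
    (∀ (k j n : ℕ) (b : Fin n → ℕ) (P : MvPolynomial (Fin 3) ℂ), AdmissibleC g k j b →
      ((∃ C : PlaneCurve (2 * k + 2), C.poly = P ∧ C.IsOfType (2 * k) ∧ C.genus = g ∧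
          C.HasData (cuspData ((2 * k) :: List.replicate (k + j) 2) b)) ↔
        IsInFamilyC g k j b P)) ∧
    -- the coefficients in class (a)
    (∀ (k n : ℕ) (b : Fin n → ℕ) (lam : Fin (2 * g + 2) → ℂ) (c : ℕ → ℂ), AdmissibleA g k b →
      (DivCond k b lam c ↔
        (c 0 = 1 ∨ c 0 = -1) ∧ ∀ j, 1 ≤ j → j < k →
          c j = ((dehom (oddProduct b lam)).coeff j -
            ∑ i ∈ Finset.Ico 1 j, c i * c (j - i)) / (2 * c 0)) ∧
      (DivCond k b lam c →
        MvPolynomial.X 1 ^ k * hPoly k b lam c = gPoly k c ^ 2 - oddProduct b lam)) := by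
  refine ⟨fun d P => ⟨?_, ?_⟩, fun k n b P ha => ⟨?_, exists_planeCurve_A ha⟩,
    fun k n b P ha => ⟨?_, exists_planeCurve_B ha⟩,
    fun k j n b P ha => ⟨?_, exists_planeCurve_C ha⟩, fun k n b lam c ha => ⟨?_, fun h => ?_⟩⟩
  · rintro ⟨C, rfl, ht, hg, hc⟩
    obtain ⟨k, rfl⟩ : ∃ k, d = k + 2 := by
      have := ht.exists_point.1
      exact ⟨d - 2, by omega⟩
    obtain ⟨n, b, ⟨ha, hf⟩ | ⟨l, rfl, ha, hf⟩ | ⟨l, j, rfl, ha, hf⟩⟩ := C.exists_family ht hg hc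
    · exact Or.inl ⟨k, n, b, rfl, ha, hf⟩
    · exact Or.inr (Or.inl ⟨l, n, b, rfl, ha, hf⟩)
    · exact Or.inr (Or.inr ⟨l, j, n, b, rfl, ha, hf⟩)
  · rintro (⟨k, n, b, rfl, ha, hf⟩ | ⟨k, n, b, rfl, ha, hf⟩ | ⟨k, j, n, b, rfl, ha, hf⟩)
    · obtain ⟨C, h1, h2, h3, h4⟩ := exists_planeCurve_A ha hf
      exact ⟨C, h1, h2, h3, h4.isCuspidal⟩
    · obtain ⟨C, h1, h2, h3, h4⟩ := exists_planeCurve_B ha hf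
      exact ⟨C, h1, h2, h3, h4.isCuspidal⟩
    · obtain ⟨C, h1, h2, h3, h4⟩ := exists_planeCurve_C ha hf
      exact ⟨C, h1, h2, h3, h4.isCuspidal⟩
  · rintro ⟨C, rfl, ht, hg, hD⟩
    obtain ⟨-, hf, -⟩ | ⟨m, -, ha', -, hl⟩ | ⟨m, j, -, ha', -, hl⟩ :=
      C.family_of_hasData ht hg ha.2.1 hD
    · exact hf
    -- Class (a) has no two after `k`, while (b) and (c) have at least one; the parity of `k` tells
    -- (b) from (c).
    · exact (multSeq_nil_ne_replicate ha'.1 hl).elim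
    · exact (multSeq_nil_ne_replicate (Nat.add_pos_left ha'.1 j) hl).elim
  · rintro ⟨C, rfl, ht, hg, hD⟩
    obtain ⟨-, -, hl⟩ | ⟨m, hm, -, hf, -⟩ | ⟨m, j, hm, -, -, -⟩ :=
      PlaneCurve.family_of_hasData (k := 2 * k + 1) (C := C) ht hg ha.2.1 hD
    · exact (multSeq_nil_ne_replicate ha.1 hl.symm).elim
    · obtain rfl : k = m := by omega
      exact hf
    · omega
  · rintro ⟨C, rfl, ht, hg, hD⟩
    obtain ⟨-, -, hl⟩ | ⟨m, hm, -, -, -⟩ | ⟨m, i, hm, -, hf, hl⟩ :=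
      PlaneCurve.family_of_hasData (k := 2 * k) (C := C) ht hg ha.2.1 hD
    · exact (multSeq_nil_ne_replicate (Nat.add_pos_left ha.1 j) hl.symm).elim
    · omega
    · obtain rfl : k = m := by omega
      obtain rfl : j = i := by
        have := multSeq_replicate_injective hl
        omega
      exact hf
  · exact divCond_iff_recursion (by have := ha.1; omega) b ha.2.2.1 lam c
  · have hN : 2 * k + 2 = 2 * g + 2 + 2 * ∑ i, b i := by
      have := ha.2.2.2
      omega
    exact (X_pow_mul_hPoly ha.2.2.1 hN ((divCond_iff ha.2.2.1 hN).1 h)).2
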